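/- Let $K$ be a field of characteristic $0$ and $N\ge 0$ an integer. Functions of $t=(x,s,t_1,t_2,\dots)$ are formal power series over $K$ in these variables. All series in $k$ lie in the ring $\mathcal R_K=K((k^{-1}))[[x,s,t_1,t_2,\dots]]$, and infinite sums are formal: for each monomial in $t$, the terms form a summable family of Laurent series in $k^{-1}$. For $A=\sum_i A_ik^i$ put $A_S=\sum_{i\in S}A_ik^i$ and $\operatorname{Res}A\,dk=A_{-1}$, and write $\operatorname{ad}A(B)=\{A,B\}=\partial_kA\,\partial_xB-\partial_kB\,\partial_xA$. If $P=k^N+p_{N-1}(t)k^{N-1}+\dots+p_0(t)$, then $\log P=N\log k+\log(1+p_{N-1}k^{-1}+\dots+p_0k^{-N})$, and similarly for $\log L^N$. A solution of the dcmKP hierarchy consists of $L=k+\sum_{n\ge0}u_{n+1}(t)k^{-n}$ and a monic polynomial $P$ of degree $N$ in $k$ as above with $$\partial_{t_n}L=\{B_n,L\},\quad B_n=(L^n)_{>0},\qquad \partial_sL=\{\log P,L\},\qquad \partial_{t_n}\log P=\partial_s(L^n)_{\ge0}-\{\log P,B_n\}\qquad(n\ge1),$$ together with a dressing function $\varphi=\sum_{n\ge0}\varphi_n(t)k^{-n}$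 and an Orlov function $M$, i.e. $$L=e^{\operatorname{ad}\varphi}k,\qquad M=e^{\operatorname{ad}\varphi}\Big(\sum_{n\ge1}nt_nk^{n-1}+x+\tfrac{Ns}{k}\Big)=\sum_{n\ge1}nt_nL^{n-1}+x+\tfrac{Ns}{L}+\sum_{n\ge1}v_nL^{-n-1},$$ $$\nabla_{t_n,\varphi}\varphi=-(L^n)_{\le0}\quad(n\ge 1),\qquad \nabla_{s,\varphi}\varphi=\log P-\log L^N\ \text{ up to a function of }t\text{ alone (a } k^0\text{-term)},$$ where $\nabla_{\partial,\varphi}\varphi=\sum_{r\ge0}\frac{(\operatorname{ad}\varphi)^r}{(r+1)!}\,\partial\varphi$ for a derivation $\partial$. A potential $\phi(t)$ of $L$ is a function with $\partial_{t_n}\phi=(L^n)_0$ for all $n\ge1$, and a potential $\Phi(t)$ of $(L,P)$ is a function with $\partial_{t_n}\Phi=\operatorname{Res}L^n\,d_k\log P$ for all $n\ge1$; both are required to depend on $x$ and $t_1$ only through $x+t_1$. A function $f(k,x)$, possibly with $s$ as a parameter, is a series $\sum f_{iab}k^ix^as^b$ ($i\in\mathbb Z$, $a,b\ge0$) with the exponents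 $i$ bounded above, and $f(L,M)=\sum f_{iab}L^iM^as^b$. Twistor data of a solution is a pair $(f,g)$ of such functions with $\{f,g\}=1$, $f(L,M)_{\le0}=0$ and $g(L,M)_{<0}=0$. All these notions are used also over the dual numbers $K[\varepsilon]/(\varepsilon^2)$. Let $(L,P,\varphi,M,v)$ be a solution over $K$ with twistor data $(f,g)$, and let $F=F(k,x)$ be a function as above that does not depend on $s$. Let $(L(\varepsilon),P(\varepsilon),\varphi(\varepsilon),M(\varepsilon),v(\varepsilon))$ be a solution over $K[\varepsilon]/(\varepsilon^2)$ which reduces to the given solution at $\varepsilon=0$ and has twistor data $(f,g)\circ\exp(-\varepsilon\operatorname{ad}F)=(f-\varepsilon\{F,f\},\,g-\varepsilon\{F,g\})$. Denote by $\delta_F$ the coefficient of $\varepsilon$. Then the sum defining $F(L,M)$ converges, and: 1. $\delta_FL=\{F(L,M)_{\le0},L\}$, $\ \delta_FM=\{F(L,M)_{\le0},M\}$, $\ \delta_F\log P=\partial_sF(L,M)_{<0}+\{F(L,M)_{\le0},\log P\}$. 2. $\delta_Fv_n=-\operatorname{Res}F(L,M)\,d_kB_n$ for all $n\ge1$. 3.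 If $\varphi+\varepsilon\,\delta_F\varphi$ is a dressing function of the deformed solution with Orlov function $M(\varepsilon)$, then there is a function $c$ of $s$ alone with $$\nabla_{\delta_F,\varphi}\varphi=\sum_{r\ge0}\frac{(\operatorname{ad}\varphi)^r}{(r+1)!}\,\delta_F\varphi=F(L,M)_{\le0}+c,\qquad \delta_F\varphi=\frac{\operatorname{ad}\varphi}{e^{\operatorname{ad}\varphi}-1}\,F(L,M)_{\le0}+c,$$ where $\frac{T}{e^T-1}$ is read as a power series in $T$. Conversely, for every function $c$ of $s$ alone, the $\delta_F\varphi$ given by the last formula makes $\varphi+\varepsilon\,\delta_F\varphi$ such a dressing function. 4. Let $\phi$ be a potential of $L$. Then $\phi+\varepsilon\,\delta_F\phi$ is a potential of $L(\varepsilon)$ if and only if $\delta_F\phi=-F(L,M)_0$ up to a function of $s$. 5. Let $\Phi$ be a potential of $(L,P)$. Then $\Phi+\varepsilon\,\delta_F\Phi$ is a potential of $(L(\varepsilon),P(\varepsilon))$ if and only if $\delta_F\Phi=-\operatorname{Res}F(L,M)\,d_k\log P$ up to a function of $s$. -/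

import Mathlib

noncomputable section

namespace DcmKP

/-- The independent variables `x`, `s`, `t₁, t₂, …`. -/
inductive Var : Type
  | x : Var
  | s : Var
  | t (n : ℕ+) : Var
  deriving DecidableEq

/-- "Functions of `t = (x, s, t₁, t₂, …)`": formal power series in the independent variables. -/
abbrev Coef (R : Type*) : Type _ := MvPowerSeries Var R

/-- The ring `R((k⁻¹))[[x, s, t₁, t₂, …]]` of formal series in `k` with coefficients in `Coef R`.
A Laurent series is written in the uniformizer `k⁻¹`, so the coefficient of `k ^ m` is the
coefficient of index `-m`. For every monomial in the `t`-variables the powers of `k` are bounded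
above, but there need not be a common bound: sums such as `∑ n t_n k ^ (n - 1)` are allowed. -/
abbrev Ser (R : Type*) [Zero R] : Type _ := MvPowerSeries Var (LaurentSeries R)

section Basic

variable {R : Type*} [CommRing R]

/-- The coefficient of `k ^ m`, a function of `t`. -/
def kCoeff (m : ℤ) (A : Ser R) : Coef R :=
  fun d => (MvPowerSeries.coeff d A).coeff (-m)

/-- `Res A dk`: the coefficient of `k⁻¹`. -/
def res (A : Ser R) : Coef R := kCoeff (-1) A

/-- A function of `t`, as a series in `k` with only the power `k ^ 0`. -/
def cst (c : Coef R) : Ser R := MvPowerSeries.map (HahnSeries.C : R →+* LaurentSeries R) c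

/-- The monomial `k ^ m`. -/
def kPow (m : ℤ) : Ser R := MvPowerSeries.C (HahnSeries.single (-m) (1 : R))

open Classical in
/-- `(A)_S`: the part of `A` with powers of `k` in `S`. -/
def part (S : Set ℤ) (A : Ser R) : Ser R := fun d =>
  { coeff := fun j => if -j ∈ S then (MvPowerSeries.coeff d A).coeff j else 0
    isPWO_support' := (MvPowerSeries.coeff d A).isPWO_support.mono (by
      intro j hj
      simp only [Function.mem_support, ne_eq, ite_eq_right_iff, Classical.not_imp] at hj
      exact hj.2) }

/-- `(A)_{> 0}`. -/
def pos (A : Ser R) : Ser R := part {m | 0 < m} A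
/-- `(A)_{≥ 0}`. -/
def nonneg (A : Ser R) : Ser R := part {m | 0 ≤ m} A
/-- `(A)_{≤ 0}`. -/
def nonpos (A : Ser R) : Ser R := part {m | m ≤ 0} A
/-- `(A)_{< 0}`. -/
def neg (A : Ser R) : Ser R := part {m | m < 0} A

/-- `∂/∂v` for an independent variable `v`, at fixed `k`. -/
def pd (v : Var) (A : Ser R) : Ser R := MvPowerSeries.pderiv (LaurentSeries R) v A

/-- `∂/∂k = - z² ∂/∂z` with `z = k⁻¹`. -/
def dk (A : Ser R) : Ser R := fun d =>
  -(HahnSeries.single (2 : ℤ) (1 : R) * LaurentSeries.derivative R (MvPowerSeries.coeff d A))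

/-- `{A, B} = ∂A/∂k ∂B/∂x - ∂B/∂k ∂A/∂x`; thus `ad A B = {A, B}`. -/
def bracket (A B : Ser R) : Ser R := dk A * pd Var.x B - dk B * pd Var.x A

/-- `c` is a function of `s` only. -/
def OnlyS (c : Coef R) : Prop :=
  MvPowerSeries.pderiv R Var.x c = 0 ∧ ∀ n : ℕ+, MvPowerSeries.pderiv R (Var.t n) c = 0

/-- The family `a` is summable with sum `A`: for every monomial in the independent variables, the
coefficients form a summable family of Laurent series in `k⁻¹` with sum the coefficient of `A`. -/
def HasFormalSum {ι : Type*} (a : ι → Ser R) (A : Ser R) : Prop :=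
  ∀ d : Var →₀ ℕ, ∃ F : HahnSeries.SummableFamily ℤ R ι,
    (∀ i, F i = MvPowerSeries.coeff d (a i)) ∧ F.hsum = MvPowerSeries.coeff d A

theorem HasFormalSum.unique {ι : Type*} {a : ι → Ser R} {A B : Ser R}
    (hA : HasFormalSum a A) (hB : HasFormalSum a B) : A = B := by
  refine MvPowerSeries.ext fun d => ?_
  obtain ⟨F, hF, hFA⟩ := hA d
  obtain ⟨G, hG, hGB⟩ := hB d
  have hFG : F = G := HahnSeries.SummableFamily.ext fun i => (hF i).trans (hG i).symm
  rw [← hFA, ← hGB, hFG]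

open Classical in
/-- The sum of a summable family (`0` if the family is not summable). -/
def formalSum {ι : Type*} (a : ι → Ser R) : Ser R :=
  if h : ∃ A, HasFormalSum a A then h.choose else 0

theorem HasFormalSum.formalSum_eq {ι : Type*} {a : ι → Ser R} {A : Ser R}
    (h : HasFormalSum a A) : formalSum a = A := by
  have hex : ∃ A, HasFormalSum a A := ⟨A, h⟩
  rw [formalSum, dif_pos hex]
  exact hex.choose_spec.unique h

/-- `A ^ i` for an integer `i` and an invertible series `A`. -/
def zPow (A : Ser R) (i : ℤ) : Ser R :=
  if 0 ≤ i then A ^ i.toNat else Ring.inverse A ^ (-i).toNat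

/-- `A = k + ∑_{n ≥ 0} u_{n+1} k ^ (-n)`. -/
def IsLaxForm (A : Ser R) : Prop := pos A = kPow 1

/-- `P` is a monic polynomial of degree `N` in `k` with coefficients depending on `t`. -/
def IsMonicPoly (N : ℕ) (P : Ser R) : Prop :=
  kCoeff N P = 1 ∧ ∀ m : ℤ, m < 0 ∨ (N : ℤ) < m → kCoeff m P = 0

/-- `B_n = (L ^ n)_{> 0}`. -/
def B (L : Ser R) (n : ℕ+) : Ser R := pos (L ^ (n : ℕ))

/-- Functions `f(k, x)`, possibly with `s` as a parameter: formal series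
`∑ f_{iab} k ^ i x ^ a s ^ b` with the powers of `k` bounded above. -/
def IsTwistorFun (f : Ser R) : Prop :=
  (∀ n : ℕ+, pd (Var.t n) f = 0) ∧ ∃ D : ℤ, ∀ m : ℤ, D < m → kCoeff m f = 0

/-- The terms `f_{iab} L ^ i M ^ a s ^ b`, whose sum is `f(L, M)`. -/
def substFamily (f L M : Ser R) : ℤ × ℕ × ℕ → Ser R := fun p =>
  MvPowerSeries.coeff (Finsupp.single Var.x p.2.1 + Finsupp.single Var.s p.2.2) (kCoeff p.1 f) •
    (zPow L p.1 * M ^ p.2.1 * MvPowerSeries.X Var.s ^ p.2.2)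

/-- A pair `(f, g)` of twistor data for `(L, M)`: `{f, g} = 1`, `f(L, M)_{≤ 0} = 0` and
`g(L, M)_{< 0} = 0`. -/
structure IsTwistorData (f g L M : Ser R) : Prop where
  fun_f : IsTwistorFun f
  fun_g : IsTwistorFun g
  canonical : bracket f g = 1
  f_cond : ∃ A, HasFormalSum (substFamily f L M) A ∧ nonpos A = 0
  g_cond : ∃ A, HasFormalSum (substFamily g L M) A ∧ neg A = 0

/-- A function `q(t)` with `∂q/∂t_n = (L ^ n)_0`; as for all objects of the hierarchy, `q`
depends on `x` and `t₁` only through `x + t₁`. -/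
structure IsPhi (L : Ser R) (q : Coef R) : Prop where
  t_flow : ∀ n : ℕ+, MvPowerSeries.pderiv R (Var.t n) q = kCoeff 0 (L ^ (n : ℕ))
  x_flow : MvPowerSeries.pderiv R Var.x q = MvPowerSeries.pderiv R (Var.t 1) q

/-- The initial Orlov function `∑ n t_n k ^ (n - 1) + x + N s / k`. -/
def seed (N : ℕ) : Ser R :=
  formalSum (fun n : ℕ+ => ((n : ℕ) : Ser R) * (MvPowerSeries.X (Var.t n) * kPow ((n : ℤ) - 1)))
    + MvPowerSeries.X Var.x + (N : Ser R) * (MvPowerSeries.X Var.s * kPow (-1))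

/-- `M = ∑ n t_n L ^ (n - 1) + x + N s / L + ∑ v_n L ^ (-n - 1)`. -/
def IsOrlovExpansion (N : ℕ) (L M : Ser R) (v : ℕ+ → Coef R) : Prop :=
  HasFormalSum
    (fun n : ℕ+ => ((n : ℕ) : Ser R) * (MvPowerSeries.X (Var.t n) * zPow L ((n : ℤ) - 1))
      + cst (v n) * zPow L (-(n : ℤ) - 1))
    (M - MvPowerSeries.X Var.x - (N : Ser R) * (MvPowerSeries.X Var.s * zPow L (-1)))

end Basic

section Exponential

variable {R : Type*} [CommRing R] [Algebra ℚ R]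

/-- The terms of `e^{ad φ} A = ∑ (ad φ)^r A / r!`. -/
def expAdFamily (φ A : Ser R) : ℕ → Ser R := fun r =>
  ((r.factorial : ℚ)⁻¹) • (bracket φ)^[r] A

/-- The terms of `∑ (ad φ)^r A / (r + 1)!`; for `A = ∂φ/∂t` the sum is `∇_{t, φ} φ`. -/
def nablaFamily (φ A : Ser R) : ℕ → Ser R := fun r =>
  (((r + 1).factorial : ℚ)⁻¹) • (bracket φ)^[r] A

/-- The terms of `(ad φ) / (e^{ad φ} - 1) A = ∑ (b_r / r!) (ad φ)^r A`, where `b_r` are the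
Bernoulli numbers with `b_1 = -1/2`. -/
def toddFamily (φ A : Ser R) : ℕ → Ser R := fun r =>
  (bernoulli r / (r.factorial : ℚ)) • (bracket φ)^[r] A

/-- For `A = k ^ N (1 + y)`, with only negative powers of `k` in `y`, formally
`log A = N log k + log (1 + y)`; this is the part `log (1 + y) = ∑ (-1)^r y^(r+1) / (r+1)`. -/
def logReg (N : ℕ) (A : Ser R) : Ser R :=
  formalSum (fun r : ℕ => ((-1 : ℚ) ^ r / ((r : ℚ) + 1)) • (A * kPow (-(N : ℤ)) - 1) ^ (r + 1))

/-- `∂ log A / ∂k`. -/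
def dkLog (N : ℕ) (A : Ser R) : Ser R := (N : Ser R) * kPow (-1) + dk (logReg N A)

/-- `{log P, A}` for `P` monic of degree `N`; as `log k` does not depend on `t`, the other partial
derivatives of `log P` are those of `logReg N P`. -/
def logBracket (N : ℕ) (P A : Ser R) : Ser R :=
  dkLog N P * pd Var.x A - dk A * pd Var.x (logReg N P)

/-- `φ = ∑_{n ≥ 0} φ_n k ^ (-n)` is a dressing function of the solution `(L, P)`, with Orlov
function `M`. The `s`-flow of `φ` is prescribed up to its `k ^ 0`-term. -/
structure IsDressing (N : ℕ) (L P M φ : Ser R) : Prop where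
  form : pos φ = 0
  dress_L : HasFormalSum (expAdFamily φ (kPow 1)) L
  dress_M : HasFormalSum (expAdFamily φ (seed N)) M
  t_flow : ∀ n : ℕ+, HasFormalSum (nablaFamily φ (pd (Var.t n) φ)) (-nonpos (L ^ (n : ℕ)))
  s_flow : ∃ c : Coef R,
    HasFormalSum (nablaFamily φ (pd Var.s φ)) (logReg N P - logReg N (L ^ N) + cst c)

/-- `∂Φ/∂t_n = Res L ^ n d_k log P`, with `Φ` depending on `x` and `t₁` only through `x + t₁`. -/
structure IsBigPhi (N : ℕ) (L P : Ser R) (Φ : Coef R) : Prop where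
  t_flow : ∀ n : ℕ+, MvPowerSeries.pderiv R (Var.t n) Φ = res (L ^ (n : ℕ) * dkLog N P)
  x_flow : MvPowerSeries.pderiv R Var.x Φ = MvPowerSeries.pderiv R (Var.t 1) Φ

end Exponential

/-- The data of a solution: `L`, `P`, a dressing function `φ`, the Orlov function `M` and its
coefficients `v_n`. -/
structure Data (R : Type*) [CommRing R] where
  L : Ser R
  P : Ser R
  φ : Ser R
  M : Ser R
  v : ℕ+ → Coef R

/-- The Lax equations of the dispersionless coupled modified KP hierarchy for `(L, P)`, together
with the definitions of `φ`, `M` and `v_n`. -/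
structure IsSolution {R : Type*} [CommRing R] [Algebra ℚ R] (N : ℕ) (D : Data R) : Prop where
  form_L : IsLaxForm D.L
  form_P : IsMonicPoly N D.P
  lax_t : ∀ n : ℕ+, pd (Var.t n) D.L = bracket (B D.L n) D.L
  lax_s : pd Var.s D.L = logBracket N D.P D.L
  lax_P : ∀ n : ℕ+, pd (Var.t n) (logReg N D.P) =
    pd Var.s (nonneg (D.L ^ (n : ℕ))) - logBracket N D.P (B D.L n)
  dressing : IsDressing N D.L D.P D.M D.φ
  orlov : IsOrlovExpansion N D.L D.M D.v

section Deformation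

open DualNumber

/-- Apply an additive map to all the scalar coefficients of a function of `t`. -/
def mapCoef {R S : Type*} [CommRing R] [CommRing S] (h : R →+ S) (c : Coef R) : Coef S :=
  fun d => h (MvPowerSeries.coeff d c)

/-- Apply an additive map to all the scalar coefficients of a series. -/
def mapSer {R S : Type*} [CommRing R] [CommRing S] (h : R →+ S) (A : Ser R) : Ser S :=
  fun d => (MvPowerSeries.coeff d A).map h

variable {K : Type*} [Field K]

/-- `a + ε b ↦ a`. -/
def fstK : K[ε] →+ K := (TrivSqZeroExt.fstHom K K K).toLinearMap.toAddMonoidHom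
/-- `a + ε b ↦ b`. -/
def sndK : K[ε] →+ K := (TrivSqZeroExt.sndHom K K).toAddMonoidHom
/-- `a ↦ a`. -/
def inlK : K →+ K[ε] := (TrivSqZeroExt.inlHom K K).toAddMonoidHom
/-- `b ↦ ε b`. -/
def inrK : K →+ K[ε] := (TrivSqZeroExt.inrHom K K).toAddMonoidHom

/-- `A + ε A'`. -/
def expand (A A' : Ser K) : Ser K[ε] := mapSer inlK A + mapSer inrK A'

/-- `c + ε c'`. -/
def expandCoef (c c' : Coef K) : Coef K[ε] := mapCoef inlK c + mapCoef inrK c'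

/-- The value of a first order family at `ε = 0`. -/
def atZero (D : Data K[ε]) : Data K where
  L := mapSer fstK D.L
  P := mapSer fstK D.P
  φ := mapSer fstK D.φ
  M := mapSer fstK D.M
  v n := mapCoef fstK (D.v n)

/-- `e^{-ε ad F} f = f - ε {F, f}`. -/
def flow (F f : Ser K) : Ser K[ε] := expand f (-bracket F f)

end Deformation

end DcmKP

end

/-!
The Poisson bracket makes `ad` a Lie algebra action by derivations, and the deformed solution is,
to first order in `ε`, moved by some Hamiltonian: if `H = ∇_{δφ, φ} φ` for a deformation `δφ` of the
dressing function, then differentiating `L = e ^ {ad φ} k` and the formula for `M` gives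
`δL = {H, L}` and `δM = {H, M}`, with only nonpositive powers of `k` in `H`
(`FormalDerivation.hasFormalSum_expAd`, `IsDressing.exists_variation`). The work is to identify `H`.

As `{L, M} = 1`, substitution of `(L, M)` is compatible with the bracket
(`hasFormalSum_subst_bracket`), so that the function `G = F(L, M)` satisfies
`{F, f}(L, M) = {G, f(L, M)}`. The `ε`-coefficients of the twistor conditions therefore say that the
brackets of `H - G` with `f(L, M)` and `g(L, M)` have no powers `k ^ m` with `m ≤ 0`, respectively
with `m < 0`. Since `f(L, M)` and `g(L, M)` are themselves a canonical pair satisfying the same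
conditions, the derivatives of `H - G` with respect to `k` and `x` have only nonnegative,
respectively positive, powers of `k`: hence `H = G_{≤ 0} + c` with `∂c/∂x = 0`
(`exists_generator_eq`). The flows of `δφ` along the `t_n`, compared with `∂G/∂t_n = {B_n, G}`, show
that `c` depends on `s` alone (`IsSolution.exists_onlyS`). The formula for `δφ` itself follows by
inverting `∑ T ^ r / (r + 1)!` by `T / (e ^ T - 1)` (`hasFormalSum_todd`), and conversely functions
of `s` alone may be added to dressing functions (`IsDressing.add_cst`).

The other variations are consequences of those of `L` and `M`. The `s`-flows determine the brackets
of `δ log P` with `L` and `M`, hence `δ log P` up to a function of `t`, which is excluded by its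
negative degree (`IsSolution.snd_logReg`). The Orlov expansion, to which `δ - ad H` and `ad L` are
applied, gives `∂H/∂k = ∑ δv_n L ^ (-n-1) ∂L/∂k`, from which `δv_n` is extracted as a residue
(`IsSolution.snd_v`). For the potentials one compares the `t_n`-derivatives of both sides; for the
second potential this amounts to an identity between residues that comes from integration by parts
(`res_mul_dk_logBracket_sub`, `IsSolution.res_variation`).

The analytic side is reduced to scalar coefficients: a formal sum is described by
`hasFormalSum_iff`, and summability is obtained from a filtration by weighted degree
(`exists_hasFormalSum`). For a suitable weight, in which `t_n` has degree `-n`, the Orlov function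
has degree `-1`, and this is why `F(L, M)` converges (`IsSolution.exists_subst`).
-/

namespace DcmKP

/-! ### Coefficients of formal series -/

section Coefficients

variable {R S : Type*} [CommRing R] [CommRing S]

/-- The coefficient of `t ^ d * k ^ m`, as an additive map. -/
noncomputable def cf (d : Var →₀ ℕ) (m : ℤ) : Ser R →+ R where
  toFun A := (MvPowerSeries.coeff d A).coeff (-m)
  map_zero' := by simp
  map_add' A B := by simp

theorem cf_def (d : Var →₀ ℕ) (m : ℤ) (A : Ser R) :
    cf d m A = (MvPowerSeries.coeff d A).coeff (-m) := rfl

theorem ser_ext {A B : Ser R} (h : ∀ d m, cf d m A = cf d m B) : A = B := by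
  refine MvPowerSeries.ext fun d => ?_
  ext j
  simpa [cf_def] using h d (-j)

theorem coeff_kCoeff (d : Var →₀ ℕ) (m : ℤ) (A : Ser R) :
    MvPowerSeries.coeff d (kCoeff m A) = cf d m A := rfl

theorem cf_smul [Algebra ℚ R] (q : ℚ) (d : Var →₀ ℕ) (m : ℤ) (A : Ser R) :
    cf d m (q • A) = q • cf d m A :=
  @map_rat_smul (Ser R) R _ _ Algebra.toModule _ (Ser R →+ R) _ _ (cf d m) q A

theorem cf_scalar_smul (q : R) (d : Var →₀ ℕ) (m : ℤ) (A : Ser R) :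
    cf d m (q • A) = q * cf d m A := by
  rw [Algebra.smul_def, MvPowerSeries.algebraMap_apply, cf_def, MvPowerSeries.coeff_C_mul,
    HahnSeries.algebraMap_apply']
  have : (HahnSeries.ofPowerSeries ℤ R) ((algebraMap R (PowerSeries R)) q) = HahnSeries.C q := by
    exact HahnSeries.ofPowerSeries_C q
  rw [this, HahnSeries.C_mul_eq_smul, HahnSeries.coeff_smul, smul_eq_mul]; rfl

open Classical in
theorem cf_part (T : Set ℤ) (d : Var →₀ ℕ) (m : ℤ) (A : Ser R) :
    cf d m (part T A) = if m ∈ T then cf d m A else 0 := by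
  change (if -(-m) ∈ T then _ else _) = _
  rw [neg_neg]; rfl

theorem cf_mapSer (h : R →+ S) (d : Var →₀ ℕ) (m : ℤ) (A : Ser R) :
    cf d m (mapSer h A) = h (cf d m A) := rfl

theorem coeff_mapCoef (h : R →+ S) (d : Var →₀ ℕ) (c : Coef R) :
    MvPowerSeries.coeff d (mapCoef h c) = h (MvPowerSeries.coeff d c) := rfl

theorem cf_pd (v : Var) (d : Var →₀ ℕ) (m : ℤ) (A : Ser R) :
    cf d m (pd v A) = cf (d + Finsupp.single v 1) m A * (d v + 1) := by
  rw [cf_def, pd, MvPowerSeries.coeff_pderiv]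
  have : ((d v : LaurentSeries R) + 1) = HahnSeries.C ((d v : R) + 1) := by
    rw [map_add, map_natCast, map_one]
  rw [this, mul_comm, HahnSeries.C_mul_eq_smul, HahnSeries.coeff_smul, smul_eq_mul, mul_comm]
  rfl

theorem cf_dk (d : Var →₀ ℕ) (m : ℤ) (A : Ser R) :
    cf d m (dk A) = (m + 1) * cf d (m + 1) A := by
  change (-(HahnSeries.single (2 : ℤ) (1 : R) *
    LaurentSeries.derivative R (MvPowerSeries.coeff d A))).coeff (-m) = _
  have h := HahnSeries.coeff_single_mul_add (r := (1 : R))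
    (x := LaurentSeries.derivative R (MvPowerSeries.coeff d A)) (a := -m - 2) (b := 2)
  rw [HahnSeries.coeff_neg, show (-m : ℤ) = -m - 2 + 2 by ring, h,
    LaurentSeries.derivative_apply, LaurentSeries.hasseDeriv_coeff, Ring.choose_one_right, cf_def,
    show (-m - 2 + ((1 : ℕ) : ℤ)) = -(m + 1) by push_cast; ring]
  rw [one_mul, zsmul_eq_mul]
  push_cast; ring

theorem cf_cst (d : Var →₀ ℕ) (m : ℤ) (c : Coef R) :
    cf d m (cst c) = if m = 0 then MvPowerSeries.coeff d c else 0 := by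
  rw [cf_def, cst, MvPowerSeries.coeff_map, HahnSeries.C_apply, HahnSeries.coeff_single]
  simp

theorem cf_kPow (i : ℤ) (d : Var →₀ ℕ) (m : ℤ) :
    cf d m (kPow i : Ser R) = if d = 0 ∧ m = i then 1 else 0 := by
  classical
  rw [cf_def, kPow, MvPowerSeries.coeff_C]
  by_cases hd : d = 0
  · simp [hd, HahnSeries.coeff_single]
  · simp [hd]

theorem cf_one (d : Var →₀ ℕ) (m : ℤ) :
    cf d m (1 : Ser R) = if d = 0 ∧ m = 0 then 1 else 0 := by
  rw [← cf_kPow, kPow]; simp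

theorem laurent_mul_support_finite (x y : LaurentSeries R) (j : ℤ) :
    (Function.support fun a => x.coeff a * y.coeff (j - a)).Finite := by
  refine ((Finset.antidiagonal x.isPWO_support y.isPWO_support j).image Prod.fst).finite_toSet.subset
    fun a ha => ?_
  simp only [Finset.coe_image, Set.mem_image, Finset.mem_coe, Finset.mem_antidiagonal]
  exact ⟨(a, j - a), ⟨left_ne_zero_of_mul ha, right_ne_zero_of_mul ha, by simp⟩, rfl⟩

/-- The coefficients of a product of Laurent series, without reference to the supports. -/
theorem laurent_coeff_mul (x y : LaurentSeries R) (j : ℤ) :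
    (x * y).coeff j = ∑ᶠ a, x.coeff a * y.coeff (j - a) := by
  classical
  rw [HahnSeries.coeff_mul]
  rw [finsum_eq_sum_of_support_subset (s := (Finset.antidiagonal x.isPWO_support
    y.isPWO_support j).image Prod.fst)]
  · rw [Finset.sum_image]
    · refine Finset.sum_congr rfl fun p hp => ?_
      rw [Finset.mem_antidiagonal] at hp
      rw [← hp.2.2, add_sub_cancel_left]
    · rintro ⟨a, b⟩ hp ⟨a', b'⟩ hq h
      simp only [Finset.mem_coe, Finset.mem_antidiagonal] at hp hq h
      ext
      · exact h
      · have h1 := hp.2.2; have h2 := hq.2.2; simp only at h1 h2 h ⊢; omega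
  · intro a ha
    simp only [Finset.coe_image, Set.mem_image, Finset.mem_coe, Finset.mem_antidiagonal]
    exact ⟨(a, j - a), ⟨left_ne_zero_of_mul ha, right_ne_zero_of_mul ha, by simp⟩, rfl⟩

theorem cf_mul (d : Var →₀ ℕ) (m : ℤ) (A B : Ser R) :
    cf d m (A * B) =
      ∑ p ∈ Finset.HasAntidiagonal.antidiagonal d, ∑ᶠ a, cf p.1 (-a) A * cf p.2 (m + a) B := by
  classical
  rw [cf_def, MvPowerSeries.coeff_mul, HahnSeries.coeff_sum]
  refine Finset.sum_congr rfl fun p _ => ?_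
  rw [laurent_coeff_mul]
  refine finsum_congr fun a => ?_
  simp only [cf_def, neg_neg]
  rw [show -m - a = -(m + a) by ring]

theorem cf_mul_support_finite (d e : Var →₀ ℕ) (m : ℤ) (A B : Ser R) :
    (Function.support fun a : ℤ => cf d (-a) A * cf e (m + a) B).Finite := by
  convert laurent_mul_support_finite (MvPowerSeries.coeff d A) (MvPowerSeries.coeff e B) (-m)
    using 4
  · simp [cf_def]
  · simp only [cf_def]; congr 1; ring

/-- A product formula for series follows from the same formula for scalar coefficients. -/
theorem mul_formula_of_cf {δ T₁ T₂ T₃ T₄ : Ser S → Ser R} {g f₁ f₂ f₃ f₄ : S →+ R}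
    (hg : ∀ x y, g (x * y) = f₁ x * f₂ y + f₃ x * f₄ y)
    (h : ∀ d m A, cf d m (δ A) = g (cf d m A))
    (h₁ : ∀ d m A, cf d m (T₁ A) = f₁ (cf d m A)) (h₂ : ∀ d m A, cf d m (T₂ A) = f₂ (cf d m A))
    (h₃ : ∀ d m A, cf d m (T₃ A) = f₃ (cf d m A)) (h₄ : ∀ d m A, cf d m (T₄ A) = f₄ (cf d m A))
    (A B : Ser S) : δ (A * B) = T₁ A * T₂ B + T₃ A * T₄ B := by
  refine ser_ext fun d m => ?_
  rw [h, cf_mul, map_add, cf_mul, cf_mul, map_sum, ← Finset.sum_add_distrib]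
  refine Finset.sum_congr rfl fun p _ => ?_
  have hf := cf_mul_support_finite p.1 p.2 m A B
  rw [AddMonoidHom.map_finsum _ hf, ← finsum_add_distrib (cf_mul_support_finite _ _ _ _ _)
    (cf_mul_support_finite _ _ _ _ _)]
  refine finsum_congr fun a => ?_
  simp only [h₁, h₂, h₃, h₄, hg]

theorem dk_add (A B : Ser R) : dk (A + B) = dk A + dk B :=
  ser_ext fun d m => by simp only [cf_dk, map_add, mul_add]

/-- The Leibniz rule for `∂/∂k`. -/
theorem dk_mul (A B : Ser R) : dk (A * B) = A * dk B + dk A * B := by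
  -- The coefficient of `k ^ m` in `dk (A * B)` has weight `m + 1 = (m + 1 + a) - a`; the two
  -- summands give the two terms, after a shift of the summation index in the second one.
  refine ser_ext fun d m => ?_
  rw [cf_dk, cf_mul, map_add, cf_mul, cf_mul, Finset.mul_sum, ← Finset.sum_add_distrib]
  refine Finset.sum_congr rfl fun p _ => ?_
  have e : ∑ᶠ a : ℤ, cf p.1 (-a) (dk A) * cf p.2 (m + a) B =
      ∑ᶠ a : ℤ, cf p.1 (-(a + 1)) (dk A) * cf p.2 (m + (a + 1)) B :=
    (finsum_comp_equiv (Equiv.addRight (1 : ℤ))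
      (f := fun a : ℤ => cf p.1 (-a) (dk A) * cf p.2 (m + a) B)).symm
  have hfin : (Function.support fun a : ℤ =>
      cf p.1 (-(a + 1)) (dk A) * cf p.2 (m + (a + 1)) B).Finite :=
    (cf_mul_support_finite p.1 p.2 m (dk A) B).preimage
      (Equiv.addRight (1 : ℤ)).injective.injOn
  rw [e, ← finsum_add_distrib (cf_mul_support_finite _ _ _ _ _) hfin]
  have hm : ((m : R) + 1) = ((m + 1 : ℤ) : R) := by push_cast; ring
  rw [← smul_eq_mul (a := ((m : R) + 1)), smul_finsum' _ (cf_mul_support_finite _ _ _ _ _)]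
  refine finsum_congr fun a => ?_
  rw [cf_dk, cf_dk, smul_eq_mul, show -(a + 1) + 1 = -a by ring,
    show m + (a + 1) = m + 1 + a by ring, show m + a + 1 = m + 1 + a by ring]
  push_cast; ring

end Coefficients

/-! ### Formal sums -/

section FormalSums

variable {R S : Type*} [CommRing R] [CommRing S] {ι κ : Type*}

theorem isPWO_int_iff {s : Set ℤ} : s.IsPWO ↔ BddBelow s := by
  rw [Set.isPWO_iff_isWF]
  refine ⟨fun h => ?_, BddBelow.isWF⟩
  rcases s.eq_empty_or_nonempty with rfl | hs
  · exact bddBelow_empty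
  · exact ⟨h.min hs, fun a ha => h.min_le hs ha⟩

/-- Summability and the sum in terms of scalar coefficients: for every monomial in the independent
variables the powers of `k` are bounded above, uniformly in the family, and every coefficient is
given by a sum with finitely many nonzero terms. -/
theorem hasFormalSum_iff {a : ι → Ser R} {A : Ser R} :
    HasFormalSum a A ↔ ∀ d, (∃ D : ℤ, ∀ i m, D < m → cf d m (a i) = 0) ∧
      ∀ m, (Function.support fun i => cf d m (a i)).Finite ∧ ∑ᶠ i, cf d m (a i) = cf d m A := by
  refine forall_congr' fun d => ⟨?_, ?_⟩
  · rintro ⟨F, hF, hs⟩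
    refine ⟨?_, fun m => ?_⟩
    · obtain ⟨b, hb⟩ := isPWO_int_iff.1 F.isPWO_iUnion_support
      refine ⟨-b, fun i m hm => ?_⟩
      by_contra hne
      have := hb (Set.mem_iUnion.2 ⟨i, show -m ∈ (F i).support by
        rw [hF]; exact hne⟩)
      omega
    · constructor
      · refine (F.finite_co_support (-m)).subset fun i hi => ?_
        simp only [Function.mem_support, ne_eq, hF]
        exact hi
      · rw [cf_def, ← hs, HahnSeries.SummableFamily.coeff_hsum]
        exact finsum_congr fun i => by rw [hF]; rfl
  · rintro ⟨⟨D, hD⟩, h⟩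
    refine ⟨⟨fun i => MvPowerSeries.coeff d (a i), ?_, fun g => ?_⟩, fun i => rfl, ?_⟩
    · refine isPWO_int_iff.2 ⟨-D, fun j hj => ?_⟩
      obtain ⟨i, hi⟩ := Set.mem_iUnion.1 hj
      by_contra hlt
      refine hi ?_
      have := hD i (-j) (by omega)
      rwa [cf_def, neg_neg] at this
    · have := (h (-g)).1
      simp only [cf_def, neg_neg] at this
      exact this
    · ext g
      rw [HahnSeries.SummableFamily.coeff_hsum]
      have := (h (-g)).2
      simp only [cf_def, neg_neg] at this
      exact this

theorem HasFormalSum.support_finite {a : ι → Ser R} {A : Ser R} (h : HasFormalSum a A)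
    (d : Var →₀ ℕ) (m : ℤ) : (Function.support fun i => cf d m (a i)).Finite :=
  ((hasFormalSum_iff.1 h d).2 m).1

theorem HasFormalSum.finsum_cf {a : ι → Ser R} {A : Ser R} (h : HasFormalSum a A)
    (d : Var →₀ ℕ) (m : ℤ) : ∑ᶠ i, cf d m (a i) = cf d m A :=
  ((hasFormalSum_iff.1 h d).2 m).2

/-- Formal sums are compatible with maps that act on single coefficients. -/
theorem HasFormalSum.map_of_cf {T : Ser R → Ser S} (k : ℤ) (e : (Var →₀ ℕ) → (Var →₀ ℕ))
    (h : (Var →₀ ℕ) → ℤ → R →+ S)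
    (hT : ∀ d m A, cf d m (T A) = h d m (cf (e d) (m + k) A)) {a : ι → Ser R} {A : Ser R}
    (ha : HasFormalSum a A) : HasFormalSum (fun i => T (a i)) (T A) := by
  rw [hasFormalSum_iff] at ha ⊢
  intro d
  obtain ⟨⟨D, hD⟩, hs⟩ := ha (e d)
  refine ⟨⟨D - k, fun i m hm => ?_⟩, fun m => ⟨?_, ?_⟩⟩
  · rw [hT, hD i _ (by omega), map_zero]
  · refine (hs (m + k)).1.subset fun i hi hz => hi ?_
    simp only at hz ⊢
    rw [hT, hz, map_zero]
  · simp only [hT]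
    rw [← AddMonoidHom.map_finsum _ (hs (m + k)).1, (hs (m + k)).2]

theorem HasFormalSum.pd {a : ι → Ser R} {A : Ser R} (ha : HasFormalSum a A) (v : Var) :
    HasFormalSum (fun i => DcmKP.pd v (a i)) (DcmKP.pd v A) :=
  ha.map_of_cf 0 (fun d => d + Finsupp.single v 1)
    (fun d _ => AddMonoidHom.mulRight ((d v : R) + 1)) fun d m A => by
      rw [cf_pd, add_zero]; rfl

theorem HasFormalSum.dk {a : ι → Ser R} {A : Ser R} (ha : HasFormalSum a A) :
    HasFormalSum (fun i => DcmKP.dk (a i)) (DcmKP.dk A) :=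
  ha.map_of_cf 1 (fun d => d) (fun _ m => AddMonoidHom.mulLeft ((m : R) + 1))
    fun d m A => by rw [cf_dk]; rfl

theorem HasFormalSum.mapSer {a : ι → Ser R} {A : Ser R} (ha : HasFormalSum a A) (h : R →+ S) :
    HasFormalSum (fun i => DcmKP.mapSer h (a i)) (DcmKP.mapSer h A) :=
  ha.map_of_cf 0 (fun d => d) (fun _ _ => h) fun d m A => by rw [cf_mapSer, add_zero]

theorem HasFormalSum.rat_smul [Algebra ℚ R] {a : ι → Ser R} {A : Ser R} (ha : HasFormalSum a A)
    (q : ℚ) : HasFormalSum (fun i => q • a i) (q • A) :=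
  ha.map_of_cf 0 (fun d => d) (fun _ _ => DistribSMul.toAddMonoidHom R q)
    fun d m A => by rw [cf_smul, add_zero]; rfl

theorem HasFormalSum.neg {a : ι → Ser R} {A : Ser R} (ha : HasFormalSum a A) :
    HasFormalSum (fun i => -a i) (-A) :=
  ha.map_of_cf 0 (fun d => d) (fun _ _ => negAddMonoidHom)
    fun d m A => by rw [map_neg, add_zero]; rfl

theorem HasFormalSum.add {a b : ι → Ser R} {A B : Ser R} (ha : HasFormalSum a A)
    (hb : HasFormalSum b B) : HasFormalSum (fun i => a i + b i) (A + B) := by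
  rw [hasFormalSum_iff] at ha hb ⊢
  intro d
  obtain ⟨⟨D, hD⟩, hs⟩ := ha d
  obtain ⟨⟨D', hD'⟩, hs'⟩ := hb d
  refine ⟨⟨max D D', fun i m hm => ?_⟩, fun m => ⟨?_, ?_⟩⟩
  · rw [map_add, hD i m (by omega), hD' i m (by omega), add_zero]
  · simp only [map_add]
    exact ((hs m).1.union (hs' m).1).subset (Function.support_add _ _)
  · simp only [map_add]
    rw [finsum_add_distrib (hs m).1 (hs' m).1, (hs m).2, (hs' m).2]

theorem HasFormalSum.sub {a b : ι → Ser R} {A B : Ser R} (ha : HasFormalSum a A)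
    (hb : HasFormalSum b B) : HasFormalSum (fun i => a i - b i) (A - B) := by
  simpa only [sub_eq_add_neg] using ha.add hb.neg

theorem HasFormalSum.congr {a b : ι → Ser R} {A : Ser R} (ha : HasFormalSum a A)
    (h : ∀ i, b i = a i) : HasFormalSum b A := by
  rwa [show b = a from funext h]

/-- A family with finitely many nonzero terms is summable. -/
theorem hasFormalSum_sum (s : Finset ι) {a : ι → Ser R} (h : ∀ i ∉ s, a i = 0) :
    HasFormalSum a (∑ i ∈ s, a i) := by
  intro d
  have hfin : (Function.support fun i => MvPowerSeries.coeff d (a i)).Finite :=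
    s.finite_toSet.subset fun i hi => by
      by_contra his
      exact hi (by simp only; rw [h i his, map_zero])
  refine ⟨HahnSeries.SummableFamily.ofFinsupp (Finsupp.ofSupportFinite _ hfin), fun i => rfl, ?_⟩
  rw [HahnSeries.SummableFamily.hsum_ofFinsupp, map_sum, Finsupp.sum_of_support_subset (s := s)]
  · rfl
  · intro i hi
    by_contra his
    rw [Finsupp.mem_support_iff] at hi
    exact hi (by change MvPowerSeries.coeff d (a i) = 0; rw [h i his, map_zero])
  · simp

theorem hasFormalSum_single {a : ι → Ser R} (i : ι) (h : ∀ j ≠ i, a j = 0) :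
    HasFormalSum a (a i) := by
  simpa using hasFormalSum_sum {i} fun j hj => h j (by simpa using hj)

theorem hasFormalSum_zero : HasFormalSum (fun _ : ι => (0 : Ser R)) 0 := by
  simpa using hasFormalSum_sum ∅ fun (j : ι) _ => rfl

theorem HasFormalSum.mul {a : ι → Ser R} {b : κ → Ser R} {A B : Ser R} (ha : HasFormalSum a A)
    (hb : HasFormalSum b B) : HasFormalSum (fun p : ι × κ => a p.1 * b p.2) (A * B) := by
  classical
  intro d
  choose F hF hFA using ha
  choose G hG hGB using hb
  refine ⟨∑ p ∈ Finset.HasAntidiagonal.antidiagonal d, (F p.1).mul (G p.2), fun i => ?_, ?_⟩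
  · have hsum : ∀ s : Finset ((Var →₀ ℕ) × (Var →₀ ℕ)),
        (∑ p ∈ s, (F p.1).mul (G p.2)) i = ∑ p ∈ s, F p.1 i.1 * G p.2 i.2 := by
      intro s
      induction s using Finset.induction_on with
      | empty => simp
      | insert p s hp ih =>
        rw [Finset.sum_insert hp, Finset.sum_insert hp, HahnSeries.SummableFamily.add_apply, ih]
        rfl
    rw [hsum, MvPowerSeries.coeff_mul]
    exact Finset.sum_congr rfl fun p _ => by rw [hF, hG]
  · have hsum : ∀ s : Finset ((Var →₀ ℕ) × (Var →₀ ℕ)),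
        (∑ p ∈ s, (F p.1).mul (G p.2)).hsum = ∑ p ∈ s, (F p.1).hsum * (G p.2).hsum := by
      intro s
      induction s using Finset.induction_on with
      | empty => simp
      | insert p s hp ih =>
        rw [Finset.sum_insert hp, Finset.sum_insert hp, HahnSeries.SummableFamily.hsum_add, ih,
          HahnSeries.SummableFamily.hsum_mul]
    rw [hsum, MvPowerSeries.coeff_mul]
    exact Finset.sum_congr rfl fun p _ => by rw [hFA, hGB]

theorem HasFormalSum.comp_equiv {a : ι → Ser R} {A : Ser R} (ha : HasFormalSum a A) (e : κ ≃ ι) :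
    HasFormalSum (fun j => a (e j)) A := by
  intro d
  obtain ⟨F, hF, hs⟩ := ha d
  exact ⟨HahnSeries.SummableFamily.Equiv e.symm F, fun i => by simp [hF],
    by rw [HahnSeries.SummableFamily.hsum_equiv, hs]⟩

theorem HasFormalSum.mul_left {a : ι → Ser R} {A : Ser R} (B : Ser R) (ha : HasFormalSum a A) :
    HasFormalSum (fun i => B * a i) (B * A) :=
  ((hasFormalSum_single (a := fun _ : Unit => B) () (by simp)).mul ha).comp_equiv
    (Equiv.punitProd ι).symm

theorem HasFormalSum.mul_right {a : ι → Ser R} {A : Ser R} (ha : HasFormalSum a A) (B : Ser R) :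
    HasFormalSum (fun i => a i * B) (A * B) := by
  simpa only [mul_comm] using ha.mul_left B

theorem HasFormalSum.bracket {a : ι → Ser R} {b : κ → Ser R} {A B : Ser R}
    (ha : HasFormalSum a A) (hb : HasFormalSum b B) :
    HasFormalSum (fun p : ι × κ => DcmKP.bracket (a p.1) (b p.2)) (DcmKP.bracket A B) := by
  refine (ha.dk.mul (hb.pd Var.x)).sub (HasFormalSum.congr (((ha.pd Var.x).mul hb.dk)) ?_ |> fun h =>
    (by rwa [mul_comm] at h))
  intro p
  exact mul_comm _ _

theorem HasFormalSum.bracket_right {b : κ → Ser R} {B : Ser R} (A : Ser R)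
    (hb : HasFormalSum b B) :
    HasFormalSum (fun i => DcmKP.bracket A (b i)) (DcmKP.bracket A B) :=
  ((hb.pd Var.x).mul_left _).sub (hb.dk.mul_right _)

open Classical in
/-- Summation by parts of the index set: if `b j` is the sum of the terms over `j`, the `b j` have
the same sum as the whole family. -/
theorem HasFormalSum.fiberwise {c : ι → Ser R} {A : Ser R} (hc : HasFormalSum c A) (r : ι → κ)
    {b : κ → Ser R} (hb : ∀ j, HasFormalSum (fun i => if r i = j then c i else 0) (b j)) :
    HasFormalSum b A := by
  have hcf : ∀ d m j, cf d m (b j) = ∑ᶠ i, if r i = j then cf d m (c i) else 0 := fun d m j => by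
    rw [← (hb j).finsum_cf]
    exact finsum_congr fun i => by split_ifs <;> simp
  rw [hasFormalSum_iff]
  intro d
  obtain ⟨⟨D, hD⟩, hs⟩ := hasFormalSum_iff.1 hc d
  refine ⟨⟨D, fun j m hm => ?_⟩, fun m => ?_⟩
  · rw [hcf]
    simp [hD _ m hm]
  set s := (hs m).1.toFinset with hsdef
  have hmem : ∀ i, i ∉ s → cf d m (c i) = 0 := fun i hi => by
    simpa [hsdef] using hi
  have hbs : ∀ j, cf d m (b j) = ∑ i ∈ s, if r i = j then cf d m (c i) else 0 := fun j => by
    rw [hcf]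
    refine finsum_eq_sum_of_support_subset _ fun i hi => ?_
    by_contra his
    exact hi (by simp [hmem i his])
  have hsub : (Function.support fun j => cf d m (b j)) ⊆ (s.image r : Finset κ) := fun j hj => by
    by_contra hjs
    refine hj ?_
    simp only
    rw [hbs]
    refine Finset.sum_eq_zero fun i hi => if_neg fun h => hjs ?_
    exact Finset.mem_coe.2 (Finset.mem_image.2 ⟨i, hi, h⟩)
  refine ⟨(s.image r).finite_toSet.subset hsub, ?_⟩
  rw [finsum_eq_sum_of_support_subset _ hsub, ← (hs m).2,
    finsum_eq_sum_of_support_subset (s := s) _ (by simp [hsdef])]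
  simp only [hbs]
  rw [Finset.sum_comm]
  refine Finset.sum_congr rfl fun i hi => ?_
  rw [Finset.sum_ite_eq, if_pos (Finset.mem_image_of_mem r hi)]

/-- Summation of a double family along antidiagonals. -/
theorem HasFormalSum.antidiagonal {c : ℕ × ℕ → Ser R} {A : Ser R} (hc : HasFormalSum c A) :
    HasFormalSum (fun n => ∑ p ∈ Finset.HasAntidiagonal.antidiagonal n, c p) A := by
  classical
  refine hc.fiberwise (fun p => p.1 + p.2) fun n => ?_
  have h := hasFormalSum_sum (Finset.HasAntidiagonal.antidiagonal n)
    (a := fun p : ℕ × ℕ => if p.1 + p.2 = n then c p else 0) fun p hp =>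
      if_neg fun h => hp (Finset.HasAntidiagonal.mem_antidiagonal.2 h)
  rw [Finset.sum_congr rfl fun p hp =>
    if_pos (Finset.HasAntidiagonal.mem_antidiagonal.1 hp)] at h
  convert h

/-- Summation of a double family by rows. -/
theorem HasFormalSum.rows {c : ι × κ → Ser R} {A : Ser R} (hc : HasFormalSum c A)
    {b : ι → Ser R} (hb : ∀ i, HasFormalSum (fun j => c (i, j)) (b i)) : HasFormalSum b A := by
  classical
  refine hc.fiberwise Prod.fst fun i => ?_
  rw [hasFormalSum_iff]
  intro d
  obtain ⟨⟨D, hD⟩, hs⟩ := hasFormalSum_iff.1 (hb i) d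
  refine ⟨⟨D, fun p m hm => ?_⟩, fun m => ?_⟩
  · split_ifs with h
    · obtain ⟨p1, p2⟩ := p
      obtain rfl : p1 = i := h
      exact hD p2 m hm
    · simp
  have hsub : (Function.support fun p : ι × κ => cf d m (if p.1 = i then c p else 0)) ⊆
      ((hs m).1.toFinset.image fun j => (i, j) : Finset (ι × κ)) := by
    rintro ⟨p1, p2⟩ hp
    simp only [Function.mem_support, ne_eq] at hp
    split_ifs at hp with h
    · obtain rfl : p1 = i := h
      simpa using hp
    · simp at hp
  refine ⟨(Finset.finite_toSet _).subset hsub, ?_⟩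
  rw [finsum_eq_sum_of_support_subset _ hsub, Finset.sum_image (by simp)]
  refine Eq.trans ?_ ((finsum_eq_sum_of_support_subset
    (s := (hs m).1.toFinset) _ (by simp)).symm.trans (hs m).2)
  exact Finset.sum_congr rfl fun j _ => by simp

end FormalSums

/-! ### Filtrations by weighted degree -/

section Filtration

variable {R S : Type*} [CommRing R] [CommRing S] {ι κ : Type*}

/-- The weight of the monomial `t ^ d`, for weights `w` of the independent variables. -/
def wt (w : Var → ℕ) (d : Var →₀ ℕ) : ℕ := d.sum fun v n => n * w v

theorem wt_add (w : Var → ℕ) (d e : Var →₀ ℕ) : wt w (d + e) = wt w d + wt w e :=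
  Finsupp.sum_add_index' (by simp) (by simp [add_mul])

theorem wt_single (w : Var → ℕ) (v : Var) (n : ℕ) : wt w (Finsupp.single v n) = n * w v :=
  Finsupp.sum_single_index (by simp)

theorem wt_zero (d : Var →₀ ℕ) : wt 0 d = 0 := by simp [wt]

variable (R) in
/-- The series of degree at most `p`, if `k` has degree `1` and an independent variable `v` has
degree `-w v`. For `w = 0` these are the series in which only powers `k ^ m` with `m ≤ p` occur. -/
def W (w : Var → ℕ) (p : ℤ) : AddSubgroup (Ser R) where
  carrier := {A | ∀ d m, p + wt w d < m → cf d m A = 0}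
  zero_mem' _ _ _ := map_zero _
  add_mem' hA hB d m h := by rw [map_add, hA d m h, hB d m h, add_zero]
  neg_mem' hA d m h := by rw [map_neg, hA d m h, neg_zero]

variable {w w' : Var → ℕ} {p q : ℤ} {A B : Ser R}

theorem mem_W : A ∈ W R w p ↔ ∀ d m, p + wt w d < m → cf d m A = 0 := Iff.rfl

theorem mem_W_zero : A ∈ W R 0 p ↔ ∀ d m, p < m → cf d m A = 0 := by
  simp [mem_W, wt_zero]

theorem W_mono (h : p ≤ q) (hA : A ∈ W R w p) : A ∈ W R w q :=
  fun d m hm => hA d m (by omega)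

theorem W_of_W_zero (hA : A ∈ W R 0 p) : A ∈ W R w p :=
  fun d m hm => mem_W_zero.1 hA d m (by omega)

theorem mul_mem_W (hA : A ∈ W R w p) (hB : B ∈ W R w q) : A * B ∈ W R w (p + q) := by
  intro d m hm
  rw [cf_mul]
  refine Finset.sum_eq_zero fun e he => ?_
  rw [finsum_eq_zero_of_forall_eq_zero]
  intro a
  have hd := Finset.HasAntidiagonal.mem_antidiagonal.1 he
  rw [← hd, wt_add] at hm
  push_cast at hm
  by_cases h : p + wt w e.1 < -a
  · rw [hA _ _ h, zero_mul]
  · rw [hB _ (m + a) (by omega), mul_zero]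

theorem dk_mem_W (hA : A ∈ W R w p) : dk A ∈ W R w (p - 1) := by
  intro d m hm
  rw [cf_dk, hA d (m + 1) (by omega), mul_zero]

theorem pd_mem_W (hA : A ∈ W R w p) (v : Var) : pd v A ∈ W R w (p + w v) := by
  intro d m hm
  rw [cf_pd, hA _ m (by rw [wt_add, wt_single]; push_cast; omega), zero_mul]

theorem cst_mem_W (c : Coef R) : cst c ∈ W R w 0 := by
  intro d m hm
  rw [cf_cst, if_neg (by omega)]

theorem kPow_mem_W (i : ℤ) : kPow i ∈ W R w i := by
  intro d m hm
  rw [cf_kPow, if_neg (by rintro ⟨rfl, rfl⟩; omega)]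

theorem one_mem_W : (1 : Ser R) ∈ W R w 0 := by
  intro d m hm
  rw [cf_one, if_neg (by rintro ⟨rfl, rfl⟩; omega)]

theorem natCast_mem_W (n : ℕ) : (n : Ser R) ∈ W R w 0 := by
  rw [← nsmul_one]
  exact nsmul_mem one_mem_W n

theorem cf_X (v : Var) (d : Var →₀ ℕ) (m : ℤ) :
    cf d m (MvPowerSeries.X v : Ser R) = if d = Finsupp.single v 1 ∧ m = 0 then 1 else 0 := by
  classical
  rw [cf_def, MvPowerSeries.coeff_X]
  by_cases hd : d = Finsupp.single v 1
  · simp [hd, HahnSeries.coeff_one]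
  · simp [hd]

theorem X_mem_W (v : Var) : (MvPowerSeries.X v : Ser R) ∈ W R w (-w v) := by
  intro d m hm
  rw [cf_X, if_neg]
  rintro ⟨rfl, rfl⟩
  rw [wt_single] at hm
  push_cast at hm
  omega

theorem rat_smul_mem_W [Algebra ℚ R] (c : ℚ) (hA : A ∈ W R w p) : c • A ∈ W R w p := by
  intro d m hm
  rw [cf_smul, hA d m hm, smul_zero]

theorem pow_mem_W (hA : A ∈ W R w p) (n : ℕ) : A ^ n ∈ W R w (n * p) := by
  induction n with
  | zero => simpa using one_mem_W
  | succ n ih =>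
    rw [pow_succ]
    convert mul_mem_W ih hA using 2
    push_cast; ring

theorem HasFormalSum.mem_W {a : ι → Ser R} (ha : HasFormalSum a A) (h : ∀ i, a i ∈ W R w p) :
    A ∈ W R w p := by
  intro d m hm
  rw [← ha.finsum_cf]
  exact finsum_eq_zero_of_forall_eq_zero fun i => h i d m hm

/-- A family whose weighted degrees tend to `-∞` is summable. -/
theorem exists_hasFormalSum (w : Var → ℕ) {a : ι → Ser R}
    (h : ∀ p : ℤ, {i | a i ∉ W R w p}.Finite) : ∃ A, HasFormalSum a A := by
  have key : ∀ d, ∃ F : HahnSeries.SummableFamily ℤ R ι,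
      ∀ i, F i = MvPowerSeries.coeff d (a i) := by
    intro d
    refine ⟨⟨fun i => MvPowerSeries.coeff d (a i), ?_, fun g => ?_⟩, fun i => rfl⟩
    · rw [isPWO_int_iff]
      have h1 : BddBelow (⋃ i ∈ {i | a i ∉ W R w 0}, (MvPowerSeries.coeff d (a i)).support) := by
        refine (h 0).bddBelow_biUnion.2 fun i _ => ?_
        exact isPWO_int_iff.1 (MvPowerSeries.coeff d (a i)).isPWO_support
      have h2 : BddBelow {j : ℤ | -(wt w d : ℤ) ≤ j} := ⟨_, fun j hj => hj⟩
      refine (h1.union h2).mono fun j hj => ?_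
      obtain ⟨i, hi⟩ := Set.mem_iUnion.1 hj
      by_cases hW : a i ∈ W R w 0
      · refine Or.inr (show -(wt w d : ℤ) ≤ j from not_lt.1 fun hlt => hi ?_)
        have := hW d (-j) (by omega)
        rwa [cf_def, neg_neg] at this
      · exact Or.inl (Set.mem_biUnion (show i ∈ {i | a i ∉ W R w 0} from hW) hi)
    · refine (h (-g - 1 - wt w d)).subset fun i hi hW => hi ?_
      have := hW d (-g) (by omega)
      rwa [cf_def, neg_neg] at this
  choose F hF using key
  exact ⟨fun d => (F d).hsum, fun d => ⟨F d, hF d, rfl⟩⟩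

theorem exists_hasFormalSum_nat {a : ℕ → Ser R} (p : ℤ) (h : ∀ n : ℕ, a n ∈ W R 0 (p - n)) :
    ∃ A ∈ W R 0 p, HasFormalSum a A := by
  obtain ⟨A, hA⟩ := exists_hasFormalSum (a := a) 0 fun q =>
    (Set.finite_lt_nat (p - q).toNat).subset fun n hn => by
      by_contra hlt
      simp only [Set.mem_ofPred_eq, not_lt] at hlt
      exact hn (W_mono (by omega) (h n))
  exact ⟨A, hA.mem_W fun n => W_mono (by omega) (h n), hA⟩

end Filtration

/-! ### The bracket -/

theorem addHom_rat_smul {V V' : Type*} [CommRing V] [CommRing V'] [Algebra ℚ V] [Algebra ℚ V']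
    (f : V →+ V') (q : ℚ) (A : V) : f (q • A) = q • f A :=
  map_rat_smul f q A

section Bracket

variable {R : Type*} [CommRing R]

theorem pd_add (v : Var) (A B : Ser R) : pd v (A + B) = pd v A + pd v B := map_add _ _ _
theorem pd_sub (v : Var) (A B : Ser R) : pd v (A - B) = pd v A - pd v B := map_sub _ _ _
theorem pd_one (v : Var) : pd v (1 : Ser R) = 0 := Derivation.map_one_eq_zero _
theorem pd_mul (v : Var) (A B : Ser R) : pd v (A * B) = A * pd v B + pd v A * B := by
  rw [pd, Derivation.leibniz, smul_eq_mul, smul_eq_mul, mul_comm B]; rfl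

theorem dk_neg (A : Ser R) : dk (-A) = -dk A := ser_ext fun d m => by simp [cf_dk]
theorem dk_sub (A B : Ser R) : dk (A - B) = dk A - dk B := by
  rw [sub_eq_add_neg, dk_add, dk_neg, sub_eq_add_neg]
theorem dk_one : dk (1 : Ser R) = 0 := by
  have := dk_mul (1 : Ser R) 1
  simpa using this

theorem pd_comm (u v : Var) (A : Ser R) : pd u (pd v A) = pd v (pd u A) := by
  refine ser_ext fun d m => ?_
  simp only [cf_pd]
  rw [add_right_comm]
  by_cases h : u = v
  · subst h; ring
  · have h1 : (d + Finsupp.single u 1 : Var →₀ ℕ) v = d v := by simp [h]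
    have h2 : (d + Finsupp.single v 1 : Var →₀ ℕ) u = d u := by
      simp [Ne.symm h]
    rw [h1, h2]; ring

theorem dk_pd (v : Var) (A : Ser R) : dk (pd v A) = pd v (dk A) := by
  refine ser_ext fun d m => ?_
  simp only [cf_pd, cf_dk]; ring

theorem bracket_add_right (A B C : Ser R) : bracket A (B + C) = bracket A B + bracket A C := by
  simp only [bracket, pd_add, dk_add]; ring
theorem bracket_add_left (A B C : Ser R) : bracket (A + B) C = bracket A C + bracket B C := by
  simp only [bracket, pd_add, dk_add]; ring
theorem bracket_skew (A B : Ser R) : bracket A B = -bracket B A := by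
  simp only [bracket]; ring
theorem bracket_self (A : Ser R) : bracket A A = 0 := by simp only [bracket]; ring
theorem bracket_mul_right (A B C : Ser R) :
    bracket A (B * C) = B * bracket A C + bracket A B * C := by
  simp only [bracket, pd_mul, dk_mul]; ring
/-- The Jacobi identity: `ad A` is a derivation of the bracket. -/
theorem bracket_jacobi (A B C : Ser R) :
    bracket A (bracket B C) = bracket B (bracket A C) + bracket (bracket A B) C := by
  simp only [bracket, pd_sub, dk_sub, pd_mul, dk_mul, dk_pd]; ring
theorem pd_bracket (v : Var) (A B : Ser R) :
    pd v (bracket A B) = bracket A (pd v B) + bracket (pd v A) B := by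
  simp only [bracket, pd_sub, pd_mul, dk_pd, pd_comm v Var.x]; ring

/-- The bracket as a biadditive map. -/
noncomputable def bracketHom : Ser R →+ Ser R →+ Ser R :=
  AddMonoidHom.mk' (fun A => AddMonoidHom.mk' (bracket A) (bracket_add_right A)) fun A B => by
    ext C : 1; exact bracket_add_left A B C

theorem bracketHom_apply (A B : Ser R) : bracketHom A B = bracket A B := rfl

theorem bracket_zero_right (A : Ser R) : bracket A 0 = 0 := map_zero (bracketHom A)
theorem bracket_neg_right (A B : Ser R) : bracket A (-B) = -bracket A B := map_neg (bracketHom A) B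
theorem bracket_neg_left (A B : Ser R) : bracket (-A) B = -bracket A B := by
  rw [bracket_skew, bracket_neg_right, bracket_skew B A, neg_neg]
theorem bracket_sub_right (A B C : Ser R) : bracket A (B - C) = bracket A B - bracket A C :=
  map_sub (bracketHom A) B C
theorem bracket_sub_left (A B C : Ser R) : bracket (A - B) C = bracket A C - bracket B C := by
  rw [sub_eq_add_neg, bracket_add_left, bracket_neg_left, sub_eq_add_neg]
theorem bracket_sum_right {ι : Type*} (A : Ser R) (s : Finset ι) (f : ι → Ser R) :
    bracket A (∑ i ∈ s, f i) = ∑ i ∈ s, bracket A (f i) := map_sum (bracketHom A) f s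
theorem bracket_rat_smul_right [Algebra ℚ R] (q : ℚ) (A B : Ser R) :
    bracket A (q • B) = q • bracket A B :=
  addHom_rat_smul (V := Ser R) (V' := Ser R) (bracketHom A) q B
theorem bracket_rat_smul_left [Algebra ℚ R] (q : ℚ) (A B : Ser R) :
    bracket (q • A) B = q • bracket A B :=
  addHom_rat_smul (V := Ser R) (V' := Ser R) ((AddMonoidHom.flip bracketHom) B) q A

theorem bracket_mem_W {w : Var → ℕ} {p q : ℤ} {A B : Ser R} (hA : A ∈ W R w p)
    (hB : B ∈ W R w q) : bracket A B ∈ W R w (p + q + w Var.x - 1) := by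
  refine sub_mem ?_ ?_
  · convert mul_mem_W (dk_mem_W hA) (pd_mem_W hB Var.x) using 2; ring
  · convert mul_mem_W (dk_mem_W hB) (pd_mem_W hA Var.x) using 2; ring

theorem bracket_mem_W_zero {p q : ℤ} {A B : Ser R} (hA : A ∈ W R 0 p) (hB : B ∈ W R 0 q) :
    bracket A B ∈ W R 0 (p + q - 1) := by
  simpa using bracket_mem_W hA hB

theorem iterate_bracket_mem_W {p : ℤ} {φ A : Ser R} (hφ : φ ∈ W R 0 0) (hA : A ∈ W R 0 p)
    (r : ℕ) : (bracket φ)^[r] A ∈ W R 0 (p - r) := by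
  induction r with
  | zero => simpa using hA
  | succ r ih =>
    rw [Function.iterate_succ_apply']
    convert bracket_mem_W_zero hφ ih using 2
    push_cast; ring

theorem pderiv_C (v : Var) (c : R) : MvPowerSeries.pderiv R v (MvPowerSeries.C c) = 0 := by simp

theorem pd_cst (v : Var) (c : Coef R) : pd v (cst c) = cst (MvPowerSeries.pderiv R v c) := by
  refine ser_ext fun d m => ?_
  rw [cf_pd, cf_cst, cf_cst, MvPowerSeries.coeff_pderiv]
  split_ifs <;> simp

theorem dk_cst (c : Coef R) : dk (cst c) = 0 := by
  refine ser_ext fun d m => ?_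
  rw [cf_dk, cf_cst, map_zero]
  split_ifs with h
  · have : ((m : R) + 1) = ((m + 1 : ℤ) : R) := by push_cast; ring
    rw [this, h]; simp
  · simp

theorem cst_zero : cst (0 : Coef R) = 0 := map_zero _
theorem cst_add (a b : Coef R) : cst (a + b) = cst a + cst b := map_add _ _ _
theorem cst_neg (a : Coef R) : cst (-a) = -cst a := by
  simp only [cst, map_neg]
theorem cst_sub (a b : Coef R) : cst (a - b) = cst a - cst b := by
  simp only [cst, map_sub]

/-- Functions of `t` that do not depend on `x` are central. -/
theorem bracket_cst_right (A : Ser R) {c : Coef R} (hc : MvPowerSeries.pderiv R Var.x c = 0) :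
    bracket A (cst c) = 0 := by
  rw [bracket, pd_cst, dk_cst, hc, cst_zero]; ring

theorem bracket_cst_left (A : Ser R) {c : Coef R} (hc : MvPowerSeries.pderiv R Var.x c = 0) :
    bracket (cst c) A = 0 := by
  rw [bracket_skew, bracket_cst_right A hc, neg_zero]

theorem pd_kPow (v : Var) (i : ℤ) : pd v (kPow i : Ser R) = 0 := by
  refine ser_ext fun d m => ?_
  rw [cf_pd, cf_kPow, if_neg, zero_mul, map_zero]
  rintro ⟨h, -⟩
  simpa using DFunLike.congr_fun h v

theorem dk_kPow (i : ℤ) : dk (kPow i : Ser R) = (i : Ser R) * kPow (i - 1) := by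
  refine ser_ext fun d m => ?_
  rw [cf_dk, cf_kPow, ← zsmul_eq_mul, map_zsmul, cf_kPow, zsmul_eq_mul]
  by_cases h : d = 0 ∧ m + 1 = i
  · rw [if_pos h, if_pos ⟨h.1, by omega⟩, ← h.2]; push_cast; ring
  · rw [if_neg h, if_neg fun h' => h ⟨h'.1, by omega⟩]; simp

theorem kPow_mul (i j : ℤ) : (kPow i * kPow j : Ser R) = kPow (i + j) := by
  rw [kPow, kPow, ← map_mul, HahnSeries.single_mul_single, mul_one, kPow, neg_add]

theorem kPow_zero : (kPow 0 : Ser R) = 1 := by rw [kPow]; simp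

theorem pd_X (u v : Var) : pd u (MvPowerSeries.X v : Ser R) = if u = v then 1 else 0 := by
  rw [pd, MvPowerSeries.pderiv_X]
  simp [Pi.single_apply, eq_comm]

theorem dk_X (v : Var) : dk (MvPowerSeries.X v : Ser R) = 0 := by
  have : (MvPowerSeries.X v : Ser R) = cst (MvPowerSeries.X v) := by rw [cst]; simp
  rw [this, dk_cst]

end Bracket

/-! ### Derivations compatible with formal sums -/

/-- A derivation `δ` along a ring homomorphism `h₀`, both compatible with the bracket and with
formal sums. The examples are `∂/∂v` along the identity, and the coefficient of `ε` along the
evaluation at `ε = 0`. -/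
structure FormalDerivation (S R : Type*) [CommRing S] [CommRing R] where
  /-- The ring homomorphism. -/
  h₀ : Ser S →+* Ser R
  /-- The derivation along `h₀`. -/
  δ : Ser S →+ Ser R
  leibniz : ∀ A B, δ (A * B) = h₀ A * δ B + δ A * h₀ B
  h₀_bracket : ∀ A B, h₀ (bracket A B) = bracket (h₀ A) (h₀ B)
  δ_bracket : ∀ A B, δ (bracket A B) = bracket (h₀ A) (δ B) + bracket (δ A) (h₀ B)
  h₀_sum : ∀ {ι : Type} {a : ι → Ser S} {A : Ser S}, HasFormalSum a A →
    HasFormalSum (fun i => h₀ (a i)) (h₀ A)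
  δ_sum : ∀ {ι : Type} {a : ι → Ser S} {A : Ser S}, HasFormalSum a A →
    HasFormalSum (fun i => δ (a i)) (δ A)

namespace FormalDerivation

variable {R S : Type*} [CommRing R] [CommRing S]

theorem δ_one (E : FormalDerivation S R) : E.δ 1 = 0 := by
  have := E.leibniz 1 1
  simpa using this

theorem δ_pow_succ (E : FormalDerivation S R) (A : Ser S) (n : ℕ) :
    E.δ (A ^ (n + 1)) = (n + 1 : ℕ) * (E.h₀ A ^ n * E.δ A) := by
  induction n with
  | zero => simp
  | succ n ih =>
    rw [pow_succ, E.leibniz, ih, map_pow]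
    push_cast; ring

theorem δ_zpow (E : FormalDerivation S R) (U : (Ser S)ˣ) (i : ℤ) :
    E.δ ((U ^ i : (Ser S)ˣ) : Ser S) =
      (i : Ser R) * (E.h₀ ((U ^ (i - 1) : (Ser S)ˣ) : Ser S) * E.δ (U : Ser S)) := by
  have hU : ∀ i : ℤ, E.h₀ ((U ^ i : (Ser S)ˣ) : Ser S) =
      E.h₀ ((U ^ (i - 1) : (Ser S)ˣ) : Ser S) * E.h₀ (U : Ser S) := fun i => by
    rw [← map_mul, ← Units.val_mul, ← zpow_add_one, sub_add_cancel]
  have step : ∀ i : ℤ, E.δ ((U ^ i : (Ser S)ˣ) : Ser S) =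
      E.h₀ ((U ^ (i - 1) : (Ser S)ˣ) : Ser S) * E.δ (U : Ser S) +
        E.δ ((U ^ (i - 1) : (Ser S)ˣ) : Ser S) * E.h₀ (U : Ser S) := fun i => by
    rw [← E.leibniz, ← Units.val_mul, ← zpow_add_one, sub_add_cancel]
  induction i using Int.induction_on with
  | zero => simp [E.δ_one]
  | succ i ih =>
    rw [step, add_sub_cancel_right, ih, hU i]
    push_cast; ring
  | pred i ih =>
    have hinv : E.h₀ (U : Ser S) * E.h₀ (↑U⁻¹ : Ser S) = 1 := by
      rw [← map_mul, Units.mul_inv, map_one]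
    have h1 := step (-i)
    have h2 := hU (-i - 1)
    rw [ih] at h1
    push_cast at h1 ⊢
    linear_combination (-E.h₀ (↑U⁻¹ : Ser S)) * h1 -
      (E.δ ((U ^ (-(i : ℤ) - 1) : (Ser S)ˣ) : Ser S) -
        (-(i : Ser R) - 1) * E.h₀ ((U ^ (-(i : ℤ) - 1 - 1) : (Ser S)ˣ) : Ser S) *
          E.δ (U : Ser S)) * hinv -
      ((i : Ser R) + 1) * E.δ (U : Ser S) * E.h₀ (↑U⁻¹ : Ser S) * h2

/-- The partial derivative with respect to an independent variable. -/
noncomputable def ofVar (R : Type*) [CommRing R] (v : Var) : FormalDerivation R R where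
  h₀ := RingHom.id _
  δ := AddMonoidHom.mk' (pd v) (pd_add v)
  leibniz := pd_mul v
  h₀_bracket _ _ := rfl
  δ_bracket := pd_bracket v
  h₀_sum h := h
  δ_sum h := h.pd v

/-- The derivative with respect to `k`. -/
noncomputable def ofK (R : Type*) [CommRing R] : FormalDerivation R R where
  h₀ := RingHom.id _
  δ := AddMonoidHom.mk' dk dk_add
  leibniz := dk_mul
  h₀_bracket _ _ := rfl
  δ_bracket A B := by
    simp only [bracket, AddMonoidHom.mk'_apply, dk_sub, dk_mul, dk_pd, RingHom.id_apply]; ring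
  h₀_sum h := h
  δ_sum h := h.dk

/-- The bracket with a fixed series, as a derivation along the ring homomorphism of another
derivation. -/
noncomputable def ad (E : FormalDerivation S R) (H : Ser R) : FormalDerivation S R where
  h₀ := E.h₀
  δ := (bracketHom H).comp E.h₀.toAddMonoidHom
  leibniz A B := by
    change bracket H (E.h₀ (A * B)) = E.h₀ A * bracket H (E.h₀ B) + bracket H (E.h₀ A) * E.h₀ B
    rw [map_mul, bracket_mul_right]
  h₀_bracket := E.h₀_bracket
  δ_bracket A B := by
    change bracket H (E.h₀ (bracket A B)) =
      bracket (E.h₀ A) (bracket H (E.h₀ B)) + bracket (bracket H (E.h₀ A)) (E.h₀ B)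
    rw [E.h₀_bracket, bracket_jacobi]
  h₀_sum h := E.h₀_sum h
  δ_sum h := (E.h₀_sum h).bracket_right H

theorem ad_δ (E : FormalDerivation S R) (H : Ser R) (A : Ser S) :
    (E.ad H).δ A = bracket H (E.h₀ A) := rfl

/-- A derivation that agrees with `ad H` on an invertible element does so on all its powers. -/
theorem δ_zpow_eq_bracket (E : FormalDerivation S R) {U : (Ser S)ˣ} {H : Ser R}
    (h : E.δ (U : Ser S) = bracket H (E.h₀ (U : Ser S))) (i : ℤ) :
    E.δ ((U ^ i : (Ser S)ˣ) : Ser S) = bracket H (E.h₀ ((U ^ i : (Ser S)ˣ) : Ser S)) := by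
  rw [← ad_δ, (E.ad H).δ_zpow, E.δ_zpow, ad_δ, h]; rfl

end FormalDerivation

/-! ### The exponential of `ad φ` -/

/-! Rational multiples in a commutative `ℚ`-algebra, for use in `Ser R`, where the scalar action is
the one of the algebra structure. -/

section RatSMul

variable {V : Type*} [CommRing V] [Algebra ℚ V]

theorem rat_smul_smul (a b : ℚ) (x : V) : a • b • x = (a * b) • x := smul_smul a b x
theorem rat_smul_add (a : ℚ) (x y : V) : a • (x + y) = a • x + a • y := smul_add a x y
theorem add_rat_smul (a b : ℚ) (x : V) : (a + b) • x = a • x + b • x := add_smul a b x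
theorem one_rat_smul (x : V) : (1 : ℚ) • x = x := one_smul ℚ x
theorem zero_rat_smul (x : V) : (0 : ℚ) • x = 0 := zero_smul ℚ x
theorem rat_smul_zero (a : ℚ) : a • (0 : V) = 0 := smul_zero a
theorem rat_smul_sum {ι : Type*} (a : ℚ) (s : Finset ι) (f : ι → V) :
    a • ∑ i ∈ s, f i = ∑ i ∈ s, a • f i := Finset.smul_sum
theorem sum_rat_smul {ι : Type*} (s : Finset ι) (f : ι → ℚ) (x : V) :
    (∑ i ∈ s, f i) • x = ∑ i ∈ s, f i • x := Finset.sum_smul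

end RatSMul

section Iterate

variable {R S : Type*} [CommRing R] [CommRing S]

theorem FormalDerivation.h₀_iterate (E : FormalDerivation S R) (φ A : Ser S) (r : ℕ) :
    E.h₀ ((bracket φ)^[r] A) = (bracket (E.h₀ φ))^[r] (E.h₀ A) := by
  induction r with
  | zero => rfl
  | succ r ih => rw [Function.iterate_succ_apply', Function.iterate_succ_apply', E.h₀_bracket, ih]

theorem iterate_bracket_sub (φ A B : Ser R) (r : ℕ) :
    (bracket φ)^[r] (A - B) = (bracket φ)^[r] A - (bracket φ)^[r] B := by
  induction r with
  | zero => rfl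
  | succ r ih => simp only [Function.iterate_succ_apply', ih, bracket_sub_right]

theorem HasFormalSum.iterate_bracket {ι : Type*} {a : ι → Ser R} {A : Ser R}
    (h : HasFormalSum a A) (φ : Ser R) (r : ℕ) :
    HasFormalSum (fun i => (DcmKP.bracket φ)^[r] (a i)) ((DcmKP.bracket φ)^[r] A) := by
  induction r with
  | zero => exact h
  | succ r ih =>
    rw [Function.iterate_succ_apply']
    exact (ih.bracket_right φ).congr fun i => Function.iterate_succ_apply' _ _ _

end Iterate

section Exp

variable {R S : Type*} [CommRing R] [CommRing S] [Algebra ℚ R] [Algebra ℚ S]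

theorem succ_smul_cancel {n : ℕ} {A B : Ser R}
    (h : ((n : ℚ) + 1) • A = ((n : ℚ) + 1) • B) : A = B := by
  have hn : ((n : ℚ) + 1) ≠ 0 := by positivity
  rw [← one_rat_smul A, ← one_rat_smul B, ← inv_mul_cancel₀ hn, ← rat_smul_smul, h, rat_smul_smul]

theorem expAdFamily_zero (φ A : Ser R) : expAdFamily φ A 0 = A := by
  simp [expAdFamily, one_rat_smul]

theorem nablaFamily_zero (φ A : Ser R) : nablaFamily φ A 0 = A := by
  simp [nablaFamily, one_rat_smul]

theorem expAdFamily_succ (φ A : Ser R) (r : ℕ) :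
    ((r : ℚ) + 1) • expAdFamily φ A (r + 1) = bracket φ (expAdFamily φ A r) := by
  rw [expAdFamily, expAdFamily, bracket_rat_smul_right, Function.iterate_succ_apply', rat_smul_smul,
    Nat.factorial_succ]
  congr 1
  have : (r.factorial : ℚ) ≠ 0 := by positivity
  push_cast
  field_simp

theorem nablaFamily_succ (φ A : Ser R) (r : ℕ) :
    ((r : ℚ) + 2) • nablaFamily φ A (r + 1) = bracket φ (nablaFamily φ A r) := by
  rw [nablaFamily, nablaFamily, bracket_rat_smul_right, Function.iterate_succ_apply', rat_smul_smul,
    Nat.factorial_succ (r + 1)]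
  congr 1
  have : ((r + 1).factorial : ℚ) ≠ 0 := by positivity
  push_cast
  field_simp
  ring

theorem FormalDerivation.δ_rat_smul (E : FormalDerivation S R) (q : ℚ) (A : Ser S) :
    E.δ (q • A) = q • E.δ A := addHom_rat_smul (V := Ser S) (V' := Ser R) E.δ q A

theorem FormalDerivation.h₀_rat_smul (E : FormalDerivation S R) (q : ℚ) (A : Ser S) :
    E.h₀ (q • A) = q • E.h₀ A :=
  addHom_rat_smul (V := Ser S) (V' := Ser R) E.h₀.toAddMonoidHom q A

theorem sum_antidiagonal_weight (n : ℕ) (f : ℕ × ℕ → Ser R) :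
    ((n : ℚ) + 1) • ∑ p ∈ Finset.HasAntidiagonal.antidiagonal (n + 1), f p =
      ∑ p ∈ Finset.HasAntidiagonal.antidiagonal n,
        (((p.1 : ℚ) + 1) • f (p.1 + 1, p.2) + ((p.2 : ℚ) + 1) • f (p.1, p.2 + 1)) := by
  have h1 : ((n : ℚ) + 1) • ∑ p ∈ Finset.HasAntidiagonal.antidiagonal (n + 1), f p =
      ∑ p ∈ Finset.HasAntidiagonal.antidiagonal (n + 1), (p.1 : ℚ) • f p +
      ∑ p ∈ Finset.HasAntidiagonal.antidiagonal (n + 1), (p.2 : ℚ) • f p := by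
    rw [rat_smul_sum, ← Finset.sum_add_distrib]
    refine Finset.sum_congr rfl fun p hp => ?_
    rw [← add_rat_smul]
    congr 1
    have := Finset.HasAntidiagonal.mem_antidiagonal.1 hp
    exact_mod_cast this.symm
  rw [h1, Finset.Nat.sum_antidiagonal_succ, Finset.Nat.sum_antidiagonal_succ',
    Finset.sum_add_distrib]
  simp [zero_rat_smul]

/-- `e ^ ad φ` is compatible with any biadditive operation of which `ad φ` is a derivation. -/
theorem expAdFamily_biadditive (φ : Ser R) (β : Ser R →+ Ser R →+ Ser R)
    (hβ : ∀ A B, bracket φ (β A B) = β A (bracket φ B) + β (bracket φ A) B) (A B : Ser R)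
    (n : ℕ) : expAdFamily φ (β A B) n =
      ∑ p ∈ Finset.HasAntidiagonal.antidiagonal n,
        β (expAdFamily φ A p.1) (expAdFamily φ B p.2) := by
  have hl : ∀ (q : ℚ) A B, β (q • A) B = q • β A B := fun q A B =>
    addHom_rat_smul (V := Ser R) (V' := Ser R) ((AddMonoidHom.flip β) B) q A
  have hr : ∀ (q : ℚ) A B, β A (q • B) = q • β A B := fun q A B =>
    addHom_rat_smul (V := Ser R) (V' := Ser R) (β A) q B
  induction n with
  | zero => simp [expAdFamily_zero]
  | succ n ih =>
    refine succ_smul_cancel (n := n) ?_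
    rw [expAdFamily_succ, ih, bracket_sum_right, sum_antidiagonal_weight]
    refine Finset.sum_congr rfl fun p _ => ?_
    rw [hβ, ← expAdFamily_succ, ← expAdFamily_succ, hl, hr, add_comm]

theorem hasFormalSum_expAd_mul {φ A B A' B' : Ser R} (hA : HasFormalSum (expAdFamily φ A) A')
    (hB : HasFormalSum (expAdFamily φ B) B') :
    HasFormalSum (expAdFamily φ (A * B)) (A' * B') :=
  (hA.mul hB).antidiagonal.congr
    (expAdFamily_biadditive φ AddMonoidHom.mul (fun A B => bracket_mul_right φ A B) A B)

theorem hasFormalSum_expAd_bracket {φ A B A' B' : Ser R}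
    (hA : HasFormalSum (expAdFamily φ A) A') (hB : HasFormalSum (expAdFamily φ B) B') :
    HasFormalSum (expAdFamily φ (bracket A B)) (bracket A' B') :=
  (hA.bracket hB).antidiagonal.congr
    (expAdFamily_biadditive φ bracketHom (fun A B => bracket_jacobi φ A B) A B)

theorem hasFormalSum_expAd_one (φ : Ser R) : HasFormalSum (expAdFamily φ 1) 1 := by
  have h : ∀ j ≠ 0, expAdFamily φ (1 : Ser R) j = 0 := fun j hj => by
    obtain ⟨r, rfl⟩ := Nat.exists_eq_succ_of_ne_zero hj
    have h0 : ∀ r, (bracket φ)^[r + 1] (1 : Ser R) = 0 := fun r => by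
      induction r with
      | zero => simp [bracket, pd_one, dk_one]
      | succ r ih => rw [Function.iterate_succ_apply', ih, bracket_zero_right]
    rw [expAdFamily, h0, rat_smul_zero]
  simpa [expAdFamily_zero] using hasFormalSum_single 0 h

theorem FormalDerivation.h₀_expAd (E : FormalDerivation S R) (φ A : Ser S) (r : ℕ) :
    E.h₀ (expAdFamily φ A r) = expAdFamily (E.h₀ φ) (E.h₀ A) r := by
  rw [expAdFamily, E.h₀_rat_smul, E.h₀_iterate, expAdFamily]

/-- The derivative of `e ^ {ad φ} A` is `{∇ φ, e ^ {ad φ} A} + e ^ {ad φ} (δ A)`, in every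
order in `φ`. -/
theorem FormalDerivation.δ_expAd_succ (E : FormalDerivation S R) (φ A : Ser S) (n : ℕ) :
    E.δ (expAdFamily φ A (n + 1)) = expAdFamily (E.h₀ φ) (E.δ A) (n + 1) +
      ∑ p ∈ Finset.HasAntidiagonal.antidiagonal n,
        bracket (nablaFamily (E.h₀ φ) (E.δ φ) p.1) (expAdFamily (E.h₀ φ) (E.h₀ A) p.2) := by
  induction n with
  | zero =>
    have h : ∀ (φ A : Ser R), expAdFamily φ A 1 = bracket φ A := fun φ A => by
      simp [expAdFamily, one_rat_smul]
    have h' : ∀ (φ A : Ser S), expAdFamily φ A 1 = bracket φ A := fun φ A => by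
      simp [expAdFamily, one_rat_smul]
    simp only [zero_add, h, h', E.δ_bracket, Finset.HasAntidiagonal.antidiagonal_zero,
      Finset.sum_singleton, nablaFamily_zero, expAdFamily_zero]
  | succ n ih =>
    refine succ_smul_cancel (n := n + 1) ?_
    have hs := expAdFamily_succ φ A (n + 1)
    have hs' := expAdFamily_succ (E.h₀ φ) (E.δ A) (n + 1)
    rw [← E.δ_rat_smul, hs, E.δ_bracket, ih, E.h₀_expAd, rat_smul_add, hs', bracket_add_right,
      add_assoc]
    congr 1
    rw [bracket_sum_right]
    push_cast
    rw [add_rat_smul, one_rat_smul, sum_antidiagonal_weight]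
    rw [Finset.Nat.sum_antidiagonal_succ (f := fun p => bracket (nablaFamily (E.h₀ φ) (E.δ φ) p.1)
      (expAdFamily (E.h₀ φ) (E.h₀ A) p.2)), nablaFamily_zero,
      add_comm (bracket (E.δ φ) _), ← add_assoc, ← Finset.sum_add_distrib]
    congr 1
    refine Finset.sum_congr rfl fun p _ => ?_
    rw [bracket_jacobi, ← nablaFamily_succ, ← expAdFamily_succ, bracket_rat_smul_left,
      bracket_rat_smul_right, show (p.1 : ℚ) + 2 = (p.1 + 1) + 1 by ring, add_rat_smul (_ + 1),
      one_rat_smul]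
    abel

/-- The dressed form of the variation: `e ^ {ad φ} (δ A) = δ A' - {H, A'}` for `A' = e ^ {ad φ} A`
and `H = ∇ φ`. -/
theorem FormalDerivation.hasFormalSum_expAd (E : FormalDerivation S R) {φ A A' : Ser S}
    {H : Ser R} (hA : HasFormalSum (expAdFamily φ A) A')
    (hH : HasFormalSum (nablaFamily (E.h₀ φ) (E.δ φ)) H) :
    HasFormalSum (expAdFamily (E.h₀ φ) (E.δ A)) (E.δ A' - bracket H (E.h₀ A')) := by
  have h0 : HasFormalSum (expAdFamily (E.h₀ φ) (E.h₀ A)) (E.h₀ A') :=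
    (E.h₀_sum hA).congr fun r => (E.h₀_expAd φ A r).symm
  have h1 := (hH.bracket h0).antidiagonal
  -- The sum over antidiagonals of order `n` contributes to the order `n + 1` in `φ`.
  have h2 : HasFormalSum (fun r : ℕ => match r with
      | 0 => (0 : Ser R)
      | n + 1 => ∑ p ∈ Finset.HasAntidiagonal.antidiagonal n,
        bracket (nablaFamily (E.h₀ φ) (E.δ φ) p.1) (expAdFamily (E.h₀ φ) (E.h₀ A) p.2))
      (bracket H (E.h₀ A')) := by
    classical
    refine h1.fiberwise (fun n => n + 1) fun r => ?_
    cases r with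
    | zero => exact hasFormalSum_zero.congr fun i => by simp
    | succ n =>
      have := hasFormalSum_single (a := fun i => if i + 1 = n + 1 then
        ∑ p ∈ Finset.HasAntidiagonal.antidiagonal i, bracket
          (nablaFamily (E.h₀ φ) (E.δ φ) p.1) (expAdFamily (E.h₀ φ) (E.h₀ A) p.2) else 0) n
        fun j hj => if_neg (by omega)
      simpa using this
  refine ((E.δ_sum hA).sub h2).congr fun r => ?_
  cases r with
  | zero => simp [expAdFamily_zero]
  | succ n => rw [E.δ_expAd_succ]; simp

theorem iterate_bracket_rat_smul (φ A : Ser R) (q : ℚ) (r : ℕ) :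
    (bracket φ)^[r] (q • A) = q • (bracket φ)^[r] A := by
  induction r with
  | zero => rfl
  | succ r ih => rw [Function.iterate_succ_apply', ih, bracket_rat_smul_right,
      Function.iterate_succ_apply']

/-- Power series in `ad φ` converge on series with powers of `k` bounded above. -/
theorem exists_hasFormalSum_ad (c : ℕ → ℚ) {φ A : Ser R} {p : ℤ} (hφ : φ ∈ W R 0 0)
    (hA : A ∈ W R 0 p) : ∃ B ∈ W R 0 p, HasFormalSum (fun r => c r • (bracket φ)^[r] A) B :=
  exists_hasFormalSum_nat p fun n => rat_smul_mem_W _ (iterate_bracket_mem_W hφ hA n)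

theorem bernoulli_mul_inv_factorial (n : ℕ) :
    ∑ p ∈ Finset.HasAntidiagonal.antidiagonal n,
      (bernoulli p.1 / (p.1.factorial : ℚ)) * (((p.2 + 1).factorial : ℚ)⁻¹) =
      if n = 0 then 1 else 0 := by
  have h := congrArg (PowerSeries.coeff (n + 1)) (bernoulliPowerSeries_mul_exp_sub_one ℚ)
  rw [PowerSeries.coeff_mul, Finset.Nat.sum_antidiagonal_succ', PowerSeries.coeff_X] at h
  simp only [bernoulliPowerSeries, PowerSeries.coeff_mk, map_sub, PowerSeries.coeff_exp,
    PowerSeries.coeff_one] at h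
  simpa [add_eq_right] using h

/-- The operator `T / (e ^ T - 1)` with `T = ad φ` is inverse to `∑ T ^ r / (r + 1)!`. -/
theorem hasFormalSum_todd {φ X H : Ser R} {p : ℤ} (hφ : φ ∈ W R 0 0) (hX : X ∈ W R 0 p)
    (hH : HasFormalSum (nablaFamily φ X) H) : HasFormalSum (toddFamily φ H) X := by
  have hc : ∀ q : ℕ × ℕ, (bernoulli q.1 / (q.1.factorial : ℚ)) •
      (bracket φ)^[q.1] (nablaFamily φ X q.2) =
      ((bernoulli q.1 / (q.1.factorial : ℚ)) * (((q.2 + 1).factorial : ℚ)⁻¹)) •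
        (bracket φ)^[q.1 + q.2] X := fun q => by
    rw [nablaFamily, iterate_bracket_rat_smul, rat_smul_smul, Function.iterate_add_apply]
  obtain ⟨A, hA⟩ := exists_hasFormalSum (R := R) (a := fun q : ℕ × ℕ =>
      (bernoulli q.1 / (q.1.factorial : ℚ)) • (bracket φ)^[q.1] (nablaFamily φ X q.2)) 0
    fun s => by
      refine ((Set.finite_lt_nat (p - s).toNat).prod (Set.finite_lt_nat (p - s).toNat)).subset
        fun q hq => ?_
      have h1 : ¬ p - (q.1 + q.2 : ℕ) ≤ s := fun hle => hq (by
        rw [hc]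
        exact W_mono hle (rat_smul_mem_W _ (iterate_bracket_mem_W hφ hX _)))
      simp only [Set.mem_prod, Set.mem_ofPred_eq]
      omega
  have hrow : HasFormalSum (toddFamily φ H) A := by
    refine hA.rows fun r => ?_
    have h := (hH.iterate_bracket φ r).rat_smul (bernoulli r / (r.factorial : ℚ))
    exact h
  have hdiag := hA.antidiagonal
  have hX' : HasFormalSum (fun n => ∑ q ∈ Finset.HasAntidiagonal.antidiagonal n,
      (bernoulli q.1 / (q.1.factorial : ℚ)) • (bracket φ)^[q.1] (nablaFamily φ X q.2)) X := by
    have hn : ∀ n, ∑ q ∈ Finset.HasAntidiagonal.antidiagonal n,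
        (bernoulli q.1 / (q.1.factorial : ℚ)) • (bracket φ)^[q.1] (nablaFamily φ X q.2) =
        (if n = 0 then (1 : ℚ) else 0) • (bracket φ)^[n] X := fun n => by
      rw [← bernoulli_mul_inv_factorial, sum_rat_smul]
      refine Finset.sum_congr rfl fun q hq => ?_
      rw [hc, Finset.HasAntidiagonal.mem_antidiagonal.1 hq]
    have := hasFormalSum_single (a := fun n => (if n = 0 then (1 : ℚ) else 0) •
      (bracket φ)^[n] X) 0 fun j hj => by simp [hj, zero_rat_smul]
    exact HasFormalSum.congr (by simpa [one_rat_smul] using this) hn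
  rwa [hdiag.unique hX'] at hrow

end Exp

/-! ### Series over the dual numbers -/

open DualNumber

section MapSer

variable {R S : Type*} [CommRing R] [CommRing S]

theorem mapSer_add (h : R →+ S) (A B : Ser R) : mapSer h (A + B) = mapSer h A + mapSer h B :=
  ser_ext fun d m => by simp only [cf_mapSer, map_add]

theorem mapSer_zero (h : R →+ S) : mapSer h (0 : Ser R) = 0 :=
  ser_ext fun d m => by simp only [cf_mapSer, map_zero]

theorem mul_natCast_add_one (n : ℕ) (x : R) : x * ((n : R) + 1) = (n + 1) • x := by
  rw [nsmul_eq_mul, mul_comm]; push_cast; ring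

theorem intCast_add_one_mul (n : ℤ) (x : R) : ((n : R) + 1) * x = (n + 1 : ℤ) • x := by
  rw [zsmul_eq_mul]; push_cast; ring

theorem mapSer_pd (h : R →+ S) (v : Var) (A : Ser R) : mapSer h (pd v A) = pd v (mapSer h A) := by
  refine ser_ext fun d m => ?_
  simp only [cf_mapSer, cf_pd]
  rw [mul_natCast_add_one, mul_natCast_add_one, map_nsmul]

theorem mapSer_dk (h : R →+ S) (A : Ser R) : mapSer h (dk A) = dk (mapSer h A) := by
  refine ser_ext fun d m => ?_
  simp only [cf_mapSer, cf_dk]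
  rw [intCast_add_one_mul, intCast_add_one_mul, map_zsmul]

theorem mapSer_part (h : R →+ S) (T : Set ℤ) (A : Ser R) :
    mapSer h (part T A) = part T (mapSer h A) := by
  classical
  refine ser_ext fun d m => ?_
  simp only [cf_mapSer, cf_part]
  split_ifs <;> simp

theorem mapSer_mem_W (h : R →+ S) {w : Var → ℕ} {p : ℤ} {A : Ser R} (hA : A ∈ W R w p) :
    mapSer h A ∈ W S w p := fun d m hm => by rw [cf_mapSer, hA d m hm, map_zero]

theorem mapSer_cst (h : R →+ S) (c : Coef R) : mapSer h (cst c) = cst (mapCoef h c) := by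
  refine ser_ext fun d m => ?_
  rw [cf_mapSer, cf_cst, cf_cst, coeff_mapCoef]
  split_ifs <;> simp

theorem mapCoef_kCoeff (h : R →+ S) (m : ℤ) (A : Ser R) :
    mapCoef h (kCoeff m A) = kCoeff m (mapSer h A) := rfl

theorem mapCoef_pderiv (h : R →+ S) (v : Var) (c : Coef R) :
    mapCoef h (MvPowerSeries.pderiv R v c) = MvPowerSeries.pderiv S v (mapCoef h c) := by
  refine MvPowerSeries.ext fun d => ?_
  rw [coeff_mapCoef, MvPowerSeries.coeff_pderiv, MvPowerSeries.coeff_pderiv, coeff_mapCoef]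
  rw [mul_natCast_add_one, mul_natCast_add_one, map_nsmul]

end MapSer

section Dual

variable {K : Type*} [Field K]

theorem sndK_apply (x : K[ε]) : sndK x = TrivSqZeroExt.snd x := rfl
theorem fstK_one : fstK (1 : K[ε]) = 1 := TrivSqZeroExt.fst_one (R := K) (M := K)
theorem sndK_one : sndK (1 : K[ε]) = 0 := TrivSqZeroExt.snd_one (R := K) (M := K)
theorem fstK_mul (x y : K[ε]) : fstK (x * y) = fstK x * fstK y := TrivSqZeroExt.fst_mul x y
theorem sndK_mul (x y : K[ε]) : sndK (x * y) = fstK x * sndK y + sndK x * fstK y := by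
  rw [sndK_apply, TrivSqZeroExt.snd_mul]
  rw [smul_eq_mul, op_smul_eq_smul, smul_eq_mul, mul_comm (TrivSqZeroExt.fst y)]; rfl

theorem fstK_inlK (x : K) : fstK (inlK x) = x := rfl
theorem sndK_inlK (x : K) : sndK (inlK x) = 0 := rfl
theorem fstK_inrK (x : K) : fstK (inrK x) = 0 := rfl
theorem sndK_inrK (x : K) : sndK (inrK x) = x := rfl

theorem inlK_add_inrK (x : K[ε]) : inlK (fstK x) + inrK (sndK x) = x :=
  TrivSqZeroExt.inl_fst_add_inr_snd_eq x

theorem fst_mul (A B : Ser K[ε]) :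
    mapSer fstK (A * B) = mapSer fstK A * mapSer fstK B := by
  have := mul_formula_of_cf (S := K[ε]) (R := K) (g := fstK) (f₁ := fstK) (f₂ := fstK) (f₃ := 0)
    (f₄ := 0) (δ := mapSer fstK) (T₁ := mapSer fstK) (T₂ := mapSer fstK) (T₃ := fun _ => 0)
    (T₄ := fun _ => 0) (by simp [fstK_mul]) (fun _ _ _ => rfl) (fun _ _ _ => rfl)
    (fun _ _ _ => rfl) (by simp) (by simp) A B
  simpa using this

theorem snd_mul (A B : Ser K[ε]) :
    mapSer sndK (A * B) = mapSer fstK A * mapSer sndK B + mapSer sndK A * mapSer fstK B :=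
  mul_formula_of_cf (S := K[ε]) (R := K) (g := sndK) sndK_mul (fun _ _ _ => rfl)
    (fun _ _ _ => rfl) (fun _ _ _ => rfl) (fun _ _ _ => rfl) (fun _ _ _ => rfl) A B

theorem fst_one : mapSer fstK (1 : Ser K[ε]) = 1 :=
  ser_ext fun d m => by rw [cf_mapSer, cf_one, cf_one]; split_ifs <;> simp [fstK_one]

theorem mapSer_sub {R S : Type*} [CommRing R] [CommRing S] (h : R →+ S) (A B : Ser R) :
    mapSer h (A - B) = mapSer h A - mapSer h B :=
  ser_ext fun d m => by simp only [cf_mapSer, map_sub]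

variable (K) in
/-- The coefficient of `ε`, as a derivation along the evaluation at `ε = 0`. -/
noncomputable def FormalDerivation.ofDual : FormalDerivation K[ε] K where
  h₀ :=
    { toFun := mapSer fstK
      map_one' := fst_one
      map_mul' := fst_mul
      map_zero' := mapSer_zero _
      map_add' := mapSer_add _ }
  δ := AddMonoidHom.mk' (mapSer sndK) (mapSer_add _)
  leibniz := snd_mul
  h₀_bracket A B := by
    change mapSer fstK _ = bracket (mapSer fstK A) (mapSer fstK B)
    simp only [bracket, mapSer_sub, fst_mul, mapSer_dk, mapSer_pd]
  δ_bracket A B := by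
    change mapSer sndK _ = bracket (mapSer fstK A) (mapSer sndK B) +
      bracket (mapSer sndK A) (mapSer fstK B)
    simp only [bracket, mapSer_sub, snd_mul, mapSer_dk, mapSer_pd]
    ring
  h₀_sum h := h.mapSer _
  δ_sum h := h.mapSer _

theorem fst_pow (L : Ser K[ε]) (n : ℕ) : mapSer fstK (L ^ n) = mapSer fstK L ^ n :=
  map_pow (FormalDerivation.ofDual K).h₀ L n

theorem fst_kPow (i : ℤ) : mapSer fstK (kPow i : Ser K[ε]) = kPow i :=
  ser_ext fun d m => by rw [cf_mapSer, cf_kPow, cf_kPow]; split_ifs <;> simp [fstK_one]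

theorem snd_kPow (i : ℤ) : mapSer sndK (kPow i : Ser K[ε]) = 0 :=
  ser_ext fun d m => by rw [cf_mapSer, cf_kPow]; split_ifs <;> simp [sndK_one]

theorem fst_X (v : Var) : mapSer fstK (MvPowerSeries.X v : Ser K[ε]) = MvPowerSeries.X v :=
  ser_ext fun d m => by rw [cf_mapSer, cf_X, cf_X]; split_ifs <;> simp [fstK_one]

theorem snd_X (v : Var) : mapSer sndK (MvPowerSeries.X v : Ser K[ε]) = 0 :=
  ser_ext fun d m => by rw [cf_mapSer, cf_X]; split_ifs <;> simp [sndK_one]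

theorem fst_natCast (n : ℕ) : mapSer fstK (n : Ser K[ε]) = n :=
  map_natCast (FormalDerivation.ofDual K).h₀ n

theorem snd_natCast (n : ℕ) : mapSer sndK (n : Ser K[ε]) = 0 := by
  have : (FormalDerivation.ofDual K).δ (n : Ser K[ε]) = 0 := by
    rw [← nsmul_one, map_nsmul, FormalDerivation.δ_one, nsmul_zero]
  exact this

theorem fst_expand (A A' : Ser K) : mapSer fstK (expand A A') = A :=
  ser_ext fun d m => by simp [expand, cf_mapSer, fstK_inlK, fstK_inrK]

theorem snd_expand (A A' : Ser K) : mapSer sndK (expand A A') = A' :=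
  ser_ext fun d m => by simp [expand, cf_mapSer, sndK_inlK, sndK_inrK]

theorem expand_fst_snd (A : Ser K[ε]) : expand (mapSer fstK A) (mapSer sndK A) = A :=
  ser_ext fun d m => by simp [expand, cf_mapSer, inlK_add_inrK]

theorem fst_expandCoef (c c' : Coef K) : mapCoef fstK (expandCoef c c') = c :=
  MvPowerSeries.ext fun d => by
    rw [coeff_mapCoef, expandCoef, map_add, coeff_mapCoef, coeff_mapCoef, map_add, fstK_inlK,
      fstK_inrK, add_zero]

theorem snd_expandCoef (c c' : Coef K) : mapCoef sndK (expandCoef c c') = c' :=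
  MvPowerSeries.ext fun d => by
    rw [coeff_mapCoef, expandCoef, map_add, coeff_mapCoef, coeff_mapCoef, map_add, sndK_inlK,
      sndK_inrK, zero_add]

theorem ser_dual_ext {A B : Ser K[ε]} (h0 : mapSer fstK A = mapSer fstK B)
    (h1 : mapSer sndK A = mapSer sndK B) : A = B := by
  rw [← expand_fst_snd A, h0, h1, expand_fst_snd]

theorem coef_dual_ext_iff {a b : Coef K[ε]} :
    a = b ↔ mapCoef fstK a = mapCoef fstK b ∧ mapCoef sndK a = mapCoef sndK b := by
  refine ⟨fun h => h ▸ ⟨rfl, rfl⟩, fun h => MvPowerSeries.ext fun d => ?_⟩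
  have h0 := congrArg (MvPowerSeries.coeff d) h.1
  have h1 := congrArg (MvPowerSeries.coeff d) h.2
  rw [coeff_mapCoef, coeff_mapCoef] at h0 h1
  rw [← inlK_add_inrK (MvPowerSeries.coeff d a), h0, h1, inlK_add_inrK]

end Dual

/-! ### Positive and negative parts, residues -/

section Parts

variable {R : Type*} [CommRing R]

theorem cf_pos (d : Var →₀ ℕ) (m : ℤ) (A : Ser R) :
    cf d m (pos A) = if 0 < m then cf d m A else 0 := by
  rw [pos, cf_part]; simp only [Set.mem_ofPred_eq]; congr

theorem cf_nonneg (d : Var →₀ ℕ) (m : ℤ) (A : Ser R) :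
    cf d m (nonneg A) = if 0 ≤ m then cf d m A else 0 := by
  rw [nonneg, cf_part]; simp only [Set.mem_ofPred_eq]; congr

theorem cf_nonpos (d : Var →₀ ℕ) (m : ℤ) (A : Ser R) :
    cf d m (nonpos A) = if m ≤ 0 then cf d m A else 0 := by
  rw [nonpos, cf_part]; simp only [Set.mem_ofPred_eq]; congr

theorem cf_neg (d : Var →₀ ℕ) (m : ℤ) (A : Ser R) :
    cf d m (neg A) = if m < 0 then cf d m A else 0 := by
  rw [neg, cf_part]; simp only [Set.mem_ofPred_eq]; congr

theorem nonpos_add_pos (A : Ser R) : nonpos A + pos A = A := ser_ext fun d m => by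
  rw [map_add, cf_nonpos, cf_pos]
  split_ifs <;> first | omega | simp

theorem nonneg_add_neg (A : Ser R) : nonneg A + neg A = A := ser_ext fun d m => by
  rw [map_add, cf_nonneg, cf_neg]
  split_ifs <;> first | omega | simp

theorem part_add (T : Set ℤ) (A B : Ser R) : part T (A + B) = part T A + part T B := by
  classical
  refine ser_ext fun d m => ?_
  simp only [cf_part, map_add]
  split_ifs <;> simp

theorem part_sub (T : Set ℤ) (A B : Ser R) : part T (A - B) = part T A - part T B := by
  classical
  refine ser_ext fun d m => ?_
  simp only [cf_part, map_sub]
  split_ifs <;> simp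

theorem part_pd (T : Set ℤ) (v : Var) (A : Ser R) : part T (pd v A) = pd v (part T A) := by
  classical
  refine ser_ext fun d m => ?_
  simp only [cf_part, cf_pd]
  split_ifs <;> simp

theorem nonpos_mem_W (A : Ser R) : nonpos A ∈ W R 0 0 :=
  mem_W_zero.2 fun d m hm => by rw [cf_nonpos, if_neg (by omega)]

theorem neg_mem_W (A : Ser R) : neg A ∈ W R 0 (-1) :=
  mem_W_zero.2 fun d m hm => by rw [cf_neg, if_neg (by omega)]

theorem mem_W_of_pos_eq_zero {A : Ser R} (h : pos A = 0) : A ∈ W R 0 0 := by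
  rw [← nonpos_add_pos A, h, add_zero]; exact nonpos_mem_W A

theorem pos_eq_zero {A : Ser R} (h : A ∈ W R 0 0) : pos A = 0 := ser_ext fun d m => by
  rw [cf_pos, map_zero]
  split_ifs with hm
  · exact mem_W_zero.1 h d m hm
  · rfl

theorem nonpos_eq_self {A : Ser R} (h : A ∈ W R 0 0) : nonpos A = A := by
  conv_rhs => rw [← nonpos_add_pos A, pos_eq_zero h, add_zero]

theorem neg_eq_self {A : Ser R} (h : A ∈ W R 0 (-1)) : neg A = A := ser_ext fun d m => by
  rw [cf_neg]
  split_ifs with hm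
  · rfl
  · exact (mem_W_zero.1 h d m (by omega)).symm

variable (R) in
/-- The series in which only powers `k ^ m` with `p ≤ m` occur. -/
def V (p : ℤ) : AddSubgroup (Ser R) where
  carrier := {A | ∀ d m, m < p → cf d m A = 0}
  zero_mem' _ _ _ := map_zero _
  add_mem' hA hB d m h := by rw [map_add, hA d m h, hB d m h, add_zero]
  neg_mem' hA d m h := by rw [map_neg, hA d m h, neg_zero]

theorem V_mono {p q : ℤ} {A : Ser R} (h : q ≤ p) (hA : A ∈ V R p) : A ∈ V R q :=
  fun d m hm => hA d m (by omega)

theorem mul_mem_V {p q : ℤ} {A B : Ser R} (hA : A ∈ V R p) (hB : B ∈ V R q) :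
    A * B ∈ V R (p + q) := by
  intro d m hm
  rw [cf_mul]
  refine Finset.sum_eq_zero fun e he => finsum_eq_zero_of_forall_eq_zero fun a => ?_
  by_cases h : -a < p
  · rw [hA _ _ h, zero_mul]
  · rw [hB _ (m + a) (by omega), mul_zero]

theorem pd_mem_V {p : ℤ} {A : Ser R} (hA : A ∈ V R p) (v : Var) : pd v A ∈ V R p :=
  fun d m hm => by rw [cf_pd, hA _ m hm, zero_mul]

theorem dk_mem_V {A : Ser R} (hA : A ∈ V R 0) : dk A ∈ V R 0 := fun d m hm => by
  rw [cf_dk]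
  rcases eq_or_ne m (-1) with rfl | h
  · simp
  · rw [hA _ (m + 1) (by omega), mul_zero]

theorem bracket_mem_V_one {A B : Ser R} (hA : A ∈ V R 1) (hB : B ∈ V R 1) :
    bracket A B ∈ V R 1 := by
  have h1 := mul_mem_V (dk_mem_V (V_mono zero_le_one hA)) (pd_mem_V hB Var.x)
  have h2 := mul_mem_V (dk_mem_V (V_mono zero_le_one hB)) (pd_mem_V hA Var.x)
  rw [zero_add] at h1 h2
  exact sub_mem h1 h2

theorem mem_V_one_iff {A : Ser R} : A ∈ V R 1 ↔ nonpos A = 0 := by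
  refine ⟨fun h => ser_ext fun d m => ?_, fun h d m hm => ?_⟩
  · rw [cf_nonpos, map_zero]
    split_ifs with hm
    · exact h d m (by omega)
    · rfl
  · have := congrArg (cf d m) h
    rwa [cf_nonpos, if_pos (by omega), map_zero] at this

theorem mem_V_zero_iff {A : Ser R} : A ∈ V R 0 ↔ neg A = 0 := by
  refine ⟨fun h => ser_ext fun d m => ?_, fun h d m hm => ?_⟩
  · rw [cf_neg, map_zero]
    split_ifs with hm
    · exact h d m (by omega)
    · rfl
  · have := congrArg (cf d m) h
    rwa [cf_neg, if_pos (by omega), map_zero] at this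

theorem pos_mem_V (A : Ser R) : pos A ∈ V R 1 := fun d m hm => by
  rw [cf_pos, if_neg (by omega)]

theorem nonneg_mem_V (A : Ser R) : nonneg A ∈ V R 0 := fun d m hm => by
  rw [cf_nonneg, if_neg (by omega)]

theorem neg_part_nonpos (A : Ser R) : neg (nonpos A) = neg A := ser_ext fun d m => by
  rw [cf_neg, cf_nonpos, cf_neg]
  split_ifs <;> first | rfl | omega

theorem neg_cst (c : Coef R) : neg (cst c) = 0 := mem_V_zero_iff.1 fun d m hm => by
  rw [cf_cst, if_neg (by omega)]

theorem dk_nonpos (A : Ser R) : dk (nonpos A) = dk (neg A) := ser_ext fun d m => by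
  rw [cf_dk, cf_dk, cf_nonpos, cf_neg]
  rcases lt_trichotomy (m + 1) 0 with h | h | h
  · rw [if_pos h.le, if_pos h]
  · have : (m : R) + 1 = 0 := by rw [← Int.cast_one, ← Int.cast_add, h, Int.cast_zero]
    rw [this, zero_mul, zero_mul]
  · rw [if_neg (by omega), if_neg (by omega)]

theorem dk_nonneg (A : Ser R) : dk (nonneg A) = dk (pos A) := by
  have h1 := congrArg dk (nonpos_add_pos A)
  rw [← nonneg_add_neg A, dk_add, dk_add, nonneg_add_neg, dk_nonpos] at h1
  linear_combination -h1

theorem kCoeff_add (m : ℤ) (A B : Ser R) : kCoeff m (A + B) = kCoeff m A + kCoeff m B :=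
  MvPowerSeries.ext fun d => by simp only [coeff_kCoeff, map_add]

theorem kCoeff_sub (m : ℤ) (A B : Ser R) : kCoeff m (A - B) = kCoeff m A - kCoeff m B :=
  MvPowerSeries.ext fun d => by simp only [coeff_kCoeff, map_sub]

theorem kCoeff_neg (m : ℤ) (A : Ser R) : kCoeff m (-A) = -kCoeff m A :=
  MvPowerSeries.ext fun d => by simp only [coeff_kCoeff, map_neg]

theorem kCoeff_zero (m : ℤ) : kCoeff m (0 : Ser R) = 0 :=
  MvPowerSeries.ext fun d => by simp only [coeff_kCoeff, map_zero]

theorem kCoeff_pd (m : ℤ) (v : Var) (A : Ser R) :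
    kCoeff m (pd v A) = MvPowerSeries.pderiv R v (kCoeff m A) :=
  MvPowerSeries.ext fun d => by rw [coeff_kCoeff, MvPowerSeries.coeff_pderiv, coeff_kCoeff, cf_pd]

theorem kCoeff_cst_zero (c : Coef R) : kCoeff 0 (cst c) = c :=
  MvPowerSeries.ext fun d => by rw [coeff_kCoeff, cf_cst, if_pos rfl]

theorem kCoeff_of_mem_W {m p : ℤ} {A : Ser R} (hA : A ∈ W R 0 p) (h : p < m) :
    kCoeff m A = 0 :=
  MvPowerSeries.ext fun d => by rw [coeff_kCoeff, mem_W_zero.1 hA d m h, map_zero]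

theorem kCoeff_of_mem_V {m p : ℤ} {A : Ser R} (hA : A ∈ V R p) (h : m < p) :
    kCoeff m A = 0 :=
  MvPowerSeries.ext fun d => by rw [coeff_kCoeff, hA d m h, map_zero]

theorem kCoeff_zero_nonpos (A : Ser R) : kCoeff 0 (nonpos A) = kCoeff 0 A :=
  MvPowerSeries.ext fun d => by rw [coeff_kCoeff, cf_nonpos, if_pos le_rfl, coeff_kCoeff]

theorem res_add (A B : Ser R) : res (A + B) = res A + res B := kCoeff_add _ A B
theorem res_sub (A B : Ser R) : res (A - B) = res A - res B := kCoeff_sub _ A B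
theorem res_neg (A : Ser R) : res (-A) = -res A := kCoeff_neg _ A
theorem res_pd (v : Var) (A : Ser R) : res (pd v A) = MvPowerSeries.pderiv R v (res A) :=
  kCoeff_pd _ v A

theorem res_dk (A : Ser R) : res (dk A) = 0 := MvPowerSeries.ext fun d => by
  rw [res, coeff_kCoeff, cf_dk]; simp

theorem res_mul_of_mem_W {p q : ℤ} {A B : Ser R} (hA : A ∈ W R 0 p) (hB : B ∈ W R 0 q)
    (h : p + q < -1) : res (A * B) = 0 := kCoeff_of_mem_W (mul_mem_W hA hB) h

theorem res_mul_of_mem_V {A B : Ser R} (hA : A ∈ V R 0) (hB : B ∈ V R 0) : res (A * B) = 0 :=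
  kCoeff_of_mem_V (mul_mem_V hA hB) (by norm_num)

/-- Integration by parts. -/
theorem res_mul_dk (A B : Ser R) : res (A * dk B) = -res (dk A * B) := by
  rw [eq_neg_iff_add_eq_zero, ← res_add, ← dk_mul, res_dk]

theorem cf_mul_kPow (i : ℤ) (d : Var →₀ ℕ) (m : ℤ) (A : Ser R) :
    cf d m (A * kPow i) = cf d (m - i) A := by
  rw [cf_def, kPow, MvPowerSeries.coeff_mul_C]
  have h := HahnSeries.coeff_mul_single_add (r := (1 : R))
    (x := MvPowerSeries.coeff d A) (a := -m + i) (b := -i)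
  rw [show -m + i + -i = -m by ring] at h
  rw [h, mul_one, cf_def, show -(m - i) = -m + i by ring]

theorem cf_cst_mul (c : Coef R) (d : Var →₀ ℕ) (m : ℤ) (A : Ser R) :
    cf d m (cst c * A) = MvPowerSeries.coeff d (c * kCoeff m A) := by
  rw [cf_mul, MvPowerSeries.coeff_mul]
  refine Finset.sum_congr rfl fun p _ => ?_
  rw [finsum_eq_single _ 0, neg_zero, cf_cst, if_pos rfl, add_zero, coeff_kCoeff]
  intro a ha
  rw [cf_cst, if_neg (by omega), zero_mul]

/-- A series with `∂A/∂k = 0` is a function of `t`. -/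
theorem eq_cst_of_dk_eq_zero [Algebra ℚ R] {A : Ser R} (h : dk A = 0) : A = cst (kCoeff 0 A) := by
  refine ser_ext fun d m => ?_
  rw [cf_cst]
  split_ifs with hm
  · rw [hm, coeff_kCoeff]
  · have h1 := congrArg (cf d (m - 1)) h
    rw [cf_dk, map_zero, intCast_add_one_mul, sub_add_cancel] at h1
    have h2 : ((m : ℚ)) • cf d m A = 0 := by
      rw [← h1, Int.cast_smul_eq_zsmul]
    rw [← one_smul ℚ (cf d m A), ← inv_mul_cancel₀ (Int.cast_ne_zero (α := ℚ).2 hm), mul_smul, h2,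
      smul_zero]

end Parts

/-! ### Monic series, inverses and logarithms -/

section Monic

variable {R S : Type*} [CommRing R] [CommRing S]

/-- `A = k ^ N (1 + y)` with only negative powers of `k` in `y`. -/
def IsMonicSer (N : ℤ) (A : Ser R) : Prop := A * kPow (-N) - 1 ∈ W R 0 (-1)

theorem IsMonicSer.mem_W {N : ℤ} {A : Ser R} (h : IsMonicSer N A) : A ∈ W R 0 N := by
  have h1 : A = (A * kPow (-N) - 1) * kPow N + kPow N := by
    rw [sub_mul, mul_assoc, kPow_mul, neg_add_cancel, kPow_zero]; ring
  rw [h1]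
  exact add_mem (W_mono (by omega) (mul_mem_W h (kPow_mem_W N))) (kPow_mem_W N)

theorem IsMonicSer.mul {M N : ℤ} {A B : Ser R} (hA : IsMonicSer M A) (hB : IsMonicSer N B) :
    IsMonicSer (M + N) (A * B) := by
  have h : A * B * kPow (-(M + N)) - 1 =
      (A * kPow (-M) - 1) * (B * kPow (-N) - 1) + (A * kPow (-M) - 1) + (B * kPow (-N) - 1) := by
    rw [neg_add, ← kPow_mul]; ring
  rw [IsMonicSer, h]
  exact add_mem (add_mem (W_mono (by norm_num) (mul_mem_W hA hB)) hA) hB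

theorem isMonicSer_one : IsMonicSer 0 (1 : Ser R) := by
  rw [IsMonicSer, neg_zero, kPow_zero]; simp

theorem IsMonicSer.pow {N : ℤ} {A : Ser R} (hA : IsMonicSer N A) (n : ℕ) :
    IsMonicSer (n * N) (A ^ n) := by
  induction n with
  | zero => simpa using isMonicSer_one
  | succ n ih =>
    rw [pow_succ]
    convert ih.mul hA using 1
    push_cast; ring

theorem IsLaxForm.isMonicSer {L : Ser R} (h : IsLaxForm L) : IsMonicSer 1 L := by
  refine mem_W_zero.2 fun d m hm => ?_
  have h1 := congrArg (cf d (m + 1)) h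
  rw [cf_pos, if_pos (by omega), cf_kPow] at h1
  rw [map_sub, cf_mul_kPow, sub_neg_eq_add, h1, cf_one]
  have : (d = 0 ∧ m + 1 = 1) ↔ (d = 0 ∧ m = 0) := by
    constructor <;> exact fun h => ⟨h.1, by omega⟩
  simp only [this, sub_self]

theorem IsMonicPoly.isMonicSer {N : ℕ} {P : Ser R} (h : IsMonicPoly N P) : IsMonicSer N P := by
  classical
  refine mem_W_zero.2 fun d m hm => ?_
  rw [map_sub, cf_mul_kPow, sub_neg_eq_add, cf_one, ← coeff_kCoeff]
  rcases eq_or_ne m 0 with rfl | hm0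
  · rw [zero_add, h.1, MvPowerSeries.coeff_one]; simp
  · rw [h.2 _ (Or.inr (by omega))]; simp [hm0]

theorem HasFormalSum.succ {a : ℕ → Ser R} {A : Ser R} (h : HasFormalSum a A) :
    HasFormalSum (fun n => a (n + 1)) (A - a 0) := by
  classical
  have h0 := hasFormalSum_single (a := fun n => if n = 0 then a n else 0) 0 fun j hj => if_neg hj
  refine (h.sub h0).fiberwise Nat.pred fun n => ?_
  refine (hasFormalSum_single (a := fun i => if i.pred = n then
    a i - (if i = 0 then a i else 0) else 0) (n + 1) fun j hj => ?_).congr (fun i => rfl) |> fun h =>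
      by convert h; simp
  rcases j with _ | j
  · simp
  · exact if_neg fun h' => hj (by simpa using h')

/-- The geometric series. -/
theorem exists_inverse_one_add {y : Ser R} (hy : y ∈ W R 0 (-1)) :
    ∃ Z ∈ W R 0 0, HasFormalSum (fun r : ℕ => (-y) ^ r) Z ∧ (1 + y) * Z = 1 := by
  obtain ⟨Z, hZ, hs⟩ := exists_hasFormalSum_nat (a := fun r : ℕ => (-y) ^ r) 0 fun n => by
    convert pow_mem_W (neg_mem hy) n using 2; ring
  refine ⟨Z, hZ, hs, ?_⟩
  have h1 := hs.succ
  have h2 : HasFormalSum (fun r : ℕ => (-y) ^ (r + 1)) (-y * Z) :=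
    (hs.mul_left (-y)).congr fun r => pow_succ' _ _
  have h3 := h1.unique h2
  rw [pow_zero] at h3
  linear_combination h3

/-- A monic series is invertible. -/
theorem IsMonicSer.exists_unit {N : ℤ} {A : Ser R} (h : IsMonicSer N A) :
    ∃ U : (Ser R)ˣ, (U : Ser R) = A ∧ ((U⁻¹ : (Ser R)ˣ) : Ser R) ∈ W R 0 (-N) := by
  obtain ⟨Z, hZ, -, hinv⟩ := exists_inverse_one_add h
  have h1 : A * (kPow (-N) * Z) = 1 := by
    rw [← hinv]; ring
  refine ⟨⟨A, kPow (-N) * Z, h1, by rw [mul_comm, h1]⟩, rfl, ?_⟩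
  change kPow (-N) * Z ∈ _
  simpa using mul_mem_W (kPow_mem_W (-N)) hZ

theorem units_zpow_mem_W {U : (Ser R)ˣ} (h1 : (U : Ser R) ∈ W R 0 1)
    (h2 : ((U⁻¹ : (Ser R)ˣ) : Ser R) ∈ W R 0 (-1)) (i : ℤ) :
    ((U ^ i : (Ser R)ˣ) : Ser R) ∈ W R 0 i := by
  induction i using Int.induction_on with
  | zero => simpa using one_mem_W
  | succ i ih => rw [zpow_add_one, Units.val_mul]; exact mul_mem_W ih h1
  | pred i ih => rw [zpow_sub_one, Units.val_mul]; exact mul_mem_W ih h2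

theorem zPow_units (U : (Ser R)ˣ) (i : ℤ) : zPow (U : Ser R) i = ((U ^ i : (Ser R)ˣ) : Ser R) := by
  rw [zPow]
  split_ifs with h
  · lift i to ℕ using h
    simp
  · obtain ⟨n, hn⟩ := Int.exists_eq_neg_ofNat (not_le.1 h).le
    subst hn
    rw [Ring.inverse_unit]
    simp

variable [Algebra ℚ R] [Algebra ℚ S]

theorem IsMonicSer.hasFormalSum_logReg {N : ℕ} {A : Ser R} (h : IsMonicSer N A) :
    HasFormalSum (fun r : ℕ => ((-1 : ℚ) ^ r / ((r : ℚ) + 1)) •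
      (A * kPow (-(N : ℤ)) - 1) ^ (r + 1)) (logReg N A) ∧ logReg N A ∈ W R 0 (-1) := by
  obtain ⟨Z, hZ, hs⟩ := exists_hasFormalSum_nat (a := fun r : ℕ =>
    ((-1 : ℚ) ^ r / ((r : ℚ) + 1)) • (A * kPow (-(N : ℤ)) - 1) ^ (r + 1)) (-1) fun n =>
      rat_smul_mem_W _ (by
        convert pow_mem_W h (n + 1) using 2
        push_cast; ring)
  have := hs.formalSum_eq
  rw [logReg, this]
  exact ⟨hs, hZ⟩

/-- The logarithmic derivative, for a derivation that kills `k`. -/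
theorem FormalDerivation.mul_δ_logReg_aux (E : FormalDerivation S R) {N : ℕ} {A : Ser S}
    (h : IsMonicSer N A) (h' : IsMonicSer N (E.h₀ A))
    (hk : E.h₀ (kPow (-(N : ℤ))) = kPow (-(N : ℤ))) :
    E.h₀ A * kPow (-(N : ℤ)) * E.δ (logReg N A) = E.δ (A * kPow (-(N : ℤ))) := by
  set y := A * kPow (-(N : ℤ)) - 1 with hy
  have hy0 : E.h₀ y = E.h₀ A * kPow (-(N : ℤ)) - 1 := by
    rw [hy, map_sub, map_mul, hk, map_one]
  obtain ⟨Z, -, hZ, hinv⟩ := exists_inverse_one_add (y := E.h₀ y) (by rw [hy0]; exact h')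
  have h1 := E.δ_sum h.hasFormalSum_logReg.1
  have h2 : HasFormalSum (fun r : ℕ => E.δ (((-1 : ℚ) ^ r / ((r : ℚ) + 1)) • y ^ (r + 1)))
      (Z * E.δ y) := by
    refine (hZ.mul_right (E.δ y)).congr fun r => ?_
    have hq : algebraMap ℚ (Ser R) ((-1 : ℚ) ^ r / ((r : ℚ) + 1)) * ((r + 1 : ℕ) : Ser R) =
        (-1) ^ r := by
      rw [← map_natCast (algebraMap ℚ (Ser R)), ← map_mul, Nat.cast_succ,
        div_mul_cancel₀ _ (by positivity), map_pow, map_neg, map_one]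
    rw [E.δ_rat_smul, E.δ_pow_succ, Algebra.smul_def, ← mul_assoc, hq, neg_pow (E.h₀ y), mul_assoc]
  rw [h1.unique h2]
  have h3 : E.h₀ A * kPow (-(N : ℤ)) = 1 + E.h₀ y := by rw [hy0]; ring
  have h4 : E.δ y = E.δ (A * kPow (-(N : ℤ))) := by rw [hy, map_sub, E.δ_one, sub_zero]
  rw [h3, ← mul_assoc, hinv, one_mul, h4]

theorem FormalDerivation.mul_δ_logReg (E : FormalDerivation S R) {N : ℕ} {A : Ser S}
    (h : IsMonicSer N A) (h' : IsMonicSer N (E.h₀ A))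
    (hk : E.h₀ (kPow (-(N : ℤ))) = kPow (-(N : ℤ))) (hk' : E.δ (kPow (-(N : ℤ))) = 0) :
    E.h₀ A * E.δ (logReg N A) = E.δ A := by
  have h1 := E.mul_δ_logReg_aux h h' hk
  have h2 : (kPow (-(N : ℤ)) * kPow N : Ser R) = 1 := by
    rw [kPow_mul, neg_add_cancel, kPow_zero]
  rw [E.leibniz, hk', mul_zero, zero_add, hk] at h1
  linear_combination (kPow N : Ser R) * h1 - (E.h₀ A * E.δ (logReg N A) - E.δ A) * h2

theorem IsMonicSer.mul_pd_logReg {N : ℕ} {A : Ser R} (h : IsMonicSer N A) (v : Var) :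
    A * pd v (logReg N A) = pd v A :=
  (FormalDerivation.ofVar R v).mul_δ_logReg h h rfl (pd_kPow v _)

theorem IsMonicSer.mul_dkLog {N : ℕ} {A : Ser R} (h : IsMonicSer N A) :
    A * dkLog N A = dk A := by
  have h1 : A * kPow (-(N : ℤ)) * dk (logReg N A) = dk (A * kPow (-(N : ℤ))) :=
    (FormalDerivation.ofK R).mul_δ_logReg_aux h h rfl
  have h2 : (kPow (-(N : ℤ)) * kPow N : Ser R) = 1 := by
    rw [kPow_mul, neg_add_cancel, kPow_zero]
  have h3 : (kPow (-(N : ℤ) - 1) * kPow N : Ser R) = kPow (-1) := by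
    rw [kPow_mul]; congr 1; ring
  rw [dk_mul, dk_kPow] at h1
  push_cast at h1
  rw [dkLog]
  linear_combination (kPow N : Ser R) * h1 - (A * dk (logReg N A) - dk A) * h2
    - (N : Ser R) * A * h3

theorem IsMonicSer.mul_logBracket {N : ℕ} {A : Ser R} (h : IsMonicSer N A) (X : Ser R) :
    A * logBracket N A X = bracket A X := by
  rw [logBracket, bracket, mul_sub, ← mul_assoc, h.mul_dkLog, mul_left_comm, h.mul_pd_logReg]

theorem IsMonicSer.dkLog_mem_W {N : ℕ} {A : Ser R} (h : IsMonicSer N A) :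
    dkLog N A ∈ W R 0 (-1) := by
  refine add_mem ?_ (W_mono (by norm_num) (dk_mem_W h.hasFormalSum_logReg.2))
  simpa using mul_mem_W (natCast_mem_W (R := R) N) (kPow_mem_W (-1))

theorem IsMonicSer.logBracket_mem_W {N : ℕ} {P A : Ser R} (h : IsMonicSer N P)
    (hA : A ∈ W R 0 0) : logBracket N P A ∈ W R 0 (-1) := by
  refine sub_mem ?_ ?_
  · simpa using mul_mem_W h.dkLog_mem_W (pd_mem_W hA Var.x)
  · exact W_mono (by norm_num)
      (mul_mem_W (dk_mem_W hA) (pd_mem_W h.hasFormalSum_logReg.2 Var.x))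

end Monic

/-! ### The initial Orlov function -/

section Seed

variable {R : Type*} [CommRing R]

theorem finite_pnat_lt (n : ℕ) : {m : ℕ+ | (m : ℕ) < n}.Finite :=
  (Set.finite_lt_nat n).preimage PNat.coe_injective.injOn

theorem exists_hasFormalSum_seed : ∃ T : Ser R, HasFormalSum
    (fun n : ℕ+ => ((n : ℕ) : Ser R) * (MvPowerSeries.X (Var.t n) * kPow ((n : ℤ) - 1))) T := by
  -- With weight `2 n` for `t_n` the terms have degrees `-n - 1`.
  let w : Var → ℕ := fun v => match v with
    | Var.t n => 2 * n
    | _ => 0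
  refine exists_hasFormalSum w fun p => (finite_pnat_lt (-p).toNat).subset fun n hn => ?_
  by_contra hlt
  refine hn ?_
  simp only [Set.mem_ofPred_eq, not_lt] at hlt
  have h := mul_mem_W (natCast_mem_W (w := w) (R := R) n) (mul_mem_W (X_mem_W (w := w) (Var.t n))
    (kPow_mem_W (R := R) ((n : ℤ) - 1)))
  refine W_mono ?_ h
  have : w (Var.t n) = 2 * n := rfl
  rw [this]; push_cast; omega

theorem seed_eq (N : ℕ) {T : Ser R} (hT : HasFormalSum
    (fun n : ℕ+ => ((n : ℕ) : Ser R) * (MvPowerSeries.X (Var.t n) * kPow ((n : ℤ) - 1))) T) :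
    seed N = T + MvPowerSeries.X Var.x + (N : Ser R) * (MvPowerSeries.X Var.s * kPow (-1)) := by
  rw [seed, hT.formalSum_eq]

theorem pd_natCast (v : Var) (n : ℕ) : pd v (n : Ser R) = 0 := by
  rw [pd]; exact Derivation.map_natCast _ n

theorem pd_natCast_mul (v : Var) (n : ℕ) (A : Ser R) : pd v ((n : Ser R) * A) = n * pd v A := by
  rw [pd_mul, pd_natCast]; ring

theorem pd_seed_term (v u : Var) (n : ℕ) (i : ℤ) :
    pd v ((n : Ser R) * (MvPowerSeries.X u * kPow i)) = if v = u then (n : Ser R) * kPow i else 0 := by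
  rw [pd_natCast_mul, pd_mul, pd_kPow, pd_X]
  split_ifs <;> simp

theorem pd_x_seed (N : ℕ) : pd Var.x (seed N : Ser R) = 1 := by
  obtain ⟨T, hT⟩ := exists_hasFormalSum_seed (R := R)
  have h0 : pd Var.x T = 0 := (hT.pd Var.x).unique (hasFormalSum_zero.congr fun n => by
    rw [pd_seed_term, if_neg (by simp)])
  rw [seed_eq N hT, pd_add, pd_add, h0, pd_X, if_pos rfl, pd_seed_term, if_neg (by simp)]
  ring

theorem pd_s_seed (N : ℕ) : pd Var.s (seed N : Ser R) = (N : Ser R) * kPow (-1) := by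
  obtain ⟨T, hT⟩ := exists_hasFormalSum_seed (R := R)
  have h0 : pd Var.s T = 0 := (hT.pd Var.s).unique (hasFormalSum_zero.congr fun n => by
    rw [pd_seed_term, if_neg (by simp)])
  rw [seed_eq N hT, pd_add, pd_add, h0, pd_X, if_neg (by simp), pd_seed_term, if_pos rfl]
  ring

theorem pd_t_seed (N : ℕ) (m : ℕ+) :
    pd (Var.t m) (seed N : Ser R) = ((m : ℕ) : Ser R) * kPow ((m : ℤ) - 1) := by
  obtain ⟨T, hT⟩ := exists_hasFormalSum_seed (R := R)
  have h0 : pd (Var.t m) T = ((m : ℕ) : Ser R) * kPow ((m : ℤ) - 1) := by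
    refine (hT.pd (Var.t m)).unique ?_
    have := hasFormalSum_single (a := fun n : ℕ+ => if Var.t m = Var.t n then
      ((n : ℕ) : Ser R) * kPow ((n : ℤ) - 1) else 0) m fun j hj =>
        if_neg (by simpa using Ne.symm hj)
    rw [if_pos rfl] at this
    exact this.congr fun n => pd_seed_term _ _ _ _
  rw [seed_eq N hT, pd_add, pd_add, h0, pd_X, if_neg (by simp), pd_seed_term, if_neg (by simp)]
  ring

open DualNumber in
theorem snd_seed {K : Type*} [Field K] (N : ℕ) : mapSer sndK (seed N : Ser K[ε]) = 0 := by
  obtain ⟨T, hT⟩ := exists_hasFormalSum_seed (R := K[ε])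
  have h0 : mapSer sndK T = 0 := (hT.mapSer sndK).unique (hasFormalSum_zero.congr fun n => by
    rw [snd_mul, snd_mul, snd_natCast, snd_X, snd_kPow]; ring)
  rw [seed_eq N hT, mapSer_add, mapSer_add, h0, snd_X, snd_mul, snd_mul, snd_natCast, snd_X,
    snd_kPow]
  ring

end Seed

/-! ### Consequences of the dressing equations -/

section Powers

variable {R : Type*} [CommRing R]

theorem kPow_one_pow (n : ℕ) : (kPow 1 : Ser R) ^ n = kPow n := by
  induction n with
  | zero => simp [kPow_zero]
  | succ n ih => rw [pow_succ, ih, kPow_mul]; push_cast; rfl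

theorem bracket_one_right (A : Ser R) : bracket A 1 = 0 := by
  simp [bracket, pd_one, dk_one]

theorem FormalDerivation.δ_pow_eq_bracket {S : Type*} [CommRing S] (E : FormalDerivation S R) {A : Ser S} {H : Ser R}
    (h : E.δ A = bracket H (E.h₀ A)) (n : ℕ) : E.δ (A ^ n) = bracket H (E.h₀ A ^ n) := by
  cases n with
  | zero => rw [pow_zero, pow_zero, E.δ_one, bracket_one_right]
  | succ n => rw [E.δ_pow_succ, h, ← map_pow E.h₀ A (n + 1), ← E.ad_δ, ← E.ad_δ,
      (E.ad H).δ_pow_succ]; rfl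

theorem mem_W_of_form {φ : Ser R} (h : pos φ = 0) : φ ∈ W R 0 0 := mem_W_of_pos_eq_zero h

theorem bracket_pow_left (A B : Ser R) (n : ℕ) :
    bracket (A ^ (n + 1)) B = ((n + 1 : ℕ) : Ser R) * (A ^ n * bracket A B) := by
  have h := ((FormalDerivation.ofK R).ad B).δ_pow_succ A n
  rw [FormalDerivation.ad_δ, FormalDerivation.ad_δ] at h
  change bracket B (A ^ (n + 1)) = _ * (A ^ n * bracket B A) at h
  rw [bracket_skew, h, bracket_skew A B]; ring

theorem nonpos_add_B (L : Ser R) (n : ℕ+) : nonpos (L ^ (n : ℕ)) + B L n = L ^ (n : ℕ) :=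
  nonpos_add_pos _

theorem IsMonicSer.cancel {N : ℤ} {A X Y : Ser R} (h : IsMonicSer N A) (hXY : A * X = A * Y) :
    X = Y := by
  obtain ⟨U, hU, -⟩ := h.exists_unit
  rw [← hU] at hXY
  exact (Units.mul_right_inj U).1 hXY

theorem IsLaxForm.isMonicSer_dk {L : Ser R} (h : IsLaxForm L) : IsMonicSer 0 (dk L) := by
  rw [IsMonicSer, neg_zero, kPow_zero, mul_one]
  have h1 : L = kPow 1 + nonpos L := by rw [← h, add_comm, nonpos_add_pos]
  have h2 : dk L - 1 = dk (nonpos L) := by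
    conv_lhs => rw [h1, dk_add, dk_kPow, sub_self, kPow_zero]
    simp
  rw [h2]
  exact W_mono (by norm_num) (dk_mem_W (nonpos_mem_W L))

/-- Only functions of `t` that do not depend on `x` commute with `L`. -/
theorem IsLaxForm.pderiv_eq_zero {L : Ser R} (h : IsLaxForm L) {c : Coef R}
    (hc : bracket (cst c) L = 0) : MvPowerSeries.pderiv R Var.x c = 0 := by
  rw [bracket, dk_cst, zero_mul, zero_sub, neg_eq_zero, pd_cst] at hc
  have := h.isMonicSer_dk.cancel (hc.trans (mul_zero _).symm)
  rw [← kCoeff_cst_zero (MvPowerSeries.pderiv R Var.x c), this, kCoeff_zero]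

end Powers

section Dressing

variable {R S : Type*} [CommRing R] [CommRing S] [Algebra ℚ R] [Algebra ℚ S]

theorem IsDressing.bracket_L_M {N : ℕ} {L P M φ : Ser R} (h : IsDressing N L P M φ) :
    bracket L M = 1 := by
  have h1 := hasFormalSum_expAd_bracket h.dress_L h.dress_M
  have h2 : bracket (kPow 1) (seed N : Ser R) = 1 := by
    rw [bracket, pd_x_seed, dk_kPow, pd_kPow, sub_self, kPow_zero]; simp
  rw [h2] at h1
  exact h1.unique (hasFormalSum_expAd_one φ)

theorem hasFormalSum_expAd_pow {φ A A' : Ser R} (h : HasFormalSum (expAdFamily φ A) A') (n : ℕ) :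
    HasFormalSum (expAdFamily φ (A ^ n)) (A' ^ n) := by
  induction n with
  | zero => simpa using hasFormalSum_expAd_one φ
  | succ n ih => rw [pow_succ, pow_succ]; exact hasFormalSum_expAd_mul ih h

theorem hasFormalSum_expAd_natCast_mul {φ A A' : Ser R} (h : HasFormalSum (expAdFamily φ A) A')
    (n : ℕ) : HasFormalSum (expAdFamily φ ((n : Ser R) * A)) ((n : Ser R) * A') := by
  have hn : HasFormalSum (expAdFamily φ (n : Ser R)) (n : Ser R) := by
    induction n with
    | zero =>
      rw [Nat.cast_zero]
      refine hasFormalSum_zero.congr fun r => ?_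
      have h0 : ∀ r, (bracket φ)^[r] (0 : Ser R) = 0 := fun r => by
        induction r with
        | zero => rfl
        | succ r ih => rw [Function.iterate_succ_apply', ih, bracket_zero_right]
      rw [expAdFamily, h0, rat_smul_zero]
    | succ n ih =>
      rw [Nat.cast_succ]
      refine (ih.add (hasFormalSum_expAd_one φ)).congr fun r => ?_
      have h1 := iterate_bracket_sub φ ((n : Ser R) + 1) 1 r
      rw [add_sub_cancel_right] at h1
      rw [expAdFamily, expAdFamily, expAdFamily, ← rat_smul_add, h1, sub_add_cancel]
  exact hasFormalSum_expAd_mul hn h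

/-- The negative powers of `k` are also dressed to the powers of `L`. -/
theorem IsDressing.hasFormalSum_inv {N : ℕ} {P M φ : Ser R} {U : (Ser R)ˣ}
    (h : IsDressing N U P M φ) :
    HasFormalSum (expAdFamily φ (kPow (-1))) ((U⁻¹ : (Ser R)ˣ) : Ser R) := by
  obtain ⟨Y, -, hY⟩ := exists_hasFormalSum_ad (fun r => ((r.factorial : ℚ)⁻¹))
    (mem_W_of_form h.form) (kPow_mem_W (R := R) (-1))
  have h1 := hasFormalSum_expAd_mul hY h.dress_L
  rw [kPow_mul, neg_add_cancel, kPow_zero] at h1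
  have h2 : Y * (U : Ser R) = 1 := h1.unique (hasFormalSum_expAd_one φ)
  have h3 : Y = ((U⁻¹ : (Ser R)ˣ) : Ser R) := by
    rw [← mul_one Y, ← Units.mul_inv U, ← mul_assoc, h2, one_mul]
  exact h3 ▸ hY

theorem FormalDerivation.δ_L_eq (E : FormalDerivation S R) {N : ℕ} {L P M φ : Ser S}
    (h : IsDressing N L P M φ) (hk : E.δ (kPow 1) = 0) {H : Ser R}
    (hH : HasFormalSum (nablaFamily (E.h₀ φ) (E.δ φ)) H) :
    E.δ L = bracket H (E.h₀ L) := by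
  have h1 := E.hasFormalSum_expAd h.dress_L hH
  rw [hk] at h1
  have h2 : HasFormalSum (expAdFamily (E.h₀ φ) 0) 0 := by
    simpa using hasFormalSum_expAd_natCast_mul (hasFormalSum_expAd_one (E.h₀ φ)) 0
  exact sub_eq_zero.1 (h1.unique h2)

theorem FormalDerivation.δ_M_eq (E : FormalDerivation S R) {N : ℕ} {L P M φ : Ser S}
    (h : IsDressing N L P M φ) {H Y : Ser R}
    (hY : HasFormalSum (expAdFamily (E.h₀ φ) (E.δ (seed N))) Y)
    (hH : HasFormalSum (nablaFamily (E.h₀ φ) (E.δ φ)) H) :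
    E.δ M = bracket H (E.h₀ M) + Y := by
  have h1 := E.hasFormalSum_expAd h.dress_M hH
  rw [← h1.unique hY]; ring

end Dressing

section Solution

variable {R : Type*} [CommRing R] [Algebra ℚ R] {N : ℕ} {D : Data R}

theorem IsSolution.exists_unit (h : IsSolution N D) : ∃ U : (Ser R)ˣ, (U : Ser R) = D.L ∧
    (U : Ser R) ∈ W R 0 1 ∧ ((U⁻¹ : (Ser R)ˣ) : Ser R) ∈ W R 0 (-1) := by
  obtain ⟨U, hU, hU'⟩ := h.form_L.isMonicSer.exists_unit
  exact ⟨U, hU, hU ▸ h.form_L.isMonicSer.mem_W, hU'⟩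

theorem IsSolution.isMonicSer_pow (h : IsSolution N D) : IsMonicSer N (D.L ^ N) := by
  simpa using h.form_L.isMonicSer.pow N

/-- `∂M/∂t_n = {B_n, M}`. -/
theorem IsSolution.pd_t_M (h : IsSolution N D) (n : ℕ+) :
    pd (Var.t n) D.M = bracket (B D.L n) D.M := by
  have h1 : HasFormalSum (expAdFamily D.φ (pd (Var.t n) (seed N)))
      (((n : ℕ) : Ser R) * D.L ^ ((n : ℕ) - 1)) := by
    rw [pd_t_seed]
    have := hasFormalSum_expAd_natCast_mul
      (hasFormalSum_expAd_pow h.dressing.dress_L ((n : ℕ) - 1)) n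
    rw [kPow_one_pow] at this
    rwa [show ((n : ℤ) - 1) = (((n : ℕ) - 1 : ℕ) : ℤ) by
      have := n.pos; push_cast [Nat.cast_sub this]; rfl]
  have h2 : pd (Var.t n) D.M = _ :=
    (FormalDerivation.ofVar R (Var.t n)).δ_M_eq h.dressing h1 (h.dressing.t_flow n)
  have h3 := bracket_pow_left D.L D.M ((n : ℕ) - 1)
  rw [Nat.sub_add_cancel n.pos, h.dressing.bracket_L_M, mul_one] at h3
  change pd (Var.t n) D.M = bracket _ D.M + _ at h2
  rw [h2, ← h3, ← bracket_add_left, neg_add_eq_sub, sub_eq_iff_eq_add'.2 (nonpos_add_B D.L n).symm]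

/-- `ad` of `log P - log L ^ N + c`. -/
theorem bracket_logReg_sub (P Q A : Ser R) (c : Coef R) :
    bracket (logReg N P - logReg N Q + cst c) A =
      logBracket N P A - logBracket N Q A + bracket (cst c) A := by
  rw [bracket_add_left, bracket_sub_left]
  simp only [bracket, logBracket, dkLog]; ring

/-- The `s`-flow of the dressing function is determined up to a function of `t` which does not
depend on `x`. -/
theorem IsSolution.s_flow_const (h : IsSolution N D) {φ : Ser R}
    (hφ : IsDressing N D.L D.P D.M φ) {c : Coef R}
    (hc : HasFormalSum (nablaFamily φ (pd Var.s φ)) (logReg N D.P - logReg N (D.L ^ N) + cst c)) :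
    MvPowerSeries.pderiv R Var.x c = 0 := by
  refine h.form_L.pderiv_eq_zero ?_
  have h1 : pd Var.s D.L = bracket _ D.L :=
    (FormalDerivation.ofVar R Var.s).δ_L_eq hφ (pd_kPow _ _) hc
  have h2 : logBracket N (D.L ^ N) D.L = 0 := h.isMonicSer_pow.cancel (by
    rw [h.isMonicSer_pow.mul_logBracket, mul_zero]
    cases N with
    | zero => rw [pow_zero, bracket_skew, bracket_one_right, neg_zero]
    | succ n => rw [bracket_pow_left, bracket_self, mul_zero, mul_zero])
  rw [bracket_logReg_sub, h2, h.lax_s] at h1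
  linear_combination -h1

/-- `∂M/∂s = {log P, M}`. -/
theorem IsSolution.pd_s_M (h : IsSolution N D) : pd Var.s D.M = logBracket N D.P D.M := by
  obtain ⟨c, hc⟩ := h.dressing.s_flow
  have hcx := h.s_flow_const h.dressing hc
  obtain ⟨U, hU, -, -⟩ := h.exists_unit
  have hdr := h.dressing
  rw [← hU] at hdr
  have h1 : HasFormalSum (expAdFamily D.φ (pd Var.s (seed N)))
      ((N : Ser R) * ((U⁻¹ : (Ser R)ˣ) : Ser R)) := by
    rw [pd_s_seed]
    exact hasFormalSum_expAd_natCast_mul hdr.hasFormalSum_inv N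
  have h2 : pd Var.s D.M = _ :=
    (FormalDerivation.ofVar R Var.s).δ_M_eq h.dressing h1 hc
  change pd Var.s D.M = bracket _ D.M + _ at h2
  have h3 : logBracket N (D.L ^ N) D.M = (N : Ser R) * ((U⁻¹ : (Ser R)ˣ) : Ser R) :=
    h.isMonicSer_pow.cancel (by
      rw [h.isMonicSer_pow.mul_logBracket]
      cases N with
      | zero => rw [pow_zero, bracket_skew, bracket_one_right]; simp
      | succ n =>
        have := Units.mul_inv U
        rw [hU] at this
        rw [bracket_pow_left, h.dressing.bracket_L_M, pow_succ]
        linear_combination -((n + 1 : ℕ) : Ser R) * D.L ^ n * this)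
  rw [h2, bracket_logReg_sub, h3, bracket_cst_left _ hcx]; ring

end Solution

/-! ### Substitution of `(L, M)` into functions of `(k, x)` -/

section Subst

variable {R S : Type*} [CommRing R] [CommRing S]

/-- The monomial `L ^ i M ^ a s ^ b` with `L = U` invertible. -/
noncomputable def mon (U : (Ser R)ˣ) (M : Ser R) (p : ℤ × ℕ × ℕ) : Ser R :=
  ((U ^ p.1 : (Ser R)ˣ) : Ser R) * M ^ p.2.1 * MvPowerSeries.X Var.s ^ p.2.2

/-- The coefficient of `k ^ i x ^ a s ^ b`. -/
noncomputable def tcoef (f : Ser R) (p : ℤ × ℕ × ℕ) : R :=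
  cf (Finsupp.single Var.x p.2.1 + Finsupp.single Var.s p.2.2) p.1 f

theorem smul_eq_cst_mul (c : R) (A : Ser R) : c • A = cst (MvPowerSeries.C c) * A :=
  ser_ext fun d m => by
    rw [cf_scalar_smul, cf_cst_mul, MvPowerSeries.coeff_C_mul, coeff_kCoeff]

theorem zero_scalar_smul (A : Ser R) : (0 : R) • A = 0 :=
  ser_ext fun d m => by rw [cf_scalar_smul, zero_mul, map_zero]

theorem intCast_scalar_smul (n : ℤ) (A : Ser R) : (n : R) • A = (n : Ser R) * A :=
  ser_ext fun d m => by rw [cf_scalar_smul, ← zsmul_eq_mul, ← zsmul_eq_mul, map_zsmul]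

theorem sum_scalar_smul {ι : Type*} (s : Finset ι) (c : ι → R) (A : Ser R) :
    (∑ i ∈ s, c i) • A = ∑ i ∈ s, c i • A :=
  ser_ext fun d m => by simp only [cf_scalar_smul, map_sum, Finset.sum_mul]

theorem substFamily_units (f M : Ser R) (U : (Ser R)ˣ) (p : ℤ × ℕ × ℕ) :
    substFamily f U M p = tcoef f p • mon U M p := by
  rw [substFamily, zPow_units, coeff_kCoeff]; rfl

theorem smul_mem_W {w : Var → ℕ} {p : ℤ} {A : Ser R} (c : R) (hA : A ∈ W R w p) :
    c • A ∈ W R w p := fun d m hm => by rw [cf_scalar_smul, hA d m hm, mul_zero]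

theorem tcoef_eq_zero_of_lt {f : Ser R} {B : ℤ} (hB : ∀ m : ℤ, B < m → kCoeff m f = 0)
    {p : ℤ × ℕ × ℕ} (hp : B < p.1) : tcoef f p = 0 := by
  rw [tcoef, ← coeff_kCoeff, hB _ hp, map_zero]

/-- `f(L, M)` exists if `L` and `L⁻¹` have degrees `1` and `-1`, and `M` has degree `-1` for
some weights of the independent variables, the weight of `s` being positive. -/
theorem exists_subst {U : (Ser R)ˣ} {M : Ser R} {w : Var → ℕ} (hs : 1 ≤ w Var.s)
    (hU : (U : Ser R) ∈ W R 0 1) (hU' : ((U⁻¹ : (Ser R)ˣ) : Ser R) ∈ W R 0 (-1))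
    (hM : M ∈ W R w (-1)) {f : Ser R} (hf : IsTwistorFun f) :
    ∃ A, HasFormalSum (substFamily f U M) A := by
  obtain ⟨B, hB⟩ := hf.2
  refine exists_hasFormalSum w fun q => ?_
  have hfin : ((Set.Icc q B) ×ˢ ((Set.Iio (B - q + 1).toNat : Set ℕ) ×ˢ
      (Set.Iio (B - q + 1).toNat : Set ℕ))).Finite :=
    (Set.finite_Icc q B).prod ((Set.finite_Iio _).prod (Set.finite_Iio _))
  refine hfin.subset fun p hp => ?_
  have h1 : ¬ B < p.1 := fun h => hp (by
    rw [substFamily_units, tcoef_eq_zero_of_lt hB h, zero_scalar_smul]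
    exact zero_mem _)
  have h2 : ¬ p.1 - p.2.1 - p.2.2 ≤ q := fun h => hp (by
    rw [substFamily_units]
    refine smul_mem_W _ (W_mono h ?_)
    have ha := mul_mem_W (mul_mem_W (W_of_W_zero (w := w) (units_zpow_mem_W hU hU' p.1))
      (pow_mem_W hM p.2.1)) (W_mono (q := -1) (by omega) (X_mem_W (R := R) (w := w) Var.s) |>
        fun h => pow_mem_W h p.2.2)
    rw [show p.1 - (p.2.1 : ℤ) - p.2.2 = p.1 + (p.2.1 : ℤ) * -1 + (p.2.2 : ℤ) * -1 by ring]
    exact ha)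
  simp only [Set.mem_prod, Set.mem_Icc, Set.mem_Iio]
  omega

/-- Two derivations along the same homomorphism that agree on `L` and `M` agree on `f(L, M)`,
for `f` that does not depend on `s`. -/
theorem FormalDerivation.δ_subst_eq {E E' : FormalDerivation R R} (hE : E.h₀ = RingHom.id _)
    (hE' : E'.h₀ = RingHom.id _) (hc : ∀ c : R, E.δ (cst (MvPowerSeries.C c)) = 0)
    (hc' : ∀ c : R, E'.δ (cst (MvPowerSeries.C c)) = 0) {U : (Ser R)ˣ} {M f A : Ser R}
    (hU : E.δ (U : Ser R) = E'.δ (U : Ser R)) (hM : E.δ M = E'.δ M)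
    (hf : ∀ p : ℤ × ℕ × ℕ, p.2.2 ≠ 0 → tcoef f p = 0)
    (hA : HasFormalSum (substFamily f U M) A) : E.δ A = E'.δ A := by
  refine (E.δ_sum hA).unique ((E'.δ_sum hA).congr fun p => ?_)
  rw [substFamily_units]
  rcases eq_or_ne p.2.2 0 with hb | hb
  · have hpow : ∀ n : ℕ, E.δ (M ^ n) = E'.δ (M ^ n) := fun n => by
      cases n with
      | zero => rw [pow_zero, E.δ_one, E'.δ_one]
      | succ n => rw [E.δ_pow_succ, E'.δ_pow_succ, hM, hE, hE']
    rw [smul_eq_cst_mul, E.leibniz, E'.leibniz, hc, hc', mon, hb, pow_zero, mul_one, E.leibniz,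
      E'.leibniz, hpow, E.δ_zpow, E'.δ_zpow, hU, hE, hE']
  · rw [hf p hb, zero_scalar_smul, map_zero, map_zero]

theorem mon_kPow_apply (U : (Ser R)ˣ) (hU : (U : Ser R) = kPow 1) (p : ℤ × ℕ × ℕ)
    (d : Var →₀ ℕ) (m : ℤ) : cf d m (mon U (MvPowerSeries.X Var.x) p) =
      if d = Finsupp.single Var.x p.2.1 + Finsupp.single Var.s p.2.2 ∧ m = p.1 then 1 else 0 := by
  classical
  have hinv : ((U⁻¹ : (Ser R)ˣ) : Ser R) = kPow (-1) := by
    refine (Units.mul_right_inj U).1 ?_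
    rw [Units.mul_inv, hU, kPow_mul, add_neg_cancel, kPow_zero]
  have hz : ∀ i : ℤ, ((U ^ i : (Ser R)ˣ) : Ser R) = kPow i := fun i => by
    induction i using Int.induction_on with
    | zero => simp [kPow_zero]
    | succ i ih => rw [zpow_add_one, Units.val_mul, ih, hU, kPow_mul]
    | pred i ih => rw [zpow_sub_one, Units.val_mul, ih, hinv, kPow_mul]; rfl
  rw [mon, hz, mul_assoc, mul_comm, cf_mul_kPow, MvPowerSeries.X_pow_eq, MvPowerSeries.X_pow_eq,
    MvPowerSeries.monomial_mul_monomial, mul_one, cf_def, MvPowerSeries.coeff_monomial]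
  by_cases hd : d = Finsupp.single Var.x p.2.1 + Finsupp.single Var.s p.2.2
  · simp [hd, HahnSeries.coeff_one, sub_eq_zero, eq_comm]
  · simp [hd]

/-- A function of `(k, x, s)` is its own substitution at `L = k`, `M = x`. -/
theorem hasFormalSum_substFamily_self [IsDomain R] [CharZero R] {f : Ser R} (hf : IsTwistorFun f)
    (U : (Ser R)ˣ) (hU : (U : Ser R) = kPow 1) :
    HasFormalSum (substFamily f U (MvPowerSeries.X Var.x)) f := by
  obtain ⟨B, hB⟩ := hf.2
  have hcf : ∀ p d m, cf d m (substFamily f U (MvPowerSeries.X Var.x) p) =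
      if d = Finsupp.single Var.x p.2.1 + Finsupp.single Var.s p.2.2 ∧ m = p.1 then
        cf d m f else 0 := fun p d m => by
    rw [substFamily_units, cf_scalar_smul, mon_kPow_apply U hU]
    split_ifs with h
    · rw [mul_one, tcoef, h.1, h.2]
    · rw [mul_zero]
  rw [hasFormalSum_iff]
  intro d
  refine ⟨⟨B, fun p m hm => ?_⟩, fun m => ?_⟩
  · rw [hcf, ← coeff_kCoeff, hB m hm, map_zero, ite_self]
  set q : ℤ × ℕ × ℕ := (m, d Var.x, d Var.s) with hq
  have hsub : ∀ p, p ≠ q → cf d m (substFamily f U (MvPowerSeries.X Var.x) p) = 0 := fun p hp => by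
    rw [hcf, if_neg]
    rintro ⟨hd, rfl⟩
    refine hp ?_
    have h1 := DFunLike.congr_fun hd Var.x
    have h2 := DFunLike.congr_fun hd Var.s
    simp only [Finsupp.add_apply, Finsupp.single_eq_same, ne_eq, reduceCtorEq, not_false_eq_true,
      Finsupp.single_eq_of_ne, add_zero, zero_add] at h1 h2
    rw [hq, h1, h2]
  refine ⟨(Set.finite_singleton q).subset fun p hp => by
    by_contra hne
    exact hp (hsub p hne), ?_⟩
  rw [finsum_eq_single _ q hsub, hcf]
  split_ifs with h
  · rfl
  -- A monomial that is not in `x` and `s` alone contains some `t_n`.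
  · have : ∃ n, d (Var.t n) ≠ 0 := by
      by_contra! hn
      refine h ⟨Finsupp.ext fun v => ?_, rfl⟩
      cases v with
      | x => simp [hq]
      | s => simp [hq]
      | t n => simp [hn n]
    obtain ⟨n, hn⟩ := this
    have h1 := congrArg (cf (d - Finsupp.single (Var.t n) 1) m) (hf.1 n)
    rw [cf_pd, map_zero, tsub_add_cancel_of_le (by
      rw [Finsupp.single_le_iff]; omega)] at h1
    have h2 : (((d - Finsupp.single (Var.t n) 1 : Var →₀ ℕ) (Var.t n) : ℕ) : R) + 1 ≠ 0 := by
      exact Nat.cast_add_one_ne_zero _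
    exact ((mul_eq_zero.1 h1).resolve_right h2).symm

theorem bracket_mul_mul (A B C D : Ser R) : bracket (A * B) (C * D) =
    A * C * bracket B D + A * D * bracket B C + B * C * bracket A D + B * D * bracket A C := by
  simp only [bracket, pd_mul, dk_mul]; ring

theorem bracket_natCast_left (n : ℕ) (A : Ser R) : bracket (n : Ser R) A = 0 := by
  rw [bracket_skew, ← bracketHom_apply, ← nsmul_one, map_nsmul, bracketHom_apply,
    bracket_one_right, nsmul_zero, neg_zero]

theorem bracket_zpow_left (U : (Ser R)ˣ) (A : Ser R) (i : ℤ) :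
    bracket ((U ^ i : (Ser R)ˣ) : Ser R) A =
      (i : Ser R) * (((U ^ (i - 1) : (Ser R)ˣ) : Ser R) * bracket (U : Ser R) A) := by
  have h := ((FormalDerivation.ofK R).ad A).δ_zpow U i
  rw [FormalDerivation.ad_δ, FormalDerivation.ad_δ] at h
  change bracket A ((U ^ i : (Ser R)ˣ) : Ser R) = _ * (((U ^ (i - 1) : (Ser R)ˣ) : Ser R) *
    bracket A (U : Ser R)) at h
  rw [bracket_skew, h, bracket_skew (U : Ser R)]; ring

theorem bracket_X_s_pow (A B : Ser R) (n : ℕ) :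
    bracket (A * MvPowerSeries.X Var.s ^ n) B = bracket A B * MvPowerSeries.X Var.s ^ n := by
  have h1 : ∀ n : ℕ, (MvPowerSeries.X Var.s ^ n : Ser R) = cst (MvPowerSeries.X Var.s ^ n) :=
    fun n => by simp [cst]
  rw [h1, bracket_skew, bracket_mul_right, bracket_cst_right, bracket_skew B]
  · ring
  · rw [Derivation.leibniz_pow, MvPowerSeries.pderiv_X]
    simp

/-- The bracket of two monomials in a canonical pair. The truncated exponent of `M` does no harm,
as the coefficient vanishes if neither monomial contains `M`. -/
theorem bracket_mon {U : (Ser R)ˣ} {M : Ser R} (h : bracket (U : Ser R) M = 1)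
    (p q : ℤ × ℕ × ℕ) : bracket (mon U M p) (mon U M q) =
      ((p.1 : R) * q.2.1 - p.2.1 * q.1) •
        mon U M (p.1 + q.1 - 1, p.2.1 + q.2.1 - 1, p.2.2 + q.2.2) := by
  obtain ⟨i, a, b⟩ := p
  obtain ⟨j, c, e⟩ := q
  have hUU : bracket ((U ^ i : (Ser R)ˣ) : Ser R) ((U ^ j : (Ser R)ˣ) : Ser R) = 0 := by
    rw [bracket_zpow_left, bracket_skew, bracket_zpow_left, bracket_self]; ring
  have hMM : bracket (M ^ a) (M ^ c) = 0 := by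
    cases a with
    | zero => rw [pow_zero, bracket_skew, bracket_one_right, neg_zero]
    | succ a =>
      cases c with
      | zero => rw [pow_zero, bracket_one_right]
      | succ c => rw [bracket_pow_left, bracket_skew, bracket_pow_left, bracket_self]; ring
  have hpow : ∀ (i : ℤ) (c : ℕ), bracket ((U ^ i : (Ser R)ˣ) : Ser R) (M ^ c) =
      (i : Ser R) * c * (((U ^ (i - 1) : (Ser R)ˣ) : Ser R) * M ^ (c - 1)) := fun i c => by
    cases c with
    | zero => rw [pow_zero, bracket_one_right]; simp
    | succ c =>
      rw [bracket_skew, bracket_pow_left, bracket_skew, bracket_zpow_left, h, Nat.add_sub_cancel]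
      push_cast; ring
  have hz : ∀ i j : ℤ, ((U ^ (i - 1) : (Ser R)ˣ) : Ser R) * ((U ^ j : (Ser R)ˣ) : Ser R) =
      ((U ^ (i + j - 1) : (Ser R)ˣ) : Ser R) := fun i j => by
    rw [← Units.val_mul, ← zpow_add, show i - 1 + j = i + j - 1 by ring]
  have hsm : ((i : R) * c - a * j) • mon U M (i + j - 1, a + c - 1, b + e) =
      ((i : Ser R) * c - a * j) * mon U M (i + j - 1, a + c - 1, b + e) := by
    have h1 : ((i : R) * c - a * j) = ((i * c - a * j : ℤ) : R) := by push_cast; ring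
    rw [h1, intCast_scalar_smul]
    push_cast; ring
  rw [hsm, mon, mon, bracket_X_s_pow, bracket_skew, bracket_X_s_pow, bracket_skew, neg_mul,
    neg_mul, neg_mul, neg_neg, bracket_mul_mul, hUU, hMM, hpow, bracket_skew (M ^ a), hpow, mon]
  have key : ∀ (a c : ℕ), (c : Ser R) * (M ^ a * M ^ (c - 1)) = c * M ^ (a + c - 1) := fun a c => by
    cases c with
    | zero => simp
    | succ c => rw [← pow_add]; rfl
  have k1 := key a c
  have k2 := key c a
  have z1 := hz i j
  have z2 := hz j i
  rw [add_comm j i] at z2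
  rw [add_comm c a] at k2
  rw [pow_add]
  simp only
  linear_combination (i : Ser R) * (c * (M ^ a * M ^ (c - 1))) * MvPowerSeries.X Var.s ^ b *
      MvPowerSeries.X Var.s ^ e * z1 +
    (i : Ser R) * ((U ^ (i + j - 1) : (Ser R)ˣ) : Ser R) * MvPowerSeries.X Var.s ^ b *
      MvPowerSeries.X Var.s ^ e * k1 -
    (j : Ser R) * (a * (M ^ c * M ^ (a - 1))) * MvPowerSeries.X Var.s ^ b *
      MvPowerSeries.X Var.s ^ e * z2 -
    (j : Ser R) * ((U ^ (i + j - 1) : (Ser R)ˣ) : Ser R) * MvPowerSeries.X Var.s ^ b *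
      MvPowerSeries.X Var.s ^ e * k2

theorem HasFormalSum.bracket_subst_terms {U : (Ser R)ˣ} {M f g A B : Ser R}
    (h : DcmKP.bracket (U : Ser R) M = 1) (hA : HasFormalSum (substFamily f U M) A)
    (hB : HasFormalSum (substFamily g U M) B) :
    HasFormalSum (fun p : (ℤ × ℕ × ℕ) × (ℤ × ℕ × ℕ) =>
      (tcoef f p.1 * tcoef g p.2 * ((p.1.1 : R) * p.2.2.1 - p.1.2.1 * p.2.1)) •
        mon U M (p.1.1 + p.2.1 - 1, p.1.2.1 + p.2.2.1 - 1, p.1.2.2 + p.2.2.2))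
      (DcmKP.bracket A B) := by
  refine (hA.bracket hB).congr fun p => ?_
  have hl : ∀ (c : R) (A B : Ser R), DcmKP.bracket A (c • B) = c • DcmKP.bracket A B :=
    fun c A B => by
      rw [smul_eq_cst_mul, bracket_mul_right, bracket_cst_right _ (pderiv_C _ c), smul_eq_cst_mul]; ring
  have hr : ∀ (c : R) (A B : Ser R), DcmKP.bracket (c • A) B = c • DcmKP.bracket A B :=
    fun c A B => by
      rw [bracket_skew, hl, bracket_skew B, smul_eq_cst_mul, smul_eq_cst_mul]; ring
  rw [substFamily_units, substFamily_units, hl, hr, bracket_mon h]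
  simp only [smul_eq_cst_mul, map_mul, cst]
  ring

/-- Substitution of a canonical pair is compatible with the bracket. -/
theorem hasFormalSum_subst_bracket [IsDomain R] [CharZero R] {U : (Ser R)ˣ} {M f g A B : Ser R}
    (h : bracket (U : Ser R) M = 1) (hf : IsTwistorFun f) (hg : IsTwistorFun g)
    (hA : HasFormalSum (substFamily f U M) A) (hB : HasFormalSum (substFamily g U M) B) :
    HasFormalSum (substFamily (bracket f g) U M) (bracket A B) := by
  classical
  -- The coefficients of `{f, g}` are found from the case `L = k`, `M = x`.
  obtain ⟨Uk, hUk, -⟩ := (show IsMonicSer 1 (kPow 1 : Ser R) by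
    rw [IsMonicSer, kPow_mul, add_neg_cancel, kPow_zero, sub_self]; exact zero_mem _).exists_unit
  have hk : bracket (Uk : Ser R) (MvPowerSeries.X Var.x) = 1 := by
    rw [hUk, bracket, pd_X, if_pos rfl, dk_X, dk_kPow, sub_self, kPow_zero]; simp
  have h0 := HasFormalSum.bracket_subst_terms hk (hasFormalSum_substFamily_self hf Uk hUk)
    (hasFormalSum_substFamily_self hg Uk hUk)
  have h1 := HasFormalSum.bracket_subst_terms h hA hB
  set ρ : (ℤ × ℕ × ℕ) × (ℤ × ℕ × ℕ) → ℤ × ℕ × ℕ := fun p =>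
    (p.1.1 + p.2.1 - 1, p.1.2.1 + p.2.2.1 - 1, p.1.2.2 + p.2.2.2) with hρ
  set c : (ℤ × ℕ × ℕ) × (ℤ × ℕ × ℕ) → R := fun p =>
    tcoef f p.1 * tcoef g p.2 * ((p.1.1 : R) * p.2.2.1 - p.1.2.1 * p.2.1) with hc
  have hinj : ∀ r r' : ℤ × ℕ × ℕ,
      (Finsupp.single Var.x r.2.1 + Finsupp.single Var.s r.2.2 =
        Finsupp.single Var.x r'.2.1 + Finsupp.single Var.s r'.2.2 ∧ r.1 = r'.1) ↔ r' = r := by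
    rintro ⟨i, a, b⟩ ⟨i', a', b'⟩
    refine ⟨fun ⟨h, hi⟩ => ?_, fun h => by rw [h]; exact ⟨rfl, rfl⟩⟩
    have e1 := DFunLike.congr_fun h Var.x
    have e2 := DFunLike.congr_fun h Var.s
    simp only [Finsupp.add_apply, Finsupp.single_eq_same, ne_eq, reduceCtorEq, not_false_eq_true,
      Finsupp.single_eq_of_ne, add_zero, zero_add] at e1 e2
    simp only at hi
    rw [e1, e2, hi]
  have hcf : ∀ r p, cf (Finsupp.single Var.x r.2.1 + Finsupp.single Var.s r.2.2) r.1
      (c p • mon Uk (MvPowerSeries.X Var.x) (ρ p)) = if ρ p = r then c p else 0 := fun r p => by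
    rw [cf_scalar_smul, mon_kPow_apply Uk hUk]
    simp only [hinj r (ρ p)]
    split_ifs <;> simp
  have hfin : ∀ r, (Function.support fun p => if ρ p = r then c p else 0).Finite := fun r => by
    have := h0.support_finite (Finsupp.single Var.x r.2.1 + Finsupp.single Var.s r.2.2) r.1
    refine this.subset fun p hp => ?_
    rw [Function.mem_support] at hp ⊢
    exact fun h => hp ((hcf r p).symm.trans h)
  have hsum : ∀ r, tcoef (bracket f g) r = ∑ p ∈ (hfin r).toFinset, if ρ p = r then c p else 0 :=
    fun r => by
      rw [tcoef, ← h0.finsum_cf, finsum_congr (hcf r)]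
      exact finsum_eq_sum_of_support_subset _ (by simp)
  refine h1.fiberwise ρ fun r => ?_
  have hfs := hasFormalSum_sum (hfin r).toFinset
    (a := fun p => if ρ p = r then c p • mon U M (ρ p) else 0) fun p hp => by
      have : (if ρ p = r then c p else 0) = 0 := by simpa using hp
      split_ifs at this ⊢ with h
      · rw [this, zero_scalar_smul]
      · rfl
  have hr : substFamily (bracket f g) U M r =
      ∑ p ∈ (hfin r).toFinset, if ρ p = r then c p • mon U M (ρ p) else 0 := by
    rw [substFamily_units, hsum, sum_scalar_smul]
    refine Finset.sum_congr rfl fun p _ => ?_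
    split_ifs with h
    · rw [h]
    · rw [zero_scalar_smul]
  rw [hr]
  convert hfs

theorem hasFormalSum_subst_one (U : (Ser R)ˣ) (M : Ser R) :
    HasFormalSum (substFamily 1 U M) 1 := by
  have h1 := hasFormalSum_single (a := substFamily 1 U M) (0, 0, 0) fun p hp => by
    rw [substFamily_units, tcoef, cf_one, if_neg, zero_scalar_smul]
    rintro ⟨h, hi⟩
    have e1 := DFunLike.congr_fun h Var.x
    have e2 := DFunLike.congr_fun h Var.s
    simp at e1 e2
    exact hp (Prod.ext hi (Prod.ext e1 e2))
  rw [substFamily_units] at h1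
  simpa [tcoef, cf_one, mon, smul_eq_cst_mul, cst] using h1

end Subst

/-! ### The flows of `F(L, M)` -/

section Basic

variable {R : Type*} [CommRing R]

theorem B_one {L : Ser R} (h : IsLaxForm L) : B L 1 = kPow 1 := by
  rw [B, PNat.one_coe, pow_one, h]

theorem tcoef_eq_zero_of_pd_s [IsDomain R] [CharZero R] {F : Ser R} (hF : pd Var.s F = 0)
    (p : ℤ × ℕ × ℕ) (hp : p.2.2 ≠ 0) : tcoef F p = 0 := by
  obtain ⟨i, a, b⟩ := p
  obtain ⟨b, rfl⟩ := Nat.exists_eq_succ_of_ne_zero hp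
  have h := congrArg (cf (Finsupp.single Var.x a + Finsupp.single Var.s b) i) hF
  rw [cf_pd, map_zero, add_assoc, ← Finsupp.single_add] at h
  refine (mul_eq_zero.1 h).resolve_right ?_
  simp only [Finsupp.add_apply, Finsupp.single_eq_same, ne_eq, reduceCtorEq, not_false_eq_true,
      Finsupp.single_eq_of_ne, zero_add]
  exact Nat.cast_add_one_ne_zero _

end Basic

section LogAd

variable {R : Type*} [CommRing R] [Algebra ℚ R]

theorem logBracket_add (N : ℕ) (P A B : Ser R) :
    logBracket N P (A + B) = logBracket N P A + logBracket N P B := by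
  simp only [logBracket, pd_add, dk_add]; ring

theorem pd_dkLog (v : Var) (N : ℕ) (P : Ser R) : pd v (dkLog N P) = dk (pd v (logReg N P)) := by
  rw [dkLog, pd_add, pd_natCast_mul, pd_kPow, mul_zero, zero_add, dk_pd]

/-- The operator `A ↦ {log P, A}`. -/
noncomputable def logAd (N : ℕ) (P : Ser R) : FormalDerivation R R where
  h₀ := RingHom.id _
  δ := AddMonoidHom.mk' (logBracket N P) (logBracket_add N P)
  leibniz A B := by
    simp only [AddMonoidHom.mk'_apply, RingHom.id_apply, logBracket, pd_mul, dk_mul]; ring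
  h₀_bracket _ _ := rfl
  δ_bracket A B := by
    simp only [AddMonoidHom.mk'_apply, RingHom.id_apply, logBracket, bracket, pd_sub, dk_sub,
      pd_mul, dk_mul, dk_pd, pd_dkLog]
    ring
  h₀_sum h := h
  δ_sum h := ((h.pd Var.x).mul_left _).sub (h.dk.mul_right _)

theorem logBracket_bracket (N : ℕ) (P A B : Ser R) : logBracket N P (bracket A B) =
    bracket A (logBracket N P B) + bracket (logBracket N P A) B := (logAd N P).δ_bracket A B

theorem logBracket_cst (N : ℕ) (P : Ser R) {c : Coef R}
    (hc : MvPowerSeries.pderiv R Var.x c = 0) : logBracket N P (cst c) = 0 := by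
  rw [logBracket, pd_cst, dk_cst, hc, cst_zero]; ring

/-- A series that commutes with a canonical pair is a function of `t`. -/
theorem eq_cst_of_bracket_eq_zero {L M Z : Ser R} (h : bracket L M = 1) (hL : bracket Z L = 0)
    (hM : bracket Z M = 0) : Z = cst (kCoeff 0 Z) := by
  refine eq_cst_of_dk_eq_zero ?_
  simp only [bracket] at h hL hM
  linear_combination dk L * hM - dk M * hL - dk Z * h

end LogAd

section Orlov

variable {R : Type*} [CommRing R] [Algebra ℚ R] {N : ℕ} {D : Data R}

/-- The weights for which `L` has degree `1` and the Orlov function `M` has degree `-1`. -/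
def orlovWeight : Var → ℕ
  | Var.x => 1
  | Var.s => 1
  | Var.t n => n

theorem IsSolution.M_mem_W (h : IsSolution N D) : D.M ∈ W R orlovWeight (-1) := by
  obtain ⟨U, hU, h1, h2⟩ := h.exists_unit
  have hz : ∀ i : ℤ, zPow D.L i ∈ W R orlovWeight i := fun i => by
    rw [← hU, zPow_units]; exact W_of_W_zero (units_zpow_mem_W h1 h2 i)
  have hsum := h.orlov.mem_W (w := orlovWeight) (p := -1) fun n => by
    refine add_mem ?_ ?_
    · refine W_mono ?_ (mul_mem_W (natCast_mem_W n) (mul_mem_W (X_mem_W (Var.t n)) (hz _)))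
      change (0 : ℤ) + (-((n : ℕ) : ℤ) + ((n : ℤ) - 1)) ≤ -1
      omega
    · refine W_mono ?_ (mul_mem_W (cst_mem_W (D.v n)) (hz _))
      have := n.pos
      omega
  have hx : (MvPowerSeries.X Var.x : Ser R) ∈ W R orlovWeight (-1) := X_mem_W Var.x
  have hs : (N : Ser R) * (MvPowerSeries.X Var.s * zPow D.L (-1)) ∈ W R orlovWeight (-1) :=
    W_mono (by change (0 : ℤ) + (-((1 : ℕ) : ℤ) + -1) ≤ -1; norm_num)
      (mul_mem_W (natCast_mem_W N) (mul_mem_W (X_mem_W Var.s) (hz _)))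
  have := add_mem (add_mem hsum hs) hx
  rwa [show D.M - MvPowerSeries.X Var.x - (N : Ser R) * (MvPowerSeries.X Var.s * zPow D.L (-1)) +
      (N : Ser R) * (MvPowerSeries.X Var.s * zPow D.L (-1)) + MvPowerSeries.X Var.x = D.M by
    ring] at this

theorem IsSolution.exists_subst (h : IsSolution N D) {f : Ser R} (hf : IsTwistorFun f) :
    ∃ A, HasFormalSum (substFamily f D.L D.M) A := by
  obtain ⟨U, hU, h1, h2⟩ := h.exists_unit
  rw [← hU]
  exact DcmKP.exists_subst (w := orlovWeight) le_rfl h1 h2 h.M_mem_W hf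

variable [IsDomain R] [CharZero R] {F G : Ser R}

/-- `F(L, M)` evolves like `L` and `M` along `t_n`. -/
theorem IsSolution.pd_t_subst (h : IsSolution N D) (hF : pd Var.s F = 0)
    (hG : HasFormalSum (substFamily F D.L D.M) G) (n : ℕ+) :
    pd (Var.t n) G = bracket (B D.L n) G := by
  obtain ⟨U, hU, -, -⟩ := h.exists_unit
  rw [← hU] at hG
  refine FormalDerivation.δ_subst_eq (E := .ofVar R (Var.t n))
    (E' := (FormalDerivation.ofVar R (Var.t n)).ad (B D.L n)) rfl rfl (fun c => ?_) (fun c => ?_)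
    ?_ (h.pd_t_M n) (tcoef_eq_zero_of_pd_s hF) hG
  · change pd _ (cst _) = 0
    rw [pd_cst, pderiv_C, cst_zero]
  · exact bracket_cst_right _ (pderiv_C _ _)
  · rw [hU]; exact h.lax_t n

/-- `F(L, M)` evolves like `L` and `M` along `s`, as `F` does not depend on `s`. -/
theorem IsSolution.pd_s_subst (h : IsSolution N D) (hF : pd Var.s F = 0)
    (hG : HasFormalSum (substFamily F D.L D.M) G) : pd Var.s G = logBracket N D.P G := by
  obtain ⟨U, hU, -, -⟩ := h.exists_unit
  rw [← hU] at hG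
  refine FormalDerivation.δ_subst_eq (E := .ofVar R Var.s)
    (E' := logAd N D.P) rfl rfl (fun c => ?_) (fun c => ?_)
    ?_ h.pd_s_M (tcoef_eq_zero_of_pd_s hF) hG
  · change pd _ (cst _) = 0
    rw [pd_cst, pderiv_C, cst_zero]
  · exact logBracket_cst _ _ (pderiv_C _ _)
  · rw [hU]; exact h.lax_s

theorem IsSolution.pd_x_subst (h : IsSolution N D) (hF : pd Var.s F = 0)
    (hG : HasFormalSum (substFamily F D.L D.M) G) : pd Var.x G = pd (Var.t 1) G := by
  rw [h.pd_t_subst hF hG, B_one h.form_L, bracket, dk_kPow, pd_kPow, sub_self, kPow_zero]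
  simp

/-- The derivative of `F(L, M)_0` along `t_n`. -/
theorem IsSolution.pderiv_kCoeff_zero_subst (h : IsSolution N D) (hF : pd Var.s F = 0)
    (hG : HasFormalSum (substFamily F D.L D.M) G) (n : ℕ+) :
    MvPowerSeries.pderiv R (Var.t n) (kCoeff 0 G) =
      kCoeff 0 (bracket (D.L ^ (n : ℕ)) (nonpos G)) := by
  have h1 : bracket (B D.L n) G = bracket (D.L ^ (n : ℕ)) (nonpos G) -
      bracket (nonpos (D.L ^ (n : ℕ))) (nonpos G) + bracket (B D.L n) (pos G) := by
    conv_lhs => rw [← nonpos_add_pos G, bracket_add_right]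
    rw [← bracket_sub_left, sub_eq_iff_eq_add'.2 (nonpos_add_B D.L n).symm]
  rw [← kCoeff_pd, h.pd_t_subst hF hG, h1, kCoeff_add, kCoeff_sub,
    kCoeff_of_mem_W (bracket_mem_W_zero (nonpos_mem_W _) (nonpos_mem_W _)) (by norm_num),
    kCoeff_of_mem_V (bracket_mem_V_one (show B D.L n ∈ V R 1 from pos_mem_V _) (pos_mem_V _))
      (by norm_num), sub_zero, add_zero]

end Orlov

/-! ### Variation of the twistor data -/

section Variation

open DualNumber

variable {K : Type*} [Field K]

theorem mapCoef_C {R S : Type*} [CommRing R] [CommRing S] (h : R →+ S) (c : R) :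
    mapCoef h (MvPowerSeries.C c : Coef R) = MvPowerSeries.C (h c) := by
  classical
  refine MvPowerSeries.ext fun d => ?_
  rw [coeff_mapCoef, MvPowerSeries.coeff_C, MvPowerSeries.coeff_C]
  split_ifs <;> simp

theorem fst_units_zpow (U : (Ser K[ε])ˣ) (i : ℤ) :
    mapSer fstK ((U ^ i : (Ser K[ε])ˣ) : Ser K[ε]) =
      (((Units.map (FormalDerivation.ofDual K).h₀.toMonoidHom U) ^ i : (Ser K)ˣ) : Ser K) := by
  rw [← map_zpow]; rfl

/-- The variation of `f(L, M)` when `(L, M)` moves along `ad H` and `f` along `-ad F`. -/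
theorem snd_subst_flow {F f M : Ser K} {U : (Ser K[ε])ˣ} {Mε : Ser K[ε]} {H A C : Ser K}
    {Aε : Ser K[ε]} (hM0 : mapSer fstK Mε = M)
    (hU : mapSer sndK (U : Ser K[ε]) = bracket H (mapSer fstK (U : Ser K[ε])))
    (hM : mapSer sndK Mε = bracket H M)
    (hAε : HasFormalSum (substFamily (flow F f) U Mε) Aε)
    (hA : HasFormalSum (substFamily f (mapSer fstK (U : Ser K[ε])) M) A)
    (hC : HasFormalSum (substFamily (bracket F f) (mapSer fstK (U : Ser K[ε])) M) C) :
    mapSer sndK Aε = bracket H A - C := by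
  set E := FormalDerivation.ofDual K with hE
  set U₀ : (Ser K)ˣ := Units.map E.h₀.toMonoidHom U with hU₀
  have hU₀' : mapSer fstK (U : Ser K[ε]) = (U₀ : Ser K) := rfl
  rw [hU₀'] at hA hC
  have hX : ∀ n : ℕ, mapSer fstK (MvPowerSeries.X Var.s ^ n : Ser K[ε]) =
      MvPowerSeries.X Var.s ^ n := fun n => by rw [fst_pow, fst_X]
  have hmon0 : ∀ p, mapSer fstK (mon U Mε p) = mon U₀ M p := fun p => by
    rw [mon, fst_mul, fst_mul, fst_units_zpow, fst_pow, hM0, hX]; rfl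
  have hpow : ∀ (T : Ser K[ε]) (n : ℕ), E.δ T = bracket H (E.h₀ T) →
      E.δ (T ^ n) = bracket H (E.h₀ (T ^ n)) := fun T n hT => by
    rw [E.δ_pow_eq_bracket hT, map_pow]
  have hmul : ∀ T T' : Ser K[ε], E.δ T = bracket H (E.h₀ T) → E.δ T' = bracket H (E.h₀ T') →
      E.δ (T * T') = bracket H (E.h₀ (T * T')) := fun T T' hT hT' => by
    rw [E.leibniz, map_mul, bracket_mul_right, hT, hT']
  have hmon1 : ∀ p, mapSer sndK (mon U Mε p) = bracket H (mon U₀ M p) := fun p => by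
    rw [← hmon0]
    refine hmul _ _ (hmul _ _ (E.δ_zpow_eq_bracket hU _) (hpow _ _ ?_)) (hpow _ _ ?_)
    · change mapSer sndK Mε = bracket H (mapSer fstK Mε)
      rw [hM, hM0]
    · change mapSer sndK _ = bracket H (mapSer fstK _)
      rw [snd_X, fst_X, bracket, dk_X, pd_X, if_neg (by simp)]; ring
  have ht0 : ∀ p, fstK (tcoef (flow F f) p) = tcoef f p := fun p => by
    rw [tcoef, ← cf_mapSer, flow, fst_expand, tcoef]
  have ht1 : ∀ p, sndK (tcoef (flow F f) p) = -tcoef (bracket F f) p := fun p => by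
    rw [tcoef, ← cf_mapSer, flow, snd_expand, map_neg, tcoef]
  refine (hAε.mapSer sndK).unique (((hA.bracket_right H).sub hC).congr fun p => ?_)
  rw [substFamily_units, substFamily_units, substFamily_units, smul_eq_cst_mul, snd_mul,
    mapSer_cst, mapSer_cst, mapCoef_C, mapCoef_C, ht0, ht1, hmon0, hmon1, smul_eq_cst_mul,
    bracket_mul_right, bracket_cst_right _ (pderiv_C _ _), smul_eq_cst_mul, map_neg, cst_neg]
  ring

variable [CharZero K] {N : ℕ}

/-- If `(L, M)` is deformed along `ad H`, with `H` of nonpositive degree,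
and the deformation has the twistor data deformed by `F`, then `E = H - F(L, M)` satisfies
`{E, f(L, M)}_{≤ 0} = 0` and `{E, g(L, M)}_{< 0} = 0`. As `f(L, M)` and `g(L, M)` form a canonical
pair, this determines the derivatives of `E` up to nonnegative powers of `k`, so that `H` agrees
with the nonpositive part of `F(L, M)` up to a function of `t`. -/
theorem exists_generator_eq {D : Data K} (hD : IsSolution N D) {f g : Ser K}
    (hfg : IsTwistorData f g D.L D.M) {F : Ser K} (hF : IsTwistorFun F) {Lε Mε : Ser K[ε]}
    (hLu : IsUnit Lε) (hL0 : mapSer fstK Lε = D.L) (hM0 : mapSer fstK Mε = D.M)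
    (hfgε : IsTwistorData (flow F f) (flow F g) Lε Mε) {G : Ser K}
    (hG : HasFormalSum (substFamily F D.L D.M) G) {H : Ser K} (hH : H ∈ W K 0 0)
    (hL : mapSer sndK Lε = bracket H D.L) (hM : mapSer sndK Mε = bracket H D.M) :
    ∃ c : Coef K, MvPowerSeries.pderiv K Var.x c = 0 ∧ H = nonpos G + cst c := by
  obtain ⟨U, rfl⟩ := hLu
  obtain ⟨V₀, hV₀, -, -⟩ := hD.exists_unit
  have hLM : bracket (V₀ : Ser K) D.M = 1 := by rw [hV₀]; exact hD.dressing.bracket_L_M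
  have hsub : ∀ {f A B : Ser K}, IsTwistorFun f → HasFormalSum (substFamily f D.L D.M) A →
      HasFormalSum (substFamily F D.L D.M) B →
      HasFormalSum (substFamily (bracket F f) D.L D.M) (bracket B A) := fun hf hA hB => by
    rw [← hV₀] at hA hB ⊢
    exact hasFormalSum_subst_bracket hLM hF hf hB hA
  obtain ⟨A, hA, hAn⟩ := hfg.f_cond
  obtain ⟨Q, hQ, hQn⟩ := hfg.g_cond
  obtain ⟨Aε, hAε, hAεn⟩ := hfgε.f_cond
  obtain ⟨Qε, hQε, hQεn⟩ := hfgε.g_cond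
  have hAQ : bracket A Q = 1 := by
    have hA' := hA
    have hQ' := hQ
    rw [← hV₀] at hA' hQ'
    have h1 := hasFormalSum_subst_bracket hLM hfg.fun_f hfg.fun_g hA' hQ'
    rw [hfg.canonical] at h1
    exact h1.unique (hasFormalSum_subst_one _ _)
  have hAs : mapSer sndK Aε = bracket (H - G) A := by
    rw [bracket_sub_left]
    refine snd_subst_flow hM0 (by rw [hL, hL0]) hM hAε ?_ ?_ <;> rw [hL0]
    exacts [hA, hsub hfg.fun_f hA hG]
  have hQs : mapSer sndK Qε = bracket (H - G) Q := by
    rw [bracket_sub_left]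
    refine snd_subst_flow hM0 (by rw [hL, hL0]) hM hQε ?_ ?_ <;> rw [hL0]
    exacts [hQ, hsub hfg.fun_g hQ hG]
  have hAV : A ∈ V K 1 := mem_V_one_iff.2 hAn
  have hQV : Q ∈ V K 0 := mem_V_zero_iff.2 hQn
  have hEA : bracket (H - G) A ∈ V K 1 := by
    rw [← hAs, mem_V_one_iff, nonpos, ← mapSer_part]
    change mapSer sndK (nonpos Aε) = 0
    rw [hAεn, mapSer_zero]
  have hEQ : bracket (H - G) Q ∈ V K 0 := by
    rw [← hQs, mem_V_zero_iff, neg, ← mapSer_part]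
    change mapSer sndK (neg Qε) = 0
    rw [hQεn, mapSer_zero]
  have hdk : dk (H - G) ∈ V K 0 := by
    have : dk (H - G) = dk A * bracket (H - G) Q - dk Q * bracket (H - G) A := by
      simp only [bracket] at hAQ ⊢
      linear_combination -dk (H - G) * hAQ
    rw [this]
    refine sub_mem ?_ (V_mono (by norm_num) (mul_mem_V (dk_mem_V hQV) hEA))
    exact V_mono (by norm_num) (mul_mem_V (dk_mem_V (V_mono zero_le_one hAV)) hEQ)
  have hpd : pd Var.x (H - G) ∈ V K 1 := by
    have : pd Var.x (H - G) =
        pd Var.x A * bracket (H - G) Q - pd Var.x Q * bracket (H - G) A := by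
      simp only [bracket] at hAQ ⊢
      linear_combination -pd Var.x (H - G) * hAQ
    rw [this]
    refine sub_mem ?_ ?_
    · simpa using mul_mem_V (pd_mem_V hAV Var.x) hEQ
    · simpa using mul_mem_V (pd_mem_V hQV Var.x) hEA
  refine ⟨kCoeff 0 (H - G), ?_, ?_⟩
  · rw [← kCoeff_pd]; exact kCoeff_of_mem_V hpd zero_lt_one
  · have h1 : nonpos (H - G) = cst (kCoeff 0 (H - G)) := ser_ext fun d m => by
      rw [cf_nonpos, cf_cst]
      rcases lt_trichotomy m 0 with hm | rfl | hm
      · rw [if_pos hm.le, if_neg hm.ne]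
        have h2 := hdk d (m - 1) (by omega)
        rw [cf_dk, sub_add_cancel] at h2
        refine (mul_eq_zero.1 h2).resolve_left ?_
        have : (((m - 1 : ℤ) : K) + 1) = (m : K) := by push_cast; ring
        rw [this]
        exact_mod_cast hm.ne
      · rw [if_pos le_rfl, if_pos rfl, coeff_kCoeff]
      · rw [if_neg (by omega), if_neg hm.ne']
    have h2 : nonpos (H - G) = nonpos H - nonpos G := part_sub _ _ _
    rw [nonpos_eq_self hH] at h2
    rw [← h1, h2]; ring

end Variation

/-! ### Variation of the dressing function -/

section Iterates

variable {R : Type*} [CommRing R]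

theorem iterate_bracket_add (φ A B : Ser R) (r : ℕ) :
    (bracket φ)^[r] (A + B) = (bracket φ)^[r] A + (bracket φ)^[r] B := by
  have := iterate_bracket_sub φ (A + B) B r
  rw [add_sub_cancel_right] at this
  rw [this, sub_add_cancel]

theorem iterate_bracket_zero (φ : Ser R) (r : ℕ) : (bracket φ)^[r] 0 = 0 := by
  have := iterate_bracket_sub φ 0 0 r
  rwa [sub_self, sub_self] at this

variable [Algebra ℚ R]

/-- A power series in `ad φ` with constant term `1` fixes the functions of `t` that do not depend
on `x`. -/
theorem hasFormalSum_ad_cst (c : ℕ → ℚ) (hc : c 0 = 1) (φ : Ser R) {a : Coef R}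
    (ha : MvPowerSeries.pderiv R Var.x a = 0) :
    HasFormalSum (fun r => c r • (bracket φ)^[r] (cst a)) (cst a) := by
  have h : HasFormalSum _ (c 0 • (bracket φ)^[0] (cst a)) := hasFormalSum_single
      (a := fun r => c r • (bracket φ)^[r] (cst a)) 0 fun r hr => by
    obtain ⟨r, rfl⟩ := Nat.exists_eq_succ_of_ne_zero hr
    change c _ • (bracket φ)^[r + 1] (cst a) = 0
    rw [Function.iterate_succ_apply, bracket_cst_right _ ha, iterate_bracket_zero, rat_smul_zero]
  have h0 : c 0 • (bracket φ)^[0] (cst a) = cst a := by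
    rw [hc, Function.iterate_zero_apply, one_rat_smul]
  rwa [h0] at h

theorem hasFormalSum_nabla_cst (φ : Ser R) {a : Coef R}
    (ha : MvPowerSeries.pderiv R Var.x a = 0) : HasFormalSum (nablaFamily φ (cst a)) (cst a) :=
  hasFormalSum_ad_cst (fun r => (((r + 1).factorial : ℚ)⁻¹)) (by simp) φ ha

theorem hasFormalSum_todd_cst (φ : Ser R) {a : Coef R}
    (ha : MvPowerSeries.pderiv R Var.x a = 0) : HasFormalSum (toddFamily φ (cst a)) (cst a) :=
  hasFormalSum_ad_cst (fun r => bernoulli r / (r.factorial : ℚ)) (by simp) φ ha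

theorem HasFormalSum.kCoeff_zero_nabla {φ X H : Ser R} (hφ : φ ∈ W R 0 0) (hX : X ∈ W R 0 0)
    (hH : HasFormalSum (nablaFamily φ X) H) : kCoeff 0 H = kCoeff 0 X := by
  have h1 : H - X ∈ W R 0 (-1) := by
    have := hH.succ.mem_W (w := 0) (p := -1) fun r => rat_smul_mem_W _
      (W_mono (by push_cast; omega) (iterate_bracket_mem_W hφ hX (r + 1)))
    rwa [nablaFamily_zero] at this
  have h2 := kCoeff_of_mem_W h1 (m := 0) (by norm_num)
  rwa [kCoeff_sub, sub_eq_zero] at h2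

/-- Functions of `s` alone may be added to a dressing function. -/
theorem IsDressing.add_cst {N : ℕ} {L P M φ : Ser R} (h : IsDressing N L P M φ) {η : Coef R}
    (hη : OnlyS η) : IsDressing N L P M (φ + cst η) := by
  have hb : bracket (φ + cst η) = bracket φ := funext fun A => by
    rw [bracket_add_left, bracket_cst_left A hη.1, add_zero]
  obtain ⟨c, hc⟩ := h.s_flow
  refine ⟨?_, ?_, ?_, fun n => ?_, c + MvPowerSeries.pderiv R Var.s η, ?_⟩
  · exact pos_eq_zero (add_mem (mem_W_of_form h.form) (cst_mem_W η))
  · exact h.dress_L.congr fun r => by rw [expAdFamily, expAdFamily, hb]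
  · exact h.dress_M.congr fun r => by rw [expAdFamily, expAdFamily, hb]
  · exact (h.t_flow n).congr fun r => by
      rw [nablaFamily, nablaFamily, hb, pd_add, pd_cst, hη.2, cst_zero, add_zero]
  · have hx : MvPowerSeries.pderiv R Var.x (MvPowerSeries.pderiv R Var.s η) = 0 := by
      have h1 := pd_comm Var.x Var.s (cst η)
      rw [pd_cst, pd_cst, pd_cst, pd_cst, hη.1, map_zero, cst_zero] at h1
      rw [← kCoeff_cst_zero (MvPowerSeries.pderiv R Var.x _), h1, kCoeff_zero]
    rw [cst_add, ← add_assoc]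
    exact (hc.add (hasFormalSum_nabla_cst φ hx)).congr fun r => by
      rw [nablaFamily, nablaFamily, nablaFamily, hb, pd_add, pd_cst, ← rat_smul_add,
        iterate_bracket_add]

end Iterates

section FirstOrder

open DualNumber

variable {K : Type*} [Field K] {N : ℕ}

theorem snd_pow_eq_bracket {L : Ser K[ε]} {H : Ser K}
    (h : mapSer sndK L = bracket H (mapSer fstK L)) (n : ℕ) :
    mapSer sndK (L ^ n) = bracket H (mapSer fstK L ^ n) :=
  (FormalDerivation.ofDual K).δ_pow_eq_bracket h n

theorem IsMonicSer.fst {A : Ser K[ε]} (h : IsMonicSer N A) : IsMonicSer N (mapSer fstK A) := by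
  have := mapSer_mem_W fstK h
  rwa [mapSer_sub, fst_mul, fst_kPow, fst_one] at this

end FirstOrder

section Dressing

open DualNumber

variable {K : Type*} [Field K] [CharZero K] {N : ℕ}

/-- The variation of the dressing function generates the variation of `L` and `M`. -/
theorem IsDressing.exists_variation {L P M φ : Ser K[ε]} (h : IsDressing N L P M φ) :
    ∃ H ∈ W K 0 0, HasFormalSum (nablaFamily (mapSer fstK φ) (mapSer sndK φ)) H ∧
      mapSer sndK L = bracket H (mapSer fstK L) ∧ mapSer sndK M = bracket H (mapSer fstK M) ∧
      ∀ n : ℕ+, MvPowerSeries.pderiv K (Var.t n) (kCoeff 0 H) =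
        -kCoeff 0 (bracket H (mapSer fstK L ^ (n : ℕ))) := by
  have hφ := mem_W_of_form h.form
  have hφ0 := mapSer_mem_W fstK hφ
  have hφ1 := mapSer_mem_W sndK hφ
  obtain ⟨H, hHW, hH⟩ := exists_hasFormalSum_ad (fun r => (((r + 1).factorial : ℚ)⁻¹)) hφ0 hφ1
  have hL : mapSer sndK L = bracket H (mapSer fstK L) :=
    (FormalDerivation.ofDual K).δ_L_eq h (snd_kPow 1) hH
  have hY : HasFormalSum (expAdFamily (mapSer fstK φ) (mapSer sndK (seed N : Ser K[ε]))) 0 := by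
    rw [snd_seed]
    exact hasFormalSum_zero.congr fun r => by
      rw [expAdFamily, iterate_bracket_zero, rat_smul_zero]
  have hM := (FormalDerivation.ofDual K).δ_M_eq h hY hH
  rw [add_zero] at hM
  refine ⟨H, hHW, hH, hL, hM, fun n => ?_⟩
  have h1 := congrArg (mapCoef sndK)
    ((h.t_flow n).kCoeff_zero_nabla hφ (by simpa using pd_mem_W hφ (Var.t n)))
  rw [kCoeff_pd, kCoeff_neg, kCoeff_zero_nonpos, mapCoef_pderiv, ← kCoeff_neg, mapCoef_kCoeff,
    mapCoef_kCoeff, show mapSer sndK (-L ^ (n : ℕ)) = -mapSer sndK (L ^ (n : ℕ)) from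
      map_neg (FormalDerivation.ofDual K).δ _, snd_pow_eq_bracket hL, kCoeff_neg] at h1
  rw [HasFormalSum.kCoeff_zero_nabla hφ0 hφ1 hH, ← h1]

/-- The variation of every dressing function of the deformed solution is generated by
`F(L, M)_{≤ 0}`, up to a function of `s`. -/
theorem IsSolution.exists_onlyS {D : Data K} (hD : IsSolution N D) {f g : Ser K}
    (hfg : IsTwistorData f g D.L D.M) {F : Ser K} (hF : IsTwistorFun F) (hFs : pd Var.s F = 0)
    {Lε Pε Mε φε : Ser K[ε]} (hLu : IsUnit Lε) (hL0 : mapSer fstK Lε = D.L)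
    (hM0 : mapSer fstK Mε = D.M) (hfgε : IsTwistorData (flow F f) (flow F g) Lε Mε) {G : Ser K}
    (hG : HasFormalSum (substFamily F D.L D.M) G) (hφ : IsDressing N Lε Pε Mε φε) :
    ∃ c : Coef K, OnlyS c ∧
      HasFormalSum (nablaFamily (mapSer fstK φε) (mapSer sndK φε)) (nonpos G + cst c) ∧
      mapSer sndK Lε = bracket (nonpos G) D.L ∧ mapSer sndK Mε = bracket (nonpos G) D.M := by
  obtain ⟨H, hHW, hH, hL, hM, ht⟩ := hφ.exists_variation
  rw [hL0] at hL ht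
  rw [hM0] at hM
  obtain ⟨c, hcx, rfl⟩ := exists_generator_eq hD hfg hF hLu hL0 hM0 hfgε hG hHW hL hM
  simp only [bracket_add_left, bracket_cst_left _ hcx, add_zero] at hL hM ht
  refine ⟨c, ⟨hcx, fun n => ?_⟩, hH, hL, hM⟩
  have h1 := ht n
  rw [kCoeff_add, kCoeff_zero_nonpos, kCoeff_cst_zero, map_add,
    hD.pderiv_kCoeff_zero_subst hFs hG, bracket_skew, kCoeff_neg] at h1
  linear_combination h1

theorem hasFormalSum_todd_sub_cst {φ X Y : Ser K} {c : Coef K} (hφ : φ ∈ W K 0 0)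
    (hX : X ∈ W K 0 0) (hc : MvPowerSeries.pderiv K Var.x c = 0)
    (h : HasFormalSum (nablaFamily φ X) (Y + cst c)) :
    HasFormalSum (toddFamily φ Y) (X - cst c) := by
  refine ((hasFormalSum_todd hφ hX h).sub (hasFormalSum_todd_cst φ hc)).congr fun r => ?_
  rw [toddFamily, toddFamily, toddFamily, iterate_bracket_add, rat_smul_add, add_sub_cancel_right]

end Dressing

/-! ### Variation of `log P` -/

section LogVariation

open DualNumber

variable {K : Type*} [Field K] [CharZero K] {N : ℕ}

theorem IsMonicSer.fst_logReg {A : Ser K[ε]} (h : IsMonicSer N A) :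
    mapSer fstK (logReg N A) = logReg N (mapSer fstK A) := by
  refine (h.hasFormalSum_logReg.1.mapSer fstK).unique (h.fst.hasFormalSum_logReg.1.congr
    fun r => ?_)
  have h1 := (FormalDerivation.ofDual K).h₀_rat_smul ((-1 : ℚ) ^ r / ((r : ℚ) + 1))
    ((A * kPow (-(N : ℤ)) - 1) ^ (r + 1))
  refine h1.trans ?_
  congr 1
  refine (fst_pow _ _).trans ?_
  rw [mapSer_sub, fst_mul, fst_kPow, fst_one]

theorem IsMonicSer.fst_dkLog {A : Ser K[ε]} (h : IsMonicSer N A) :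
    mapSer fstK (dkLog N A) = dkLog N (mapSer fstK A) := by
  rw [dkLog, mapSer_add, fst_mul, fst_natCast, fst_kPow, mapSer_dk, h.fst_logReg, dkLog]

theorem snd_dkLog (A : Ser K[ε]) : mapSer sndK (dkLog N A) = dk (mapSer sndK (logReg N A)) := by
  rw [dkLog, mapSer_add, snd_mul, snd_natCast, snd_kPow, mapSer_dk]; ring

theorem IsMonicSer.snd_logBracket {P : Ser K[ε]} (h : IsMonicSer N P) (A : Ser K[ε]) :
    mapSer sndK (logBracket N P A) = logBracket N (mapSer fstK P) (mapSer sndK A) +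
      bracket (mapSer sndK (logReg N P)) (mapSer fstK A) := by
  rw [logBracket, mapSer_sub, snd_mul, snd_mul, h.fst_dkLog, snd_dkLog]
  simp only [mapSer_pd, mapSer_dk, h.fst_logReg, logBracket, bracket]
  ring

/-- The variation of `log P` is determined by those of `L` and `M`: both sides have the same
brackets with `L` and `M`, so that they differ by a function of `t`, and both are of negative
degree. -/
theorem IsSolution.snd_logReg {Dε : Data K[ε]} (hDε : IsSolution N Dε)
    (hD : IsSolution N (atZero Dε)) {H : Ser K} (hH : H ∈ W K 0 0)
    (hL : mapSer sndK Dε.L = bracket H (mapSer fstK Dε.L))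
    (hM : mapSer sndK Dε.M = bracket H (mapSer fstK Dε.M)) :
    mapSer sndK (logReg N Dε.P) =
      pd Var.s (neg H) - logBracket N (mapSer fstK Dε.P) H := by
  have hP := hDε.form_P.isMonicSer
  have key : ∀ A : Ser K[ε], pd Var.s A = logBracket N Dε.P A →
      mapSer sndK A = bracket H (mapSer fstK A) →
      pd Var.s (mapSer fstK A) = logBracket N (mapSer fstK Dε.P) (mapSer fstK A) →
      bracket (mapSer sndK (logReg N Dε.P) + logBracket N (mapSer fstK Dε.P) H - pd Var.s H)
        (mapSer fstK A) = 0 := fun A h1 h2 h3 => by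
    have h4 := congrArg (mapSer sndK) h1
    rw [mapSer_pd, hP.snd_logBracket, h2, pd_bracket, h3, logBracket_bracket] at h4
    rw [bracket_sub_left, bracket_add_left]
    linear_combination -h4
  have hZ := eq_cst_of_bracket_eq_zero hD.dressing.bracket_L_M (key _ hDε.lax_s hL hD.lax_s)
    (key _ hDε.pd_s_M hM hD.pd_s_M)
  have hN := congrArg neg hZ
  rw [neg_cst, neg, part_sub, part_add, ← neg, ← neg, ← neg,
    neg_eq_self (mapSer_mem_W sndK hP.hasFormalSum_logReg.2),
    neg_eq_self (hP.fst.logBracket_mem_W hH)] at hN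
  have : neg (pd Var.s H) = pd Var.s (neg H) := part_pd _ _ _
  rw [this] at hN
  linear_combination hN

end LogVariation

/-! ### Variation of the coefficients of the Orlov function -/

theorem res_pow_mul_dk_nonpos {R : Type*} [CommRing R] (L G : Ser R) (m : ℕ+) :
    res (L ^ (m : ℕ) * dk (nonpos G)) = -res (G * dk (B L m)) := by
  have h1 : res (nonpos (L ^ (m : ℕ)) * dk (neg G)) = 0 :=
    res_mul_of_mem_W (nonpos_mem_W _) (dk_mem_W (neg_mem_W G)) (by norm_num)
  have h2 : res (B L m * dk (nonneg G)) = 0 :=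
    res_mul_of_mem_V (V_mono zero_le_one (show B L m ∈ V R 1 from pos_mem_V _))
      (dk_mem_V (nonneg_mem_V G))
  have h3 : res (B L m * dk G) = -res (G * dk (B L m)) := by rw [res_mul_dk, mul_comm]
  have h4 : L ^ (m : ℕ) * dk (nonpos G) = nonpos (L ^ (m : ℕ)) * dk (neg G) + B L m * dk G -
      B L m * dk (nonneg G) := by
    have h5 := congrArg dk (nonneg_add_neg G)
    rw [dk_add] at h5
    rw [dk_nonpos, ← h5]
    linear_combination -dk (neg G) * nonpos_add_B L m
  rw [h4, res_sub, res_add, h1, h2, h3]; ring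

section OrlovVariation

open DualNumber

variable {K : Type*} [Field K] {N : ℕ}

/-- `Res L ^ i dL`. -/
theorem res_zpow_mul_dk [CharZero K] {U : (Ser K)ˣ} (hU : IsMonicSer 1 (U : Ser K)) (i : ℤ) :
    res (((U ^ i : (Ser K)ˣ) : Ser K) * dk (U : Ser K)) = if i = -1 then 1 else 0 := by
  split_ifs with hi
  · subst hi
    have h1 : IsMonicSer ((1 : ℕ) : ℤ) (U : Ser K) := by simpa using hU
    rw [zpow_neg_one, ← h1.mul_dkLog, ← mul_assoc, Units.inv_mul, one_mul, dkLog, res_add, res_dk,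
      add_zero, Nat.cast_one, one_mul]
    refine MvPowerSeries.ext fun d => ?_
    classical
    rw [res, coeff_kCoeff, cf_kPow, MvPowerSeries.coeff_one]
    simp
  · have h1 : dk ((U ^ (i + 1) : (Ser K)ˣ) : Ser K) =
        ((i + 1 : ℤ) : Ser K) * (((U ^ (i + 1 - 1) : (Ser K)ˣ) : Ser K) * dk (U : Ser K)) :=
      (FormalDerivation.ofK K).δ_zpow U (i + 1)
    rw [add_sub_cancel_right, ← intCast_scalar_smul] at h1
    have h2 := congrArg res h1
    rw [res_dk] at h2
    refine MvPowerSeries.ext fun d => ?_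
    have h3 := congrArg (MvPowerSeries.coeff d) h2
    rw [res, coeff_kCoeff, cf_scalar_smul, map_zero] at h3
    rw [map_zero, res, coeff_kCoeff]
    refine (mul_eq_zero.1 h3.symm).resolve_left ?_
    exact_mod_cast fun h : i + 1 = 0 => hi (by omega)

section OrlovFamily

variable {R : Type*} [CommRing R]

/-- The terms of `∑ n t_n L ^ (n - 1) + ∑ v_n L ^ (-n - 1)`. -/
noncomputable def orlovFamily (U : (Ser R)ˣ) (v : ℕ+ → Coef R) (n : ℕ+) : Ser R :=
  ((n : ℕ) : Ser R) * (MvPowerSeries.X (Var.t n) * ((U ^ ((n : ℤ) - 1) : (Ser R)ˣ) : Ser R)) +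
    cst (v n) * ((U ^ (-(n : ℤ) - 1) : (Ser R)ˣ) : Ser R)

theorem IsOrlovExpansion.hasFormalSum {U : (Ser R)ˣ} {M : Ser R} {v : ℕ+ → Coef R}
    (h : IsOrlovExpansion N (U : Ser R) M v) : HasFormalSum (orlovFamily U v)
      (M - MvPowerSeries.X Var.x -
        (N : Ser R) * (MvPowerSeries.X Var.s * ((U ^ (-1 : ℤ) : (Ser R)ˣ) : Ser R))) := by
  rw [IsOrlovExpansion, zPow_units] at h
  exact h.congr fun n => by rw [orlovFamily, zPow_units, zPow_units]

theorem bracket_X_mul (H A : Ser R) {v : Var} (hv : v ≠ Var.x) :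
    bracket H (MvPowerSeries.X v * A) = MvPowerSeries.X v * bracket H A := by
  rw [bracket_mul_right]
  simp only [bracket, dk_X, pd_X, if_neg hv.symm]
  ring

theorem bracket_natCast_mul (H A : Ser R) (n : ℕ) :
    bracket H ((n : Ser R) * A) = n * bracket H A := by
  rw [bracket_mul_right, bracket_skew H n, bracket_natCast_left]; ring

theorem bracket_X_x (H : Ser R) : bracket H (MvPowerSeries.X Var.x) = dk H := by
  rw [bracket, pd_X, if_pos rfl, dk_X]; ring

theorem bracket_orlovFamily (H : Ser R) (U : (Ser R)ˣ) (v : ℕ+ → Coef R) (n : ℕ+) :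
    bracket H (orlovFamily U v n) =
      ((n : ℕ) : Ser R) * (MvPowerSeries.X (Var.t n) *
        bracket H ((U ^ ((n : ℤ) - 1) : (Ser R)ˣ) : Ser R)) +
      cst (v n) * bracket H ((U ^ (-(n : ℤ) - 1) : (Ser R)ˣ) : Ser R) +
      dk H * cst (MvPowerSeries.pderiv R Var.x (v n)) *
        ((U ^ (-(n : ℤ) - 1) : (Ser R)ˣ) : Ser R) := by
  rw [orlovFamily, bracket_add_right, bracket_natCast_mul, bracket_X_mul _ _ (by simp),
    bracket_mul_right]
  have : bracket H (cst (v n)) = dk H * cst (MvPowerSeries.pderiv R Var.x (v n)) := by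
    rw [bracket, pd_cst, dk_cst]; ring
  rw [this]; ring

/-- `ad L` applied to the Orlov expansion. -/
theorem hasFormalSum_bracket_orlov {U : (Ser R)ˣ} {M : Ser R} {v : ℕ+ → Coef R}
    (h : IsOrlovExpansion N (U : Ser R) M v) (hM : bracket (U : Ser R) M = 1) :
    HasFormalSum (fun n : ℕ+ => dk (U : Ser R) * cst (MvPowerSeries.pderiv R Var.x (v n)) *
      ((U ^ (-(n : ℤ) - 1) : (Ser R)ˣ) : Ser R)) (1 - dk (U : Ser R)) := by
  have hU : ∀ i : ℤ, bracket (U : Ser R) ((U ^ i : (Ser R)ˣ) : Ser R) = 0 := fun i => by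
    rw [bracket_skew, bracket_zpow_left, bracket_self]; ring
  have h1 := h.hasFormalSum.bracket_right (U : Ser R)
  rw [bracket_sub_right, bracket_sub_right, bracket_natCast_mul, bracket_X_mul _ _ (by simp),
    hU, hM, bracket_X_x, mul_zero, mul_zero, sub_zero] at h1
  refine h1.congr fun n => ?_
  rw [bracket_orlovFamily, hU, hU]; ring

end OrlovFamily

theorem snd_X_mul (v : Var) (A : Ser K[ε]) : mapSer sndK (MvPowerSeries.X v * A) =
    MvPowerSeries.X v * mapSer sndK A := by
  rw [snd_mul, fst_X, snd_X]; ring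

theorem snd_natCast_mul (n : ℕ) (A : Ser K[ε]) : mapSer sndK ((n : Ser K[ε]) * A) =
    n * mapSer sndK A := by
  rw [snd_mul, fst_natCast, snd_natCast]; ring

/-- The difference of the `ε`-coefficient and of `ad H` of the Orlov expansion. -/
theorem hasFormalSum_snd_orlov {V : (Ser K[ε])ˣ} {U : (Ser K)ˣ} {Mε : Ser K[ε]} {H : Ser K}
    {v : ℕ+ → Coef K[ε]} (h0 : ∀ i : ℤ, mapSer fstK ((V ^ i : (Ser K[ε])ˣ) : Ser K[ε]) =
      ((U ^ i : (Ser K)ˣ) : Ser K))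
    (h1 : ∀ i : ℤ, mapSer sndK ((V ^ i : (Ser K[ε])ˣ) : Ser K[ε]) =
      bracket H ((U ^ i : (Ser K)ˣ) : Ser K))
    (hM : mapSer sndK Mε = bracket H (mapSer fstK Mε))
    (h : IsOrlovExpansion N (V : Ser K[ε]) Mε v)
    (h' : IsOrlovExpansion N (U : Ser K) (mapSer fstK Mε) fun n => mapCoef fstK (v n)) :
    HasFormalSum (fun n : ℕ+ => (cst (mapCoef sndK (v n)) -
      dk H * cst (MvPowerSeries.pderiv K Var.x (mapCoef fstK (v n)))) *
        ((U ^ (-(n : ℤ) - 1) : (Ser K)ˣ) : Ser K)) (dk H) := by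
  have h2 := (h.hasFormalSum.mapSer sndK).sub (h'.hasFormalSum.bracket_right H)
  rw [mapSer_sub, mapSer_sub, hM, snd_X, snd_natCast_mul, snd_X_mul, h1, bracket_sub_right,
    bracket_sub_right, bracket_natCast_mul, bracket_X_mul _ _ (by simp), bracket_X_x] at h2
  have h3 : ∀ a b c : Ser K, a - 0 - b - (a - c - b) = c := fun a b c => by ring
  rw [h3] at h2
  refine h2.congr fun n => ?_
  rw [bracket_orlovFamily, orlovFamily, mapSer_add, snd_natCast_mul, snd_X_mul, h1, snd_mul,
    mapSer_cst, mapSer_cst, h0, h1]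
  ring

variable [CharZero K]

/-- If the solution is deformed along `ad H`, then `∂H/∂k = ∑ δv_n L ^ (-n-1) ∂L/∂k`, so that
the variation of `v_n` is a residue. -/
theorem IsSolution.snd_v {Dε : Data K[ε]} (hDε : IsSolution N Dε)
    (hD : IsSolution N (atZero Dε)) {H : Ser K}
    (hL : mapSer sndK Dε.L = bracket H (mapSer fstK Dε.L))
    (hM : mapSer sndK Dε.M = bracket H (mapSer fstK Dε.M)) (m : ℕ+) :
    mapCoef sndK (Dε.v m) = res (mapSer fstK Dε.L ^ (m : ℕ) * dk H) := by
  obtain ⟨V, hV, -, -⟩ := hDε.exists_unit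
  obtain ⟨U, hV0⟩ : ∃ U : (Ser K)ˣ, ∀ i : ℤ, mapSer fstK ((V ^ i : (Ser K[ε])ˣ) : Ser K[ε]) =
    ((U ^ i : (Ser K)ˣ) : Ser K) := ⟨_, fst_units_zpow V⟩
  have hUL : (U : Ser K) = mapSer fstK Dε.L := by
    have := hV0 1
    rwa [zpow_one, zpow_one, hV, eq_comm] at this
  have hV1 : ∀ i : ℤ, mapSer sndK ((V ^ i : (Ser K[ε])ˣ) : Ser K[ε]) =
      bracket H ((U ^ i : (Ser K)ˣ) : Ser K) := fun i => by
    rw [← hV0]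
    rw [← hV] at hL
    exact (FormalDerivation.ofDual K).δ_zpow_eq_bracket hL i
  have hoε : IsOrlovExpansion N (V : Ser K[ε]) Dε.M Dε.v := by rw [hV]; exact hDε.orlov
  have ho : IsOrlovExpansion N (U : Ser K) (mapSer fstK Dε.M) fun n => mapCoef fstK (Dε.v n) := by
    rw [hUL]; exact hD.orlov
  have h1 := hasFormalSum_snd_orlov hV0 hV1 hM hoε ho
  have h2 := hasFormalSum_bracket_orlov ho (by rw [hUL]; exact hD.dressing.bracket_L_M)
  have h3 : HasFormalSum (fun n : ℕ+ => cst (mapCoef sndK (Dε.v n)) *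
      (((U ^ ((m : ℤ) - n - 1) : (Ser K)ˣ) : Ser K) * dk (U : Ser K)))
      ((U : Ser K) ^ (m : ℕ) * dk H) := by
    have h4 := ((h1.mul_left (dk (U : Ser K))).add (h2.mul_left (dk H))).mul_left
      ((U : Ser K) ^ (m : ℕ))
    rw [show dk (U : Ser K) * dk H + dk H * (1 - dk (U : Ser K)) = dk H by ring] at h4
    refine h4.congr fun n => ?_
    have : ((U ^ ((m : ℤ) - n - 1) : (Ser K)ˣ) : Ser K) =
        (U : Ser K) ^ (m : ℕ) * ((U ^ (-(n : ℤ) - 1) : (Ser K)ˣ) : Ser K) := by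
      rw [← Units.val_pow_eq_pow_val, ← Units.val_mul, ← zpow_natCast, ← zpow_add]
      congr 2
      ring
    rw [this]; ring
  have hmon : IsMonicSer 1 (U : Ser K) := by rw [hUL]; exact hD.form_L.isMonicSer
  refine MvPowerSeries.ext fun d => ?_
  rw [res, coeff_kCoeff, ← hUL, ← h3.finsum_cf d (-1), finsum_eq_single _ m]
  · rw [cf_cst_mul, ← res, res_zpow_mul_dk hmon, if_pos (by ring), mul_one]
  · intro n hn
    rw [cf_cst_mul, ← res, res_zpow_mul_dk hmon, if_neg, mul_zero, map_zero]
    intro h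
    exact hn (PNat.coe_injective (by omega))

end OrlovVariation

/-! ### Variation of the potentials -/

section LogDerivative

variable {R : Type*} [CommRing R] [Algebra ℚ R] {N : ℕ}

theorem logBracket_kPow_one {P : Ser R} : logBracket N P (kPow 1) = -pd Var.x (logReg N P) := by
  rw [logBracket, pd_kPow, dk_kPow, sub_self, kPow_zero]; simp

theorem IsSolution.pd_t_dkLog {D : Data R} (hD : IsSolution N D) (n : ℕ+) :
    pd (Var.t n) (dkLog N D.P) =
      pd Var.s (dk (B D.L n)) - dk (logBracket N D.P (B D.L n)) := by
  rw [pd_dkLog, hD.lax_P, dk_sub, dk_pd, dk_nonneg, B]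

theorem IsSolution.pd_x_dkLog {D : Data R} (hD : IsSolution N D) :
    pd Var.x (dkLog N D.P) = pd (Var.t 1) (dkLog N D.P) := by
  rw [hD.pd_t_dkLog, B_one hD.form_L, logBracket_kPow_one, dk_kPow, sub_self, kPow_zero, pd_dkLog,
    dk_neg, Int.cast_one, one_mul, pd_one]
  ring

/-- The skew part of the bilinear form `(A, B) ↦ Res A d_k {log P, B}`. -/
theorem res_mul_dk_logBracket_sub (P A B : Ser R) :
    res (A * dk (logBracket N P B)) - res (B * dk (logBracket N P A)) =
      -res (bracket A B * dkLog N P) := by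
  rw [res_mul_dk, res_mul_dk, sub_neg_eq_add, ← sub_eq_neg_add, ← res_sub, ← res_neg]
  congr 1
  simp only [logBracket, bracket]
  ring

end LogDerivative

section Potentials

open DualNumber

variable {K : Type*} [Field K] [CharZero K] {N : ℕ}

theorem IsSolution.isPhi_expandCoef_iff {Dε : Data K[ε]} {D : Data K} (hD : IsSolution N D)
    (hL0 : mapSer fstK Dε.L = D.L) {F G : Ser K} (hFs : pd Var.s F = 0)
    (hG : HasFormalSum (substFamily F D.L D.M) G)
    (hL : mapSer sndK Dε.L = bracket (nonpos G) D.L) {q q' : Coef K} (hq : IsPhi D.L q) :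
    IsPhi Dε.L (expandCoef q q') ↔ OnlyS (q' + kCoeff 0 G) := by
  rw [← hL0] at hL
  have ht : ∀ n : ℕ+, mapCoef sndK (kCoeff 0 (Dε.L ^ (n : ℕ))) =
      -MvPowerSeries.pderiv K (Var.t n) (kCoeff 0 G) := fun n => by
    rw [mapCoef_kCoeff, snd_pow_eq_bracket hL, hL0, hD.pderiv_kCoeff_zero_subst hFs hG,
      bracket_skew, kCoeff_neg]
  have hx : MvPowerSeries.pderiv K Var.x (kCoeff 0 G) =
      MvPowerSeries.pderiv K (Var.t 1) (kCoeff 0 G) := by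
    rw [← kCoeff_pd, ← kCoeff_pd, hD.pd_x_subst hFs hG]
  have h1 : ∀ n : ℕ+, MvPowerSeries.pderiv K[ε] (Var.t n) (expandCoef q q') =
      kCoeff 0 (Dε.L ^ (n : ℕ)) ↔ MvPowerSeries.pderiv K (Var.t n) (q' + kCoeff 0 G) = 0 :=
    fun n => by
      rw [coef_dual_ext_iff, mapCoef_pderiv, mapCoef_pderiv, fst_expandCoef, snd_expandCoef,
        mapCoef_kCoeff, fst_pow, hL0, ht, hq.t_flow, map_add, eq_neg_iff_add_eq_zero]
      exact and_iff_right rfl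
  have h2 : MvPowerSeries.pderiv K[ε] Var.x (expandCoef q q') =
      MvPowerSeries.pderiv K[ε] (Var.t 1) (expandCoef q q') ↔
      MvPowerSeries.pderiv K Var.x (q' + kCoeff 0 G) =
        MvPowerSeries.pderiv K (Var.t 1) (q' + kCoeff 0 G) := by
    rw [coef_dual_ext_iff, mapCoef_pderiv, mapCoef_pderiv, mapCoef_pderiv, mapCoef_pderiv,
      fst_expandCoef, snd_expandCoef, map_add, map_add, hx, add_left_inj]
    exact and_iff_right hq.x_flow
  refine ⟨fun h => ?_, fun h => ⟨fun n => (h1 n).2 (h.2 n), h2.2 (by rw [h.1, h.2])⟩⟩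
  have ht' := fun n => (h1 n).1 (h.t_flow n)
  exact ⟨(h2.1 h.x_flow).trans (ht' 1), ht'⟩

/-- The variation of `Res L ^ n d_k log P` is minus the `t_n`-derivative of
`Res F(L, M) d_k log P`. -/
theorem IsSolution.res_variation {D : Data K} (hD : IsSolution N D) {F G : Ser K}
    (hFs : pd Var.s F = 0) (hG : HasFormalSum (substFamily F D.L D.M) G) (n : ℕ+) :
    res (D.L ^ (n : ℕ) * dk (pd Var.s (neg G) - logBracket N D.P (nonpos G)) +
        bracket (nonpos G) (D.L ^ (n : ℕ)) * dkLog N D.P) =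
      -MvPowerSeries.pderiv K (Var.t n) (res (G * dkLog N D.P)) := by
  have hs : pd Var.s (D.L ^ (n : ℕ)) = logBracket N D.P (D.L ^ (n : ℕ)) := by
    have h1 := (FormalDerivation.ofVar K Var.s).δ_pow_succ D.L ((n : ℕ) - 1)
    have h2 := (logAd N D.P).δ_pow_succ D.L ((n : ℕ) - 1)
    rw [Nat.sub_add_cancel n.pos] at h1 h2
    change pd Var.s (D.L ^ (n : ℕ)) = _ * (D.L ^ _ * pd Var.s D.L) at h1
    change logBracket N D.P (D.L ^ (n : ℕ)) = _ * (D.L ^ _ * logBracket N D.P D.L) at h2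
    rw [h1, h2, hD.lax_s]
  set l := D.L ^ (n : ℕ) with hl
  have hlB : nonpos l + B D.L n = l := nonpos_add_B D.L n
  have hBV : B D.L n ∈ V K 0 := V_mono zero_le_one (show B D.L n ∈ V K 1 from pos_mem_V _)
  have hWs : ∀ A ∈ W K 0 (-1), pd Var.s A ∈ W K 0 (-1) := fun A hA => by
    simpa using pd_mem_W hA Var.s
  -- In the terms with `∂/∂s` only `B_n` and `F(L, M)_{≤ 0}` contribute.
  have e1 : res (l * dk (pd Var.s (neg G))) = res (B D.L n * dk (logBracket N D.P G)) := by
    have h1 : res (nonpos l * dk (pd Var.s (neg G))) = 0 :=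
      res_mul_of_mem_W (nonpos_mem_W _) (dk_mem_W (hWs _ (neg_mem_W G))) (by norm_num)
    have h2 : res (B D.L n * dk (pd Var.s (nonneg G))) = 0 :=
      res_mul_of_mem_V hBV (dk_mem_V (pd_mem_V (nonneg_mem_V G) _))
    have h3 : l * dk (pd Var.s (neg G)) = nonpos l * dk (pd Var.s (neg G)) +
        B D.L n * dk (logBracket N D.P G) - B D.L n * dk (pd Var.s (nonneg G)) := by
      have h5 := congrArg (fun A => dk (pd Var.s A)) (nonneg_add_neg G)
      simp only [pd_add, dk_add] at h5
      rw [← hD.pd_s_subst hFs hG, ← h5]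
      linear_combination -dk (pd Var.s (neg G)) * hlB
    rw [h3, res_sub, res_add, h1, h2]; ring
  have e2 : res (G * pd Var.s (dk (B D.L n))) = res (nonpos G * dk (logBracket N D.P l)) := by
    have h1 : res (nonpos G * pd Var.s (dk (nonpos l))) = 0 := by
      rw [dk_nonpos, ← dk_pd]
      exact res_mul_of_mem_W (nonpos_mem_W _) (dk_mem_W (hWs _ (neg_mem_W l))) (by norm_num)
    have h2 : res (pos G * pd Var.s (dk (B D.L n))) = 0 :=
      res_mul_of_mem_V (V_mono zero_le_one (pos_mem_V G)) (pd_mem_V (dk_mem_V hBV) _)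
    have h3 : G * pd Var.s (dk (B D.L n)) = nonpos G * dk (logBracket N D.P l) -
        nonpos G * pd Var.s (dk (nonpos l)) + pos G * pd Var.s (dk (B D.L n)) := by
      have h5 := congrArg (fun A => pd Var.s (dk A)) hlB
      simp only [pd_add, dk_add] at h5
      rw [← hs, dk_pd, ← h5]
      linear_combination -pd Var.s (dk (B D.L n)) * nonpos_add_pos G
    rw [h3, res_add, res_sub, h1, h2]; ring
  have e3 := res_mul_dk_logBracket_sub (N := N) D.P (B D.L n) G
  have e4 := res_mul_dk_logBracket_sub (N := N) D.P (nonpos G) l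
  rw [← res_pd, pd_mul, hD.pd_t_subst hFs hG, hD.pd_t_dkLog, dk_sub, mul_sub, mul_sub, res_add,
    res_add, res_sub, res_sub, e1, e2]
  linear_combination e3 + e4

theorem IsSolution.isBigPhi_expandCoef_iff {Dε : Data K[ε]} {D : Data K} (hDε : IsSolution N Dε)
    (hD : IsSolution N D) (hL0 : mapSer fstK Dε.L = D.L) (hP0 : mapSer fstK Dε.P = D.P)
    {F G : Ser K} (hFs : pd Var.s F = 0) (hG : HasFormalSum (substFamily F D.L D.M) G)
    (hL : mapSer sndK Dε.L = bracket (nonpos G) D.L)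
    (hP : mapSer sndK (logReg N Dε.P) = pd Var.s (neg G) - logBracket N D.P (nonpos G))
    {q q' : Coef K} (hq : IsBigPhi N D.L D.P q) :
    IsBigPhi N Dε.L Dε.P (expandCoef q q') ↔ OnlyS (q' + res (G * dkLog N D.P)) := by
  rw [← hL0] at hL
  have ht0 : ∀ n : ℕ+, mapCoef fstK (res (Dε.L ^ (n : ℕ) * dkLog N Dε.P)) =
      res (D.L ^ (n : ℕ) * dkLog N D.P) := fun n => by
    rw [res, mapCoef_kCoeff, fst_mul, fst_pow, hDε.form_P.isMonicSer.fst_dkLog, hL0, hP0, res]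
  have ht : ∀ n : ℕ+, mapCoef sndK (res (Dε.L ^ (n : ℕ) * dkLog N Dε.P)) =
      -MvPowerSeries.pderiv K (Var.t n) (res (G * dkLog N D.P)) := fun n => by
    rw [res, mapCoef_kCoeff, snd_mul, fst_pow, hDε.form_P.isMonicSer.fst_dkLog, snd_dkLog,
      snd_pow_eq_bracket hL, hL0, hP0, hP]
    exact hD.res_variation hFs hG n
  have hx : MvPowerSeries.pderiv K Var.x (res (G * dkLog N D.P)) =
      MvPowerSeries.pderiv K (Var.t 1) (res (G * dkLog N D.P)) := by
    rw [← res_pd, ← res_pd, pd_mul, pd_mul, hD.pd_x_subst hFs hG, hD.pd_x_dkLog]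
  have h1 : ∀ n : ℕ+, MvPowerSeries.pderiv K[ε] (Var.t n) (expandCoef q q') =
      res (Dε.L ^ (n : ℕ) * dkLog N Dε.P) ↔
        MvPowerSeries.pderiv K (Var.t n) (q' + res (G * dkLog N D.P)) = 0 := fun n => by
    rw [coef_dual_ext_iff, mapCoef_pderiv, mapCoef_pderiv, fst_expandCoef, snd_expandCoef, ht0, ht,
      hq.t_flow, map_add, eq_neg_iff_add_eq_zero]
    exact and_iff_right rfl
  have h2 : MvPowerSeries.pderiv K[ε] Var.x (expandCoef q q') =
      MvPowerSeries.pderiv K[ε] (Var.t 1) (expandCoef q q') ↔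
      MvPowerSeries.pderiv K Var.x (q' + res (G * dkLog N D.P)) =
        MvPowerSeries.pderiv K (Var.t 1) (q' + res (G * dkLog N D.P)) := by
    rw [coef_dual_ext_iff, mapCoef_pderiv, mapCoef_pderiv, mapCoef_pderiv, mapCoef_pderiv,
      fst_expandCoef, snd_expandCoef, map_add, map_add, hx, add_left_inj]
    exact and_iff_right hq.x_flow
  refine ⟨fun h => ?_, fun h => ⟨fun n => (h1 n).2 (h.2 n), h2.2 (by rw [h.1, h.2])⟩⟩
  have ht' := fun n => (h1 n).1 (h.t_flow n)
  exact ⟨(h2.1 h.x_flow).trans (ht' 1), ht'⟩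

end Potentials

section AddFunctionOfS

open DualNumber

variable {K : Type*} [Field K]

theorem expand_add_cst (A A' : Ser K) (c : Coef K) :
    expand A (A' + cst c) = expand A A' + cst (expandCoef 0 c) := by
  have h0 : mapCoef fstK (expandCoef 0 c) = 0 := fst_expandCoef 0 c
  refine ser_dual_ext ?_ ?_
  · rw [fst_expand, mapSer_add, fst_expand, mapSer_cst, h0, cst_zero, add_zero]
  · rw [snd_expand, mapSer_add, snd_expand, mapSer_cst, snd_expandCoef]

theorem OnlyS.expandCoef_zero {c : Coef K} (h : OnlyS c) : OnlyS (expandCoef 0 c) := by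
  have key : ∀ v, MvPowerSeries.pderiv K v c = 0 →
      MvPowerSeries.pderiv K[ε] v (expandCoef 0 c) = 0 := fun v hv => by
    refine coef_dual_ext_iff.2 ⟨?_, ?_⟩
    · rw [mapCoef_pderiv, fst_expandCoef, map_zero]
      exact MvPowerSeries.ext fun d => by rw [coeff_mapCoef, map_zero, map_zero, map_zero]
    · rw [mapCoef_pderiv, snd_expandCoef, hv]
      exact MvPowerSeries.ext fun d => by rw [coeff_mapCoef, map_zero, map_zero, map_zero]
  exact ⟨key _ h.1, fun n => key _ (h.2 n)⟩

theorem OnlyS.sub {R : Type*} [CommRing R] {a b : Coef R} (ha : OnlyS a) (hb : OnlyS b) :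
    OnlyS (a - b) :=
  ⟨by rw [map_sub, ha.1, hb.1, sub_zero], fun n => by rw [map_sub, ha.2, hb.2, sub_zero]⟩

end AddFunctionOfS

end DcmKP

open DcmKP DualNumber in
theorem mainTheorem11 {K : Type*} [Field K] [CharZero K] (N : ℕ)
    -- a solution `D`, with twistor data `(f, g)`
    (D : Data K) (hD : IsSolution N D)
    (f g : Ser K) (hfg : IsTwistorData f g D.L D.M)
    -- a function `F(k, x)`
    (F : Ser K) (hF : IsTwistorFun F) (hFs : pd Var.s F = 0)
    -- a deformation of `D` to first order in `ε`, with twistor data `(f, g) ∘ exp (-ε ad F)`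
    (Dε : Data K[ε]) (hDε : IsSolution N Dε) (hbase : atZero Dε = D)
    (hfgε : IsTwistorData (flow F f) (flow F g) Dε.L Dε.M) :
    -- `G = F(L, M)`
    ∃ G : Ser K, HasFormalSum (substFamily F D.L D.M) G ∧
      mapSer sndK Dε.L = bracket (nonpos G) D.L ∧
      mapSer sndK Dε.M = bracket (nonpos G) D.M ∧
      mapSer sndK (logReg N Dε.P) = pd Var.s (neg G) - logBracket N D.P (nonpos G) ∧
      (∀ n : ℕ+, mapCoef sndK (Dε.v n) = -res (G * dk (B D.L n))) ∧
      -- the dressing functions `φ + ε φ'` of the deformed solution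
      (∀ φ' : Ser K, IsDressing N Dε.L Dε.P Dε.M (expand D.φ φ') →
        ∃ c : Coef K, OnlyS c ∧
          HasFormalSum (nablaFamily D.φ φ') (nonpos G + cst c) ∧
          HasFormalSum (toddFamily D.φ (nonpos G)) (φ' - cst c)) ∧
      (∀ (φ' : Ser K) (c : Coef K), OnlyS c →
        HasFormalSum (toddFamily D.φ (nonpos G)) (φ' - cst c) →
          IsDressing N Dε.L Dε.P Dε.M (expand D.φ φ')) ∧
      -- the functions `q + ε q'` with `∂/∂t_n (q + ε q') = (L(ε) ^ n)_0`
      (∀ q q' : Coef K, IsPhi D.L q →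
        (IsPhi Dε.L (expandCoef q q') ↔ OnlyS (q' + kCoeff 0 G))) ∧
      -- the functions `Φ + ε Φ'` with `∂/∂t_n (Φ + ε Φ') = Res L(ε) ^ n d_k log P(ε)`
      (∀ Φ Φ' : Coef K, IsBigPhi N D.L D.P Φ →
        (IsBigPhi N Dε.L Dε.P (expandCoef Φ Φ') ↔ OnlyS (Φ' + res (G * dkLog N D.P)))) := by
  have hD' : IsSolution N (atZero Dε) := by rw [hbase]; exact hD
  have hL0 : mapSer fstK Dε.L = D.L := congrArg Data.L hbase
  have hP0 : mapSer fstK Dε.P = D.P := congrArg Data.P hbase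
  have hφ0 : mapSer fstK Dε.φ = D.φ := congrArg Data.φ hbase
  have hM0 : mapSer fstK Dε.M = D.M := congrArg Data.M hbase
  obtain ⟨G, hG⟩ := hD.exists_subst hF
  have hLu : IsUnit Dε.L := by
    obtain ⟨U, hU, -, -⟩ := hDε.exists_unit
    exact ⟨U, hU⟩
  have hW0 : D.φ ∈ W K 0 0 := mem_W_of_form hD.dressing.form
  -- One dressing function, the given one, is needed to find the variations of `L` and `M`.
  obtain ⟨c₀, hc₀, hn₀, hL, hM⟩ :=
    hD.exists_onlyS hfg hF hFs hLu hL0 hM0 hfgε hG hDε.dressing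
  rw [hφ0] at hn₀
  have hP := hDε.snd_logReg hD' (nonpos_mem_W G) (by rw [hL0]; exact hL) (by rw [hM0]; exact hM)
  rw [neg_part_nonpos, hP0] at hP
  have hφ1 : mapSer sndK Dε.φ ∈ W K 0 0 := mapSer_mem_W sndK (mem_W_of_form hDε.dressing.form)
  have htodd₀ : HasFormalSum (toddFamily D.φ (nonpos G)) (mapSer sndK Dε.φ - cst c₀) :=
    hasFormalSum_todd_sub_cst hW0 hφ1 hc₀.1 hn₀
  refine ⟨G, hG, hL, hM, hP, fun n => ?_, fun φ' hφ' => ?_, fun φ' c hc hφ' => ?_,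
    fun q q' hq => ?_, fun Φ Φ' hΦ => ?_⟩
  · rw [hDε.snd_v hD' (by rw [hL0]; exact hL) (by rw [hM0]; exact hM) n, hL0,
      res_pow_mul_dk_nonpos]
  · obtain ⟨c, hc, hn, -, -⟩ := hD.exists_onlyS hfg hF hFs hLu hL0 hM0 hfgε hG hφ'
    rw [fst_expand, snd_expand] at hn
    have hφW : φ' ∈ W K 0 0 := by
      have := mapSer_mem_W sndK (mem_W_of_form hφ'.form)
      rwa [snd_expand] at this
    exact ⟨c, hc, hn, hasFormalSum_todd_sub_cst hW0 hφW hc.1 hn⟩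
  · have h1 : φ' = mapSer sndK Dε.φ + cst (c - c₀) := by
      rw [cst_sub]
      linear_combination hφ'.unique htodd₀
    rw [h1, expand_add_cst, ← hφ0, expand_fst_snd]
    exact hDε.dressing.add_cst (hc.sub hc₀).expandCoef_zero
  · exact hD.isPhi_expandCoef_iff hL0 hFs hG hL hq
  · exact hDε.isBigPhi_expandCoef_iff hD hL0 hP0 hFs hG hL hP hΦ
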